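/- **Existence for concave mobility.** Let $d\in\{1,2\}$, let $\Omega\subset\mathbb R^d$ be a bounded domain with Lipschitz boundary, let $\Gamma_E\subseteq\partial\Omega$ be Borel measurable (the exits), and let $T>0$, $\sigma>0$, $\beta\ge 0$, $\rho_{\max}>0$, $\Upsilon=[0,\rho_{\max}]$. Let $\rho_0\in L^2(\Omega)$ with $\rho_0(x)\in\Upsilon$ for a.e. $x\in\Omega$. Assume that * $F:\mathbb R\to\mathbb R$ is bounded, its restriction to $\Upsilon$ is $C^1$, nonnegative, concave, and positive on $(0,\rho_{\max})$, and $F=0$ on $\mathbb R\setminus\Upsilon$; * $E\in C^1(\mathbb R)$ is convex, and $E\ge 0$ on $\Upsilon$. Let $V=L^2(0,T;H^1(\Omega))\cap H^1(0,T;H^1(\Omega)^*)$ and $Q=L^2(\Omega\times(0,T);\mathbb R^d)$. A pair $(\rho,j)\in V\times Q$ is called admissible if $\rho(0)=\rho_0$ (for the representative of $\rho$ in $C([0,T];L^2(\Omega))$) and, for a.e. $t\in(0,T)$ and all $\psi\in H^1(\Omega)$, $$\langle\partial_t\rho,\psi\rangle+\int_\Omega\Big(\frac{\sigma^2}{2}\nabla\rho-j\Big)\cdot\nabla\psi\,dx=-\int_{\Gamma_E}\beta\,\rho\,\psi\,ds,$$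 where $\langle\cdot,\cdot\rangle$ is the duality pairing of $H^1(\Omega)^*$ and $H^1(\Omega)$ and the boundary values are traces. Consider the minimization, over all admissible pairs, of $$\widetilde I_T(\rho,j)=\frac12\int_0^T\!\!\int_\Omega K(j,\rho)\,dx\,dt+\frac12\int_0^T\!\!\int_\Omega E(\rho)\,dx\,dt,\qquad K(j,\rho)=\begin{cases}|j|^2/F(\rho)&\text{if }F(\rho)\neq0,\\0&\text{if }j=0,\ F(\rho)=0,\\+\infty&\text{if }j\neq0,\ F(\rho)=0.\end{cases}$$ Then this problem has a minimizer $(\rho,j)$ with $\widetilde I_T(\rho,j)<\infty$, $\rho\in L^\infty(\Omega\times(0,T))$, $\rho(x,t)\in\Upsilon$ for a.e. $(x,t)\in\Omega\times(0,T)$, and $j\in Q$. If in addition $E$ is strictly convex on $\Upsilon$, the minimizer is unique. -/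

import Mathlib

open MeasureTheory Set Filter Topology
open scoped ENNReal NNReal ContDiff

noncomputable section

namespace CrowdControl

/-- Euclidean space `ℝᵈ`. -/
abbrev Sp (d : ℕ) : Type := EuclideanSpace ℝ (Fin d)

/-- Lebesgue measure on `Ω`. -/
abbrev muOmega {d : ℕ} (Ω : Set (Sp d)) : Measure (Sp d) := volume.restrict Ω

/-- Lebesgue measure on the time interval `(0, T)`. -/
abbrev muTime (T : ℝ) : Measure ℝ := volume.restrict (Ioo 0 T)

/-- Lebesgue measure on the space-time cylinder `Ω × (0, T)`. -/
abbrev muCyl {d : ℕ} (Ω : Set (Sp d)) (T : ℝ) : Measure (Sp d × ℝ) :=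
  (muOmega Ω).prod (muTime T)

/-- Surface measure on `∂Ω`, the `(d-1)`-dimensional Hausdorff measure. (For `d = 1` it is the
counting measure, for `d = 2` it is arc length.) -/
abbrev surf {d : ℕ} (Ω : Set (Sp d)) : Measure (Sp d) :=
  (Measure.hausdorffMeasure ((d : ℝ) - 1)).restrict (frontier Ω)

/-- `Ω` has Lipschitz boundary: near each boundary point, in a suitable direction `ν`, it is
the strict epigraph of a Lipschitz function of the component orthogonal to `ν`. -/
def HasLipschitzBoundary {d : ℕ} (Ω : Set (Sp d)) : Prop :=
  ∀ x ∈ frontier Ω, ∃ r : ℝ, 0 < r ∧ ∃ ν : Sp d, ‖ν‖ = 1 ∧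
    ∃ (γ : Sp d → ℝ) (L : ℝ≥0), LipschitzWith L γ ∧
      ∀ y ∈ Metric.ball x r, (y ∈ Ω ↔ γ (y - inner ℝ ν y • ν) < inner ℝ ν y)

/-- `g` is the weak gradient of `u` in `Ω`. -/
def IsWeakGradient {d : ℕ} (Ω : Set (Sp d)) (u : Sp d → ℝ) (g : Sp d → Sp d) : Prop :=
  ∀ φ : Sp d → ℝ, ContDiff ℝ ∞ φ → HasCompactSupport φ → tsupport φ ⊆ Ω →
    ∫ x in Ω, u x • gradient φ x = - ∫ x in Ω, φ x • g x

theorem memLp_test {d : ℕ} (Ω : Set (Sp d)) {φ : Sp d → ℝ} (h : ContDiff ℝ ∞ φ)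
    (hc : HasCompactSupport φ) : MemLp φ 2 (muOmega Ω) :=
  (h.continuous.memLp_of_hasCompactSupport hc).restrict Ω

theorem memLp_gradient_test {d : ℕ} (Ω : Set (Sp d)) {φ : Sp d → ℝ} (h : ContDiff ℝ ∞ φ)
    (hc : HasCompactSupport φ) : MemLp (gradient φ) 2 (muOmega Ω) := by
  have h1 : Continuous (gradient φ) :=
    (InnerProductSpace.toDual ℝ (Sp d)).symm.continuous.comp (h.continuous_fderiv (by simp))
  have h2 : HasCompactSupport (gradient φ) :=
    (hc.fderiv ℝ).comp_left (g := (InnerProductSpace.toDual ℝ (Sp d)).symm) (by simp)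
  exact (h1.memLp_of_hasCompactSupport h2).restrict Ω

/-- The Sobolev space `H¹(Ω)` as the subspace of the pairs `(u, ∇u)` with `u ∈ L²(Ω)` and weak
gradient `∇u ∈ L²(Ω; ℝᵈ)`, with norm `(‖u‖² + ‖∇u‖²)^{1/2}`. -/
def h1Submodule {d : ℕ} (Ω : Set (Sp d)) :
    Submodule ℝ (WithLp 2 (Lp ℝ 2 (muOmega Ω) × Lp (Sp d) 2 (muOmega Ω))) where
  carrier := {p | IsWeakGradient Ω p.fst p.snd}
  zero_mem' := by
    intro φ _ _ _
    rw [integral_eq_zero_of_ae, integral_eq_zero_of_ae, neg_zero]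
    · filter_upwards [Lp.coeFn_zero (Sp d) 2 (muOmega Ω)] with x hx
      exact (congrArg (fun y => φ x • y) hx).trans (smul_zero _)
    · filter_upwards [Lp.coeFn_zero ℝ 2 (muOmega Ω)] with x hx
      exact (congrArg (fun y => y • gradient φ x) hx).trans (zero_smul _ _)
  add_mem' := by
    intro p q hp hq φ h hc hs
    have hφ := memLp_test Ω h hc
    have hg := memLp_gradient_test Ω h hc
    have e1 : ∫ x in Ω, (p + q).fst x • gradient φ x =
        ∫ x in Ω, (p.fst x • gradient φ x + q.fst x • gradient φ x) := by
      apply integral_congr_ae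
      filter_upwards [Lp.coeFn_add p.fst q.fst] with x hx
      exact (congrArg (fun y => y • gradient φ x) hx).trans (add_smul _ _ _)
    have e2 : ∫ x in Ω, φ x • (p + q).snd x =
        ∫ x in Ω, (φ x • p.snd x + φ x • q.snd x) := by
      apply integral_congr_ae
      filter_upwards [Lp.coeFn_add p.snd q.snd] with x hx
      exact (congrArg (fun y => φ x • y) hx).trans (smul_add _ _ _)
    have i1 : ∀ r : Lp ℝ 2 (muOmega Ω),
        Integrable (fun x => r x • gradient φ x) (muOmega Ω) := fun r =>
      memLp_one_iff_integrable.1 (hg.smul (Lp.memLp r))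
    have i2 : ∀ r : Lp (Sp d) 2 (muOmega Ω),
        Integrable (fun x => φ x • r x) (muOmega Ω) := fun r =>
      memLp_one_iff_integrable.1 ((Lp.memLp r).smul hφ)
    rw [e1, e2, integral_add (i1 _) (i1 _), integral_add (i2 _) (i2 _), hp φ h hc hs,
      hq φ h hc hs, neg_add]
  smul_mem' := by
    intro c p hp φ h hc hs
    have e1 : ∫ x in Ω, (c • p).fst x • gradient φ x =
        ∫ x in Ω, c • (p.fst x • gradient φ x) := by
      apply integral_congr_ae
      filter_upwards [Lp.coeFn_smul c p.fst] with x hx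
      exact (congrArg (fun y => y • gradient φ x) hx).trans (smul_assoc c (p.fst x) (gradient φ x))
    have e2 : ∫ x in Ω, φ x • (c • p).snd x = ∫ x in Ω, c • (φ x • p.snd x) := by
      apply integral_congr_ae
      filter_upwards [Lp.coeFn_smul c p.snd] with x hx
      exact (congrArg (fun y => φ x • y) hx).trans (smul_comm (φ x) c (p.snd x))
    rw [e1, e2, integral_smul, integral_smul, hp φ h hc hs, smul_neg]

/-- The Sobolev space `H¹(Ω)`, a real inner product space. -/
abbrev H1 {d : ℕ} (Ω : Set (Sp d)) : Type := ↥(h1Submodule Ω)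

/-- The underlying `L²` function of an element of `H¹(Ω)`. -/
def h1fn {d : ℕ} {Ω : Set (Sp d)} (u : H1 Ω) : Lp ℝ 2 (muOmega Ω) := u.1.fst

/-- The weak gradient of an element of `H¹(Ω)`. -/
def h1grad {d : ℕ} {Ω : Set (Sp d)} (u : H1 Ω) : Lp (Sp d) 2 (muOmega Ω) := u.1.snd

/-- `g` is the boundary trace of `u`: some sequence of functions of class `C¹` up to the
boundary converges to `u` in `H¹(Ω)` and its boundary values converge to `g` in `L²(∂Ω)`. -/
def IsTrace {d : ℕ} {Ω : Set (Sp d)} (u : H1 Ω) (g : Lp ℝ 2 (surf Ω)) : Prop :=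
  ∃ f : ℕ → Sp d → ℝ, (∀ n, ContDiff ℝ 1 (f n)) ∧
    Tendsto (fun n => eLpNorm (fun x => f n x - h1fn u x) 2 (muOmega Ω)) atTop (𝓝 0) ∧
    Tendsto (fun n => eLpNorm (fun x => gradient (f n) x - h1grad u x) 2 (muOmega Ω))
      atTop (𝓝 0) ∧
    Tendsto (fun n => eLpNorm (fun x => f n x - g x) 2 (surf Ω)) atTop (𝓝 0)

/-- The trace of `u ∈ H¹(Ω)` on `∂Ω`. On a bounded Lipschitz domain every `u` has exactly one
trace; the value chosen when there is none is never relevant there. -/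
def trace {d : ℕ} {Ω : Set (Sp d)} (u : H1 Ω) : Lp ℝ 2 (surf Ω) :=
  Classical.epsilon (IsTrace u)

/-- `u'` is the weak time derivative of `u` on `(0, T)`, where `H¹(Ω)` is embedded in its dual
through the `L²(Ω)` inner product. -/
def IsWeakTimeDeriv {d : ℕ} {Ω : Set (Sp d)} (T : ℝ) (u : ℝ → H1 Ω)
    (u' : ℝ → StrongDual ℝ (H1 Ω)) : Prop :=
  ∀ η : ℝ → ℝ, ContDiff ℝ ∞ η → HasCompactSupport η → tsupport η ⊆ Ioo 0 T → ∀ ψ : H1 Ω,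
    ∫ t in Ioo 0 T, deriv η t * (∫ x in Ω, h1fn (u t) x * h1fn ψ x) =
      - ∫ t in Ioo 0 T, η t * u' t ψ

/-- `ρ ∈ V = L²(0,T; H¹(Ω)) ∩ H¹(0,T; H¹(Ω)*)`, where `u` is `ρ` regarded as an element of
`L²(0,T; H¹(Ω))` and `u'` is its time derivative. -/
structure IsInV {d : ℕ} (Ω : Set (Sp d)) (T : ℝ) (ρ : Lp ℝ 2 (muCyl Ω T))
    (u : Lp (H1 Ω) 2 (muTime T)) (u' : Lp (StrongDual ℝ (H1 Ω)) 2 (muTime T)) : Prop where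
  slice : ∀ᵐ t ∂(muTime T), ∀ᵐ x ∂(muOmega Ω), ρ (x, t) = h1fn (u t) x
  deriv : IsWeakTimeDeriv T u u'

/-- The initial condition `ρ(0) = ρ₀`, for the representative that is continuous on `[0, T]`
with values in `L²(Ω)`. -/
def HasInitialValue {d : ℕ} {Ω : Set (Sp d)} (T : ℝ) (u : ℝ → H1 Ω)
    (ρ₀ : Lp ℝ 2 (muOmega Ω)) : Prop :=
  ∃ w : ℝ → Lp ℝ 2 (muOmega Ω), ContinuousOn w (Icc 0 T) ∧
    (∀ᵐ t ∂(muTime T), w t = h1fn (u t)) ∧ w 0 = ρ₀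

/-- The weak form of `∂ₜρ + ∇·j = (σ²/2) Δρ` with outflux `βρ` through `ΓE` and no flux
through the rest of the boundary. -/
def SatisfiesWeakEquation {d : ℕ} {Ω : Set (Sp d)} (ΓE : Set (Sp d)) (T σ β : ℝ)
    (u : ℝ → H1 Ω) (u' : ℝ → StrongDual ℝ (H1 Ω)) (j : Sp d × ℝ → Sp d) : Prop :=
  ∀ᵐ t ∂(muTime T), ∀ ψ : H1 Ω,
    u' t ψ + ∫ x in Ω, inner ℝ ((σ ^ 2 / 2) • h1grad (u t) x - j (x, t)) (h1grad ψ x) =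
      - ∫ x in ΓE, β * trace (u t) x * trace ψ x ∂(surf Ω)

/-- `(ρ, j) ∈ V × Q`, `Q = L²(Ω × (0,T))`, satisfies the constraint with initial value `ρ₀`. -/
def IsAdmissible {d : ℕ} (Ω ΓE : Set (Sp d)) (T σ β : ℝ) (ρ₀ : Lp ℝ 2 (muOmega Ω))
    (ρ : Lp ℝ 2 (muCyl Ω T)) (j : Lp (Sp d) 2 (muCyl Ω T)) : Prop :=
  ∃ (u : Lp (H1 Ω) 2 (muTime T)) (u' : Lp (StrongDual ℝ (H1 Ω)) 2 (muTime T)),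
    IsInV Ω T ρ u u' ∧ HasInitialValue T u ρ₀ ∧ SatisfiesWeakEquation ΓE T σ β u u' j

open Classical in
/-- The kinetic cost density `|j|²/F(r)`, equal to `0` if `j = 0` and `F(r) = 0`, and to `+∞` if
`j ≠ 0` and `F(r) = 0`. It is used for `F ≥ 0` only. -/
def kineticDensity {d : ℕ} (F : ℝ → ℝ) (j : Sp d) (r : ℝ) : ℝ≥0∞ :=
  if F r = 0 then (if j = 0 then 0 else ⊤) else ENNReal.ofReal (‖j‖ ^ 2 / F r)

/-- The integral of a real function as an extended real number, meaningful as soon as its negative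
part has finite integral. -/
def extIntegral {α : Type*} [MeasurableSpace α] (μ : Measure α) (f : α → ℝ) : EReal :=
  ((∫⁻ z, ENNReal.ofReal (f z) ∂μ : ℝ≥0∞) : EReal) -
    ((∫⁻ z, ENNReal.ofReal (-f z) ∂μ : ℝ≥0∞) : EReal)

/-- The functional `½ ∫∫ K(j,ρ) dx dt + ½ ∫∫ E(ρ) dx dt`. For convex `E` and `ρ ∈ L²` on a bounded
cylinder the second integral has finite negative part. -/
def cost {d : ℕ} (Ω : Set (Sp d)) (T : ℝ) (F E : ℝ → ℝ)
    (ρ : Lp ℝ 2 (muCyl Ω T)) (j : Lp (Sp d) 2 (muCyl Ω T)) : EReal :=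
  ((∫⁻ z, 2⁻¹ * kineticDensity F (j z) (ρ z) ∂(muCyl Ω T) : ℝ≥0∞) : EReal) +
    extIntegral (muCyl Ω T) (fun z => 1 / 2 * E (ρ z))

/-- `(ρ, j)` solves the minimization problem in momentum formulation. -/
def IsMinimizer {d : ℕ} (Ω ΓE : Set (Sp d)) (T σ β : ℝ) (ρ₀ : Lp ℝ 2 (muOmega Ω))
    (F E : ℝ → ℝ) (ρ : Lp ℝ 2 (muCyl Ω T)) (j : Lp (Sp d) 2 (muCyl Ω T)) : Prop :=
  IsAdmissible Ω ΓE T σ β ρ₀ ρ j ∧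
    ∀ (ρ' : Lp ℝ 2 (muCyl Ω T)) (j' : Lp (Sp d) 2 (muCyl Ω T)),
      IsAdmissible Ω ΓE T σ β ρ₀ ρ' j' → cost Ω T F E ρ j ≤ cost Ω T F E ρ' j'

end CrowdControl

end

/-! ### Averages in `L²`, nested convex sets, weak measurability -/

namespace CrowdControl

/-! The proof is the direct method, arranged so that weak convergence never appears. Write m for
ρmax. Since F is concave and nonnegative on [0,m], the density |j|²/F(r) is jointly convex there:
the condition |j|² ≤ qF(r) survives convex combinations, by Cauchy–Schwarz and concavity
(`IsConcaveMobility.kineticDensity_convex`). As E is convex and the constraint is affine in (ρ, j),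
the admissible pairs with density in [0,m] and cost at most c form a convex set. This set is bounded
in L², because a bounded F lets the cost control j, and it is strongly closed. Nested nonempty
closed bounded convex sets in a Hilbert space have a common point (`nonempty_iInter_of_convex`); a
pair common to the levels inf + 1/(n+1) is a minimizer.

Closedness has two sources. The cost passes to the limit by Fatou's lemma along an a.e. convergent
subsequence, the density being lower semicontinuous even where F vanishes. The constraint passes to
the limit because the linear equation u' + Au = f, with f determined by j, depends continuously on
its data: the energy inequality (`IsParabolicPath.energy_le`), coercivity of A up to an L² term and
Grönwall's lemma give an a priori estimate (`exists_apriori`), which by linearity applies to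
differences of solutions. The same stability gives existence for j = 0, from an ODE regularization
whose residual tends to zero; this pair has finite cost, so the infimum is finite.

Requiring the density to lie in [0,m] loses nothing, by a maximum principle
(`ae_mem_Icc_of_isAdmissible`). Finite cost forces j = 0 wherever F(ρ) = 0, hence outside [0,m].
Test the equation with G(ρ), where G is nondecreasing and vanishes exactly on [0,m]: the flux term
disappears, diffusion and outflux have a favourable sign, and the integral of a primitive of G along
ρ, zero initially, cannot become positive.

The boundary terms need trace theory on Lipschitz domains: a trace inequality obtained by
integrating along segments that enter the domain (`exists_trace_inequality`), and density of C¹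
functions in H¹, by mollifying with kernels that look into the domain
(`isC1Approximable_of_isWeakGradient`). The same C¹ approximations give the chain rule for G(u) and
the fact that its trace is G of the trace of u.

For uniqueness, the midpoint of two minimizers is admissible, so the convexity inequality is an
equality a.e. Strict convexity of E identifies the densities. The fluxes then agree because
|j|²/F(ρ) is strictly convex in j where F(ρ) > 0, and because both vanish where F(ρ) = 0. -/

theorem sq_eLpNorm_two {α F : Type*} [MeasurableSpace α] [NormedAddCommGroup F] (μ : Measure α)
    (f : α → F) : eLpNorm f 2 μ ^ 2 = ∫⁻ x, ‖f x‖ₑ ^ 2 ∂μ := by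
  have := eLpNorm_nnreal_pow_eq_lintegral (μ := μ) (f := f) (p := 2) (by norm_num)
  simpa using this

theorem eLpNorm_two_le_iff {α F : Type*} [MeasurableSpace α] [NormedAddCommGroup F]
    (μ : Measure α) (f : α → F) (c : ℝ≥0∞) :
    eLpNorm f 2 μ ≤ c ↔ ∫⁻ x, ‖f x‖ₑ ^ 2 ∂μ ≤ c ^ 2 := by
  rw [← sq_eLpNorm_two, ENNReal.pow_le_pow_left_iff two_ne_zero]

/-- Cauchy–Schwarz against the constant 1. -/
theorem sq_lintegral_le_lintegral_sq {α : Type*} [MeasurableSpace α] (P : Measure α)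
    {f : α → ℝ≥0∞} (hf : AEMeasurable f P) :
    (∫⁻ x, f x ∂P) ^ 2 ≤ P univ * ∫⁻ x, f x ^ 2 ∂P := by
  have h := ENNReal.lintegral_mul_le_Lp_mul_Lq P Real.HolderConjugate.two_two hf
    (aemeasurable_const (b := (1 : ℝ≥0∞)))
  simp only [Pi.mul_apply, mul_one, ENNReal.one_rpow, lintegral_const, one_mul] at h
  calc (∫⁻ x, f x ∂P) ^ 2 ≤ ((∫⁻ x, f x ^ (2 : ℝ) ∂P) ^ (1 / 2 : ℝ) * P univ ^ (1 / 2 : ℝ)) ^ 2 :=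
        pow_le_pow_left' h 2
    _ = _ := by
        rw [mul_pow, ← ENNReal.rpow_natCast, ← ENNReal.rpow_natCast, ← ENNReal.rpow_mul,
          ← ENNReal.rpow_mul]
        simp [mul_comm]

section Average

variable {E F : Type*} [NormedAddCommGroup E] [NormedSpace ℝ E] [FiniteDimensional ℝ E]
  [MeasurableSpace E] [BorelSpace E] [NormedAddCommGroup F]
  (μ : Measure E) [μ.IsAddHaarMeasure]

/-- Translation is continuous in `L²`. -/
theorem exists_eLpNorm_translate_sub_le {g : E → F} (hg : MemLp g 2 μ) {ε : ℝ≥0∞} (hε : 0 < ε) :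
    ∃ δ : ℝ, 0 < δ ∧ ∀ h : E, ‖h‖ < δ → eLpNorm (fun y => g (y - h) - g y) 2 μ ≤ ε := by
  let Tr : E → C(E, E) := fun h => ⟨fun y => y - h, by fun_prop⟩
  have hTr : Continuous Tr :=
    ContinuousMap.continuous_of_continuous_uncurry _ (by
      change Continuous fun p : E × E => p.2 - p.1
      fun_prop)
  -- Composition with measure preserving maps is continuous in `Lp` as the map varies in the
  -- compact-open topology, and h ↦ (y ↦ y - h) is continuous into that topology.
  have hmp : ∀ h, MeasurePreserving (Tr h) μ μ := fun h => measurePreserving_sub_right μ h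
  have hc : Continuous fun h => Lp.compMeasurePreserving (Tr h) (hmp h) hg.toLp :=
    continuous_const.compMeasurePreservingLp hTr hmp (by simp)
  have h0 := hc.tendsto 0
  rw [EMetric.tendsto_nhds] at h0
  obtain ⟨δ, hδ, H⟩ := Metric.eventually_nhds_iff.1 (h0 ε hε)
  refine ⟨δ, hδ, fun h hh => ?_⟩
  have := (H (y := h) (by simpa using hh)).le
  have e : ∀ h, Lp.compMeasurePreserving (Tr h) (hmp h) hg.toLp =
      (hg.comp_measurePreserving (hmp h)).toLp :=
    fun h => Lp.toLp_compMeasurePreserving hg (hmp h)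
  rw [e, e, Lp.edist_toLp_toLp] at this
  refine le_trans (le_of_eq ?_) this
  congr 1
  ext y
  simp [Tr]

/-- Because P has mass one, the difference is the average of g(y - h) - g(y); Cauchy–Schwarz in h
and Tonelli finish. It serves both mollification in space and backward averages in time. -/
theorem eLpNorm_average_translate_sub_le [NormedSpace ℝ F] [CompleteSpace F] {g : E → F} (hg : StronglyMeasurable g)
    (P : Measure E) [IsProbabilityMeasure P] {ε : ℝ≥0∞}
    (h : ∀ᵐ h ∂P, eLpNorm (fun y => g (y - h) - g y) 2 μ ≤ ε) :
    eLpNorm (fun y => (∫ h, g (y - h) ∂P) - g y) 2 μ ≤ ε := by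
  have hm : StronglyMeasurable fun p : E × E => g (p.1 - p.2) - g p.1 :=
    (hg.comp_measurable (measurable_fst.sub measurable_snd)).sub (hg.comp_measurable measurable_fst)
  have hm1 : ∀ y, StronglyMeasurable fun h => g (y - h) - g y := fun y =>
    hm.comp_measurable measurable_prodMk_left
  rw [eLpNorm_two_le_iff]
  have key : ∀ y, ‖(∫ h, g (y - h) ∂P) - g y‖ₑ ^ 2 ≤ ∫⁻ h, ‖g (y - h) - g y‖ₑ ^ 2 ∂P := by
    intro y
    have h1 : ‖(∫ h, g (y - h) ∂P) - g y‖ₑ ≤ ∫⁻ h, ‖g (y - h) - g y‖ₑ ∂P := by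
      -- If the right-hand side is infinite there is nothing to prove; otherwise the translates are
      -- P-integrable and the integral can be split.
      by_cases hfin : ∫⁻ h, ‖g (y - h) - g y‖ₑ ∂P = ⊤
      · rw [hfin]; exact le_top
      have hi : Integrable (fun h => g (y - h) - g y) P :=
        ⟨(hm1 y).aestronglyMeasurable, lt_top_iff_ne_top.2 hfin⟩
      have hi2 : Integrable (fun h => g (y - h)) P := by
        refine (hi.add (integrable_const (g y))).congr (.of_forall fun h => ?_)
        simp
      have hs : (∫ h, g (y - h) ∂P) - ∫ _h, g y ∂P = ∫ h, (g (y - h) - g y) ∂P :=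
        (integral_sub hi2 (integrable_const _)).symm
      rw [integral_const, probReal_univ, one_smul] at hs
      rw [hs]
      exact enorm_integral_le_lintegral_enorm _
    calc _ ≤ (∫⁻ h, ‖g (y - h) - g y‖ₑ ∂P) ^ 2 := pow_le_pow_left' h1 2
      _ ≤ _ := by
        simpa using sq_lintegral_le_lintegral_sq P (hm1 y).enorm.aemeasurable
  calc _ ≤ ∫⁻ y, ∫⁻ h, ‖g (y - h) - g y‖ₑ ^ 2 ∂P ∂μ := lintegral_mono key
    _ = ∫⁻ h, ∫⁻ y, ‖g (y - h) - g y‖ₑ ^ 2 ∂μ ∂P :=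
        lintegral_lintegral_swap (hm.enorm.pow_const 2).aemeasurable
    _ ≤ ∫⁻ _h, ε ^ 2 ∂P := lintegral_mono_ae (by
        filter_upwards [h] with h hh using (eLpNorm_two_le_iff _ _ _).1 hh)
    _ = ε ^ 2 := by simp

end Average

/-- Nested closed bounded convex nonempty subsets of a Hilbert space have a common point. -/
theorem nonempty_iInter_of_convex {X : Type*} [NormedAddCommGroup X] [InnerProductSpace ℝ X]
    [CompleteSpace X] (C : ℕ → Set X) (hne : ∀ n, (C n).Nonempty) (hcl : ∀ n, IsClosed (C n))
    (hcv : ∀ n, Convex ℝ (C n)) (hanti : Antitone C) (hb : Bornology.IsBounded (C 0)) :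
    (⋂ n, C n).Nonempty := by
  obtain ⟨R, hR⟩ := hb.exists_norm_le
  -- Take the element v n of least norm in each set. The norms increase and stay bounded, and the
  -- parallelogram law turns their convergence into the Cauchy property of v.
  have hmin : ∀ n, ∃ v ∈ C n, ∀ w ∈ C n, ‖v‖ ≤ ‖w‖ := fun n => by
    obtain ⟨v, hv, h⟩ := exists_norm_eq_iInf_of_complete_convex (hne n) (hcl n).isComplete
      (hcv n) 0
    refine ⟨v, hv, fun w hw => ?_⟩
    have : ‖(0 : X) - v‖ ≤ ‖(0 : X) - w‖ := by
      rw [h]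
      exact ciInf_le ⟨0, by rintro _ ⟨x, rfl⟩; exact norm_nonneg _⟩ (⟨w, hw⟩ : C n)
    simpa using this
  choose v hv hvmin using hmin
  have hmono : Monotone fun n => ‖v n‖ := fun m n hmn => hvmin m _ (hanti hmn (hv n))
  have hbd : BddAbove (range fun n => ‖v n‖) :=
    ⟨R, by rintro _ ⟨n, rfl⟩; exact hR _ (hanti (Nat.zero_le n) (hv n))⟩
  have hlim := tendsto_atTop_ciSup hmono hbd
  set s := ⨆ n, ‖v n‖
  have hsq : Tendsto (fun n => ‖v n‖ ^ 2) atTop (𝓝 (s ^ 2)) := hlim.pow 2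
  have hpar : ∀ m n, m ≤ n → ‖v n - v m‖ ^ 2 ≤ 2 * (s ^ 2 - ‖v m‖ ^ 2) := by
    intro m n hmn
    -- The sets decrease, so the midpoint lies in the larger set C m, where v m has least norm.
    have hmid : (1 / 2 : ℝ) • v m + (1 / 2 : ℝ) • v n ∈ C m :=
      hcv m (hv m) (hanti hmn (hv n)) (by norm_num) (by norm_num) (by norm_num)
    have h1 := hvmin m _ hmid
    rw [← smul_add, norm_smul] at h1
    have h2 : 2 * ‖v m‖ ≤ ‖v m + v n‖ := by
      norm_num at h1; linarith
    have h3 := parallelogram_law_with_norm ℝ (v n) (v m)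
    have h4 : ‖v n‖ ≤ s := le_ciSup hbd n
    rw [add_comm (v n)] at h3
    nlinarith [norm_nonneg (v m), norm_nonneg (v n), norm_nonneg (v m + v n)]
  have hc : CauchySeq v := by
    refine Metric.cauchySeq_iff'.2 fun ε hε => ?_
    have : ∀ᶠ m in atTop, 2 * (s ^ 2 - ‖v m‖ ^ 2) < ε ^ 2 := by
      have := ((tendsto_const_nhds (x := s ^ 2)).sub hsq).const_mul 2
      simp only [sub_self, mul_zero] at this
      exact this.eventually_lt_const (by positivity)
    obtain ⟨N, hN⟩ := this.exists
    refine ⟨N, fun n hn => ?_⟩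
    rw [dist_eq_norm]
    exact lt_of_pow_lt_pow_left₀ 2 hε.le ((hpar N n hn).trans_lt hN)
  obtain ⟨x, hx⟩ := cauchySeq_tendsto_of_complete hc
  refine ⟨x, mem_iInter.2 fun n => (hcl n).mem_of_tendsto hx ?_⟩
  filter_upwards [eventually_ge_atTop n] with m hm using hanti hm (hv m)

/-- A weakly measurable function with values in a separable Hilbert space is measurable. -/
theorem stronglyMeasurable_of_inner {α X : Type*} [MeasurableSpace α] [NormedAddCommGroup X]
    [InnerProductSpace ℝ X] [SecondCountableTopology X] [MeasurableSpace X] [BorelSpace X]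
    {f : α → X} (hf : ∀ e, Measurable fun a => inner ℝ e (f a)) : StronglyMeasurable f := by
  -- The distance to q is a supremum of countably many normalized inner products over a dense
  -- sequence. A zero vector in that sequence contributes the value 0, since division by zero gives
  -- 0.
  have hn : ∀ q, Measurable fun a => ‖f a - q‖ := by
    intro q
    have : (fun a => ‖f a - q‖) =
        fun a => ⨆ i : ℕ, inner ℝ (TopologicalSpace.denseSeq X i) (f a - q) / ‖TopologicalSpace.denseSeq X i‖ := by
      funext a
      have hle : ∀ i : ℕ, inner ℝ (TopologicalSpace.denseSeq X i) (f a - q) / ‖TopologicalSpace.denseSeq X i‖ ≤ ‖f a - q‖ := by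
        intro i
        refine div_le_of_le_mul₀ (norm_nonneg _) (norm_nonneg _) ?_
        rw [mul_comm]; exact real_inner_le_norm _ _
      refine le_antisymm ?_ (ciSup_le hle)
      have hbd : BddAbove (range fun i : ℕ => inner ℝ (TopologicalSpace.denseSeq X i) (f a - q) / ‖TopologicalSpace.denseSeq X i‖) :=
        ⟨_, by rintro _ ⟨i, rfl⟩; exact hle i⟩
      by_cases h0 : f a - q = 0
      · simp [h0]
      have hcont : Tendsto (fun x : X => inner ℝ x (f a - q) / ‖x‖) (𝓝 (f a - q))
          (𝓝 ‖f a - q‖) := by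
        have : Tendsto (fun x : X => inner ℝ x (f a - q) / ‖x‖) (𝓝 (f a - q))
          (𝓝 (inner ℝ (f a - q) (f a - q) / ‖f a - q‖)) := by
          have hc : ContinuousAt (fun x : X => inner ℝ x (f a - q) / ‖x‖) (f a - q) :=
            ContinuousAt.div (by fun_prop) (by fun_prop) (norm_ne_zero_iff.2 h0)
          exact hc
        rwa [real_inner_self_eq_norm_sq, sq, mul_div_assoc, div_self (norm_ne_zero_iff.2 h0),
          mul_one] at this
      refine le_of_forall_lt fun c hc => ?_
      have hU := (hcont.eventually_const_lt hc)
      obtain ⟨x, ⟨i, rfl⟩, hx⟩ := (TopologicalSpace.denseRange_denseSeq X).inter_nhds_nonempty hU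
      exact lt_of_lt_of_le hx (le_ciSup hbd i)
    rw [this]
    refine Measurable.iSup fun i => ?_
    simp only [inner_sub_right]
    exact ((hf _).sub_const _).div_const _
  refine Measurable.stronglyMeasurable ?_
  refine measurable_of_isOpen fun U hU => ?_
  -- By second countability every open set is a countable union of balls, and preimages of balls are
  -- now known to be measurable.
  have : ∃ S : Set (X × ℝ), S.Countable ∧ U = ⋃ p ∈ S, Metric.ball p.1 p.2 := by
    choose! r hr hrU using fun x (hx : x ∈ U) => Metric.isOpen_iff.1 hU x hx
    obtain ⟨S, hSU, hS, h⟩ := TopologicalSpace.isOpen_biUnion_countable U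
      (fun x => Metric.ball x (r x)) (fun _ _ => Metric.isOpen_ball)
    refine ⟨(fun x => (x, r x)) '' S, hS.image _, ?_⟩
    rw [biUnion_image, h]
    refine Subset.antisymm (fun x hx => mem_biUnion hx (Metric.mem_ball_self (hr x hx))) ?_
    exact iUnion₂_subset hrU
  obtain ⟨S, hS, rfl⟩ := this
  simp only [preimage_iUnion]
  refine MeasurableSet.biUnion hS fun p _ => ?_
  have : f ⁻¹' Metric.ball p.1 p.2 = {a | ‖f a - p.1‖ < p.2} := by
    ext a; simp [dist_eq_norm]
  rw [this]
  exact measurableSet_lt (hn _) measurable_const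

end CrowdControl

/-! ### The trace inequality on a Lipschitz boundary -/

namespace CrowdControl

section Shear

variable {d : ℕ} {ν : Sp d}

theorem inner_coe_orthogonal_span (w : (ℝ ∙ ν)ᗮ) : inner ℝ ν (w : Sp d) = 0 :=
  Submodule.mem_orthogonal_singleton_iff_inner_right.1 w.2

theorem sub_inner_smul_mem_orthogonal_span (hν : ‖ν‖ = 1) (y : Sp d) :
    y - inner ℝ ν y • ν ∈ (ℝ ∙ ν)ᗮ := by
  rw [Submodule.mem_orthogonal_singleton_iff_inner_right, inner_sub_right, inner_smul_right,
    real_inner_self_eq_norm_sq, hν]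
  ring

/-- The decomposition of space into the hyperplane orthogonal to `ν` and the line along `ν`. -/
noncomputable def hyperplaneProdEquiv (hν : ‖ν‖ = 1) : ((ℝ ∙ ν)ᗮ × ℝ) ≃L[ℝ] Sp d :=
  LinearEquiv.toContinuousLinearEquiv
    { toFun := fun p => (p.1 : Sp d) + p.2 • ν
      map_add' := fun p q => by simp [add_smul]; abel
      map_smul' := fun c p => by simp [mul_smul]
      invFun := fun y => (⟨y - inner ℝ ν y • ν, sub_inner_smul_mem_orthogonal_span hν y⟩,
        inner ℝ ν y)
      left_inv := fun p => by
        have h : inner ℝ ν ((p.1 : Sp d) + p.2 • ν) = p.2 := by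
          rw [inner_add_right, inner_coe_orthogonal_span, inner_smul_right,
            real_inner_self_eq_norm_sq, hν]
          ring
        ext1
        · ext1; simp [h]
        · exact h
      right_inv := fun y => by simp }

theorem hyperplaneProdEquiv_apply (hν : ‖ν‖ = 1) (w : (ℝ ∙ ν)ᗮ) (s : ℝ) :
    hyperplaneProdEquiv hν (w, s) = (w : Sp d) + s • ν := rfl

/-- Integration along the lines parallel to `ν`, starting from the graph of `γ`. -/
theorem exists_lintegral_shear (hν : ‖ν‖ = 1) : ∃ c : ℝ≥0∞, c ≠ ⊤ ∧
    ∀ (γ : Sp d → ℝ), Continuous γ → ∀ h : Sp d → ℝ≥0∞, Measurable h →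
      ∫⁻ w : (ℝ ∙ ν)ᗮ, (∫⁻ s : ℝ, h (((w : Sp d) + γ w • ν) + s • ν))
        ∂(μH[Module.finrank ℝ (ℝ ∙ ν)ᗮ]) = c * ∫⁻ y, h y := by
  let m : Measure ((ℝ ∙ ν)ᗮ × ℝ) := (μH[Module.finrank ℝ (ℝ ∙ ν)ᗮ]).prod volume
  let Θ := hyperplaneProdEquiv hν
  -- A linear isomorphism carries the Haar measure on the product to a Haar measure, hence to a
  -- multiple of Lebesgue measure. The value of c is immaterial.
  have hH : (m.map Θ).IsAddHaarMeasure := Θ.isAddHaarMeasure_map m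
  obtain ⟨c, hm⟩ : ∃ c : ℝ≥0, m.map Θ = c • volume :=
    ⟨_, Measure.isAddLeftInvariant_eq_smul (m.map Θ) (volume : Measure (Sp d))⟩
  refine ⟨c, ENNReal.coe_ne_top, fun γ hγ h hh => ?_⟩
  -- On each line the height γ w is only a shift of the variable s, so it drops out.
  have h1 : ∀ w : (ℝ ∙ ν)ᗮ, ∫⁻ s : ℝ, h (((w : Sp d) + γ w • ν) + s • ν) =
      ∫⁻ s : ℝ, h (Θ (w, s)) := by
    intro w
    rw [← lintegral_add_left_eq_self (fun s => h (Θ (w, s))) (γ w)]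
    congr 1
    ext s
    rw [hyperplaneProdEquiv_apply, add_smul, add_assoc]
  simp_rw [h1]
  have hmeas : Measurable fun p => h (Θ p) := hh.comp Θ.continuous.measurable
  rw [← lintegral_prod (fun p => h (Θ p)) hmeas.aemeasurable]
  change ∫⁻ p, h (Θ p) ∂m = _
  rw [← lintegral_map hh Θ.continuous.measurable, hm, lintegral_smul_measure]
  rfl

end Shear

/-- The function s ↦ f(y + sν)(1 - s/δ) equals f(y) at 0 and vanishes at δ, so f(y) is minus the
integral of its derivative; then Cauchy–Schwarz. The constant is δ · 2(1 + 1/δ²). -/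
theorem enorm_sq_le_lintegral_segment {d : ℕ} {f : Sp d → ℝ} (hf : ContDiff ℝ 1 f) {δ : ℝ}
    (hδ : 0 < δ) {ν : Sp d} (hν : ‖ν‖ = 1) (y : Sp d) :
    ‖f y‖ₑ ^ 2 ≤ ENNReal.ofReal (2 * (δ + 1 / δ)) *
      ∫⁻ s in Ioo 0 δ, (‖f (y + s • ν)‖ₑ ^ 2 + ‖gradient f (y + s • ν)‖ₑ ^ 2) := by
  let g' : ℝ → ℝ := fun s =>
    inner ℝ (gradient f (y + s • ν)) ν * (1 - s / δ) + f (y + s • ν) * (-(1 / δ))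
  have hgc : Continuous (gradient f) :=
    (InnerProductSpace.toDual ℝ (Sp d)).symm.continuous.comp (hf.continuous_fderiv (by simp))
  have hg'c : Continuous g' := by
    have := hf.continuous
    fun_prop
  have hg : ∀ s, HasDerivAt (fun s => f (y + s • ν) * (1 - s / δ)) (g' s) s := by
    intro s
    have h1 : HasDerivAt (fun s : ℝ => y + s • ν) ν s := by
      simpa using ((hasDerivAt_id s).smul_const ν).const_add y
    have h2 : HasDerivAt (fun s : ℝ => f (y + s • ν)) (inner ℝ (gradient f (y + s • ν)) ν) s := by
      have h3 := (hf.differentiable (by simp)).differentiableAt (x := y + s • ν)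
      have := h3.hasGradientAt.hasFDerivAt.comp_hasDerivAt s h1
      simp only [InnerProductSpace.toDual_apply_apply] at this
      exact this
    have h3 : HasDerivAt (fun s : ℝ => 1 - s / δ) (-(1 / δ)) s :=
      ((hasDerivAt_id s).div_const δ).const_sub 1
    exact h2.mul h3
  have hF := intervalIntegral.integral_eq_sub_of_hasDerivAt (fun s _ => hg s)
    (hg'c.intervalIntegrable 0 δ)
  have h0 : ‖f y‖ₑ ≤ ∫⁻ s in Ioo 0 δ, ‖g' s‖ₑ := by
    have : f y = - ∫ s in (0 : ℝ)..δ, g' s := by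
      rw [hF]; simp [hδ.ne']
    rw [this, enorm_neg, intervalIntegral.integral_of_le hδ.le, integral_Ioc_eq_integral_Ioo]
    exact enorm_integral_le_lintegral_enorm _
  -- The derivative is bounded by a + b/δ with a = |∇f| and b = |f|, and (a + b/δ)² ≤ 2a² + 2b²/δ².
  have hpt : ∀ s ∈ Ioo 0 δ, ‖g' s‖ₑ ^ 2 ≤ ENNReal.ofReal (2 * (1 + 1 / δ ^ 2)) *
      (‖f (y + s • ν)‖ₑ ^ 2 + ‖gradient f (y + s • ν)‖ₑ ^ 2) := by
    intro s hs
    have e : ∀ (F : Type) [NormedAddCommGroup F] (x : F), ‖x‖ₑ ^ 2 = ENNReal.ofReal (‖x‖ ^ 2) :=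
      fun F _ x => by rw [← ofReal_norm, ENNReal.ofReal_pow (norm_nonneg _)]
    rw [e, e, e, ← ENNReal.ofReal_add (by positivity) (by positivity),
      ← ENNReal.ofReal_mul (by positivity)]
    refine ENNReal.ofReal_le_ofReal ?_
    have h1 : |inner ℝ (gradient f (y + s • ν)) ν * (1 - s / δ)| ≤ ‖gradient f (y + s • ν)‖ := by
      rw [abs_mul]
      have a1 := abs_real_inner_le_norm (gradient f (y + s • ν)) ν
      rw [hν, mul_one] at a1
      have a2 : |1 - s / δ| ≤ 1 := by
        have : 0 ≤ s / δ := div_nonneg hs.1.le hδ.le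
        have : s / δ ≤ 1 := (div_le_one hδ).2 hs.2.le
        rw [abs_le]; constructor <;> linarith
      calc _ ≤ ‖gradient f (y + s • ν)‖ * 1 :=
            mul_le_mul a1 a2 (abs_nonneg _) (norm_nonneg _)
        _ = _ := mul_one _
    have h2 : |f (y + s • ν) * (-(1 / δ))| = ‖f (y + s • ν)‖ * (1 / δ) := by
      rw [abs_mul, abs_neg, abs_of_pos (by positivity : 0 < 1 / δ), Real.norm_eq_abs]
    have h3 : ‖g' s‖ ≤ ‖gradient f (y + s • ν)‖ + ‖f (y + s • ν)‖ * (1 / δ) := by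
      rw [Real.norm_eq_abs, ← h2]
      exact (abs_add_le _ _).trans (add_le_add h1 le_rfl)
    have h4 := pow_le_pow_left₀ (norm_nonneg _) h3 2
    have h5 : (0 : ℝ) < 1 / δ := by positivity
    have h6 : 1 / δ ^ 2 = (1 / δ) ^ 2 := by rw [one_div_pow]
    rw [h6]
    set a := ‖gradient f (y + s • ν)‖
    set b := ‖f (y + s • ν)‖
    nlinarith [sq_nonneg (a - b * (1 / δ)), sq_nonneg (a * (1 / δ)), sq_nonneg a, sq_nonneg b]
  calc ‖f y‖ₑ ^ 2 ≤ (∫⁻ s in Ioo 0 δ, ‖g' s‖ₑ) ^ 2 := pow_le_pow_left' h0 2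
    _ ≤ (volume.restrict (Ioo 0 δ)) univ * ∫⁻ s in Ioo 0 δ, ‖g' s‖ₑ ^ 2 :=
        sq_lintegral_le_lintegral_sq _ hg'c.enorm.aemeasurable
    _ ≤ ENNReal.ofReal δ * ∫⁻ s in Ioo 0 δ, ENNReal.ofReal (2 * (1 + 1 / δ ^ 2)) *
      (‖f (y + s • ν)‖ₑ ^ 2 + ‖gradient f (y + s • ν)‖ₑ ^ 2) := by
        refine mul_le_mul' (by simp) (setLIntegral_mono' measurableSet_Ioo hpt)
    _ = _ := by
        rw [lintegral_const_mul' _ _ ENNReal.ofReal_ne_top, ← mul_assoc,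
          ← ENNReal.ofReal_mul hδ.le]
        congr 2
        field_simp

theorem inner_add_smul_unit {d : ℕ} {ν : Sp d} (hν : ‖ν‖ = 1) (y : Sp d) (s : ℝ) :
    inner ℝ ν (y + s • ν) = inner ℝ ν y + s := by
  rw [inner_add_right, inner_smul_right, real_inner_self_eq_norm_sq, hν]; ring

/-- Near x the boundary lies in the Lipschitz image of a hyperplane, which bounds its surface
measure, and segments issuing from it in direction ν stay in Ω. The segment estimate integrated over
the hyperplane is then a volume integral over Ω. -/
theorem exists_local_trace_inequality {d : ℕ} {Ω : Set (Sp d)} (hΩ : IsOpen Ω)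
    (hlip : HasLipschitzBoundary Ω) {x : Sp d} (hx : x ∈ frontier Ω) :
    ∃ r : ℝ, 0 < r ∧ ∃ C : ℝ≥0∞, C ≠ ⊤ ∧ ∀ f : Sp d → ℝ, ContDiff ℝ 1 f →
      ∫⁻ y in Metric.ball x r, ‖f y‖ₑ ^ 2 ∂(surf Ω) ≤
        C * ∫⁻ y in Ω, (‖f y‖ₑ ^ 2 + ‖gradient f y‖ₑ ^ 2) := by
  obtain ⟨r, hr, ν, hν, γ, L, hγ, hgraph⟩ := hlip x hx
  obtain ⟨c, hc, hshear⟩ := exists_lintegral_shear hν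
  set W := (ℝ ∙ ν)ᗮ
  have hdim : (Module.finrank ℝ W : ℝ) = (d : ℝ) - 1 := by
    have h1 := Submodule.finrank_add_finrank_orthogonal (ℝ ∙ ν)
    have h2 : Module.finrank ℝ (ℝ ∙ ν) = 1 :=
      finrank_span_singleton (by rintro rfl; simp at hν)
    rw [h2, finrank_euclideanSpace_fin] at h1
    have h3 : (1 : ℝ) + Module.finrank ℝ W = d := by exact_mod_cast h1
    linarith
  let G : W → Sp d := fun w => (w : Sp d) + γ w • ν
  have hG : LipschitzWith (1 + L) G := by
    refine LipschitzWith.of_dist_le_mul fun a b => ?_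
    have h1 := hγ.dist_le_mul (a : Sp d) b
    rw [dist_eq_norm, dist_eq_norm] at *
    have : G a - G b = ((a : Sp d) - b) + (γ a - γ b) • ν := by
      simp only [G, sub_smul]; abel
    rw [this]
    refine (norm_add_le _ _).trans ?_
    rw [norm_smul, hν, mul_one]
    push_cast
    rw [add_mul, one_mul]
    exact add_le_add le_rfl h1
  set S : Set (Sp d) := Metric.ball x (r / 2) ∩ frontier Ω
  have hSm : MeasurableSet S := Metric.isOpen_ball.measurableSet.inter isClosed_frontier.measurableSet
  -- A boundary point is not in the open set Ω, so it does not lie strictly above the graph. If it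
  -- lay strictly below, a whole neighbourhood would miss Ω, contradicting membership in the
  -- closure.
  have hsub : ∀ y ∈ S, inner ℝ ν y = γ (y - inner ℝ ν y • ν) := by
    rintro y ⟨hy, hyf⟩
    have hyr : y ∈ Metric.ball x r := Metric.ball_subset_ball (by linarith) hy
    have hle : ¬ γ (y - inner ℝ ν y • ν) < inner ℝ ν y := fun h => by
      have := (hgraph y hyr).2 h
      exact (disjoint_frontier_iff_isOpen.2 hΩ).le_bot ⟨hyf, this⟩
    refine le_antisymm (not_lt.1 hle) ?_
    by_contra hlt
    have hc1 := hγ.continuous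
    have hev : ∀ᶠ z in 𝓝 y, inner ℝ ν z < γ (z - inner ℝ ν z • ν) ∧ z ∈ Metric.ball x r :=
      Filter.Eventually.and (IsOpen.mem_nhds (isOpen_lt (f := fun z : Sp d => inner ℝ ν z)
        (g := fun z : Sp d => γ (z - inner ℝ ν z • ν)) (by fun_prop) (by fun_prop))
        (not_le.1 hlt)) (Metric.isOpen_ball.mem_nhds hyr)
    obtain ⟨z, hz, hzΩ⟩ := mem_closure_iff_nhds.1 hyf.1 _ hev
    exact absurd ((hgraph z hz.2).1 hzΩ) (not_lt.2 hz.1.le)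
  have hSG : ∀ y ∈ S, ∃ w : W, G w = y := fun y hy =>
    ⟨⟨_, sub_inner_smul_mem_orthogonal_span hν y⟩, by
      simp only [G]; rw [← hsub y hy]; exact sub_add_cancel _ _⟩
  -- Halving the radius keeps a segment of length r/2 from a point of the smaller ball inside the
  -- ball where the graph description holds.
  have hray : ∀ y ∈ S, ∀ s ∈ Ioo 0 (r / 2), y + s • ν ∈ Ω := by
    intro y hy s hs
    have hmem : y + s • ν ∈ Metric.ball x r := by
      have h1 : dist (y + s • ν) y = s := by
        rw [dist_eq_norm, add_sub_cancel_left, norm_smul, hν, mul_one, Real.norm_eq_abs,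
          abs_of_pos hs.1]
      have h2 := dist_triangle (y + s • ν) y x
      have h3 := Metric.mem_ball.1 hy.1
      have h4 := hs.2
      rw [Metric.mem_ball]; linarith
    refine (hgraph _ hmem).2 ?_
    rw [inner_add_smul_unit hν, add_smul, add_sub_add_right_eq_sub, ← hsub y hy]
    linarith [hs.1]
  have hGm : Measurable G := hG.continuous.measurable
  set μW : Measure W := μH[Module.finrank ℝ W]
  set K : ℝ≥0∞ := ((1 + L : ℝ≥0) : ℝ≥0∞) ^ (Module.finrank ℝ W : ℝ)
  have hK : K ≠ ⊤ := ENNReal.rpow_ne_top_of_nonneg (Nat.cast_nonneg _) ENNReal.coe_ne_top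
  -- The dimension of the hyperplane is d - 1, and a Lipschitz map increases Hausdorff measure of
  -- that dimension by at most the power K of its constant.
  have hmeas : (surf Ω).restrict (Metric.ball x (r / 2)) ≤
      K • (μW.restrict (G ⁻¹' S)).map G := by
    rw [surf, Measure.restrict_restrict Metric.isOpen_ball.measurableSet]
    refine Measure.le_iff.2 fun A hA => ?_
    rw [Measure.restrict_apply hA, Measure.smul_apply, Measure.map_apply hGm hA,
      Measure.restrict_apply (hGm hA), ← preimage_inter, ← hdim]
    have h1 : A ∩ S ⊆ G '' (G ⁻¹' (A ∩ S)) := by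
      intro y hy
      obtain ⟨w, rfl⟩ := hSG y hy.2
      exact mem_image_of_mem _ hy
    exact (measure_mono h1).trans (hG.hausdorffMeasure_image_le (Nat.cast_nonneg _) _)
  set M : ℝ≥0∞ := ENNReal.ofReal (2 * (r / 2 + 1 / (r / 2)))
  refine ⟨r / 2, by positivity, K * (M * c), ?_, fun f hf => ?_⟩
  · exact ENNReal.mul_ne_top hK (ENNReal.mul_ne_top ENNReal.ofReal_ne_top hc)
  have hgc : Continuous (gradient f) :=
    (InnerProductSpace.toDual ℝ (Sp d)).symm.continuous.comp (hf.continuous_fderiv (by simp))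
  have hfc := hf.continuous
  set h : Sp d → ℝ≥0∞ := fun y => ‖f y‖ₑ ^ 2 + ‖gradient f y‖ₑ ^ 2
  have hh : Measurable h := by
    have : Continuous h := by fun_prop
    exact this.measurable
  have hh2 : Measurable (Ω.indicator h) := hh.indicator hΩ.measurableSet
  have hpt : ∀ w ∈ G ⁻¹' S, ‖f (G w)‖ₑ ^ 2 ≤ M * ∫⁻ s : ℝ, Ω.indicator h (G w + (s : ℝ) • ν) := by
    intro w hw
    refine (enorm_sq_le_lintegral_segment hf (half_pos hr) hν (G w)).trans (mul_le_mul' le_rfl ?_)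
    calc _ = ∫⁻ s in Ioo 0 (r / 2), Ω.indicator h (G w + s • ν) :=
          setLIntegral_congr_fun measurableSet_Ioo fun s hs => by
            rw [indicator_of_mem (hray _ hw s hs)]
      _ ≤ _ := setLIntegral_le_lintegral _ _
  calc ∫⁻ y in Metric.ball x (r / 2), ‖f y‖ₑ ^ 2 ∂(surf Ω)
      ≤ ∫⁻ y, ‖f y‖ₑ ^ 2 ∂(K • (μW.restrict (G ⁻¹' S)).map G) := lintegral_mono' hmeas le_rfl
    _ = K * ∫⁻ w in G ⁻¹' S, ‖f (G w)‖ₑ ^ 2 ∂μW := by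
        rw [lintegral_smul_measure, lintegral_map (by fun_prop) hGm]; rfl
    _ ≤ K * ∫⁻ w, (M * ∫⁻ s : ℝ, Ω.indicator h (G w + s • ν)) ∂μW := by
        refine mul_le_mul' le_rfl ?_
        exact (setLIntegral_mono' (hGm hSm) hpt).trans (setLIntegral_le_lintegral _ _)
    _ = K * (M * c) * ∫⁻ y in Ω, h y := by
        rw [lintegral_const_mul' _ _ ENNReal.ofReal_ne_top, hshear γ hγ.continuous _ hh2,
          lintegral_indicator hΩ.measurableSet]
        ring

/-- The trace inequality for functions of class `C¹` up to the boundary. -/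
theorem exists_trace_inequality {d : ℕ} {Ω : Set (Sp d)} (hΩ : IsOpen Ω)
    (hb : Bornology.IsBounded Ω) (hlip : HasLipschitzBoundary Ω) :
    ∃ C : ℝ≥0∞, C ≠ ⊤ ∧ ∀ f : Sp d → ℝ, ContDiff ℝ 1 f →
      ∫⁻ y, ‖f y‖ₑ ^ 2 ∂(surf Ω) ≤ C * ∫⁻ y in Ω, (‖f y‖ₑ ^ 2 + ‖gradient f y‖ₑ ^ 2) := by
  have hcomp : IsCompact (frontier Ω) :=
    Metric.isCompact_of_isClosed_isBounded isClosed_frontier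
      (hb.closure.subset frontier_subset_closure)
  have key : ∃ C : ℝ≥0∞, C ≠ ⊤ ∧ ∀ f : Sp d → ℝ, ContDiff ℝ 1 f →
      ∫⁻ y in frontier Ω, ‖f y‖ₑ ^ 2 ∂(surf Ω) ≤
        C * ∫⁻ y in Ω, (‖f y‖ₑ ^ 2 + ‖gradient f y‖ₑ ^ 2) := by
    -- Local inequalities add up over a finite cover of the compact boundary.
    refine hcomp.induction_on (p := fun s => ∃ C : ℝ≥0∞, C ≠ ⊤ ∧ ∀ f : Sp d → ℝ,
      ContDiff ℝ 1 f → ∫⁻ y in s, ‖f y‖ₑ ^ 2 ∂(surf Ω) ≤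
        C * ∫⁻ y in Ω, (‖f y‖ₑ ^ 2 + ‖gradient f y‖ₑ ^ 2)) ⟨0, by simp, by simp⟩ ?_ ?_ ?_
    · rintro s t hst ⟨C, hC, h⟩
      exact ⟨C, hC, fun f hf => (lintegral_mono_set hst).trans (h f hf)⟩
    · rintro s t ⟨C, hC, h⟩ ⟨C', hC', h'⟩
      refine ⟨C + C', ENNReal.add_ne_top.2 ⟨hC, hC'⟩, fun f hf => ?_⟩
      rw [add_mul]
      exact (lintegral_union_le _ _ _).trans (add_le_add (h f hf) (h' f hf))
    · intro x hx
      obtain ⟨r, hr, C, hC, h⟩ := exists_local_trace_inequality hΩ hlip hx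
      exact ⟨_, mem_nhdsWithin_of_mem_nhds (Metric.ball_mem_nhds x hr), C, hC, h⟩
  simpa only [surf, Measure.restrict_restrict isClosed_frontier.measurableSet, inter_self]
    using key

end CrowdControl

/-! ### Density in `H¹` of functions of class `C¹` up to the boundary -/

namespace CrowdControl

section Gradient

variable {d : ℕ}

/-- The Riesz isomorphism, as a linear map. -/
noncomputable def rieszGradient : StrongDual ℝ (Sp d) ≃L[ℝ] Sp d where
  toFun := (InnerProductSpace.toDual ℝ (Sp d)).symm
  invFun := InnerProductSpace.toDual ℝ (Sp d)
  map_add' := map_add _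
  map_smul' := fun c x => by simp
  left_inv := (InnerProductSpace.toDual ℝ (Sp d)).right_inv
  right_inv := (InnerProductSpace.toDual ℝ (Sp d)).left_inv
  continuous_toFun := (InnerProductSpace.toDual ℝ (Sp d)).symm.continuous
  continuous_invFun := (InnerProductSpace.toDual ℝ (Sp d)).continuous

theorem continuous_gradient {f : Sp d → ℝ} (hf : ContDiff ℝ 1 f) : Continuous (gradient f) :=
  (InnerProductSpace.toDual ℝ (Sp d)).symm.continuous.comp (hf.continuous_fderiv (by simp))

theorem gradient_mul {f g : Sp d → ℝ} {x : Sp d} (hf : DifferentiableAt ℝ f x)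
    (hg : DifferentiableAt ℝ g x) :
    gradient (fun y => f y * g y) x = f x • gradient g x + g x • gradient f x := by
  rw [gradient, fderiv_fun_mul hf hg, map_add]
  simp [gradient]

theorem gradient_add {f g : Sp d → ℝ} {x : Sp d} (hf : DifferentiableAt ℝ f x)
    (hg : DifferentiableAt ℝ g x) :
    gradient (fun y => f y + g y) x = gradient f x + gradient g x := by
  rw [gradient, fderiv_fun_add hf hg, map_add]
  simp [gradient]

theorem gradient_const_sub_comp {f : Sp d → ℝ} (hf : Differentiable ℝ f) (y x : Sp d) :
    gradient (fun z => f (y - z)) x = - gradient f (y - x) := by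
  have h1 : HasFDerivAt (fun z => f (y - z)) ((fderiv ℝ f (y - x)).comp
      (-ContinuousLinearMap.id ℝ (Sp d))) x :=
    (hf (y - x)).hasFDerivAt.comp x ((hasFDerivAt_id x).const_sub y)
  rw [gradient, h1.fderiv, ContinuousLinearMap.comp_neg, ContinuousLinearMap.comp_id, map_neg]
  rfl

theorem gradient_eq_zero_of_notMem_tsupport {f : Sp d → ℝ} {x : Sp d} (h : x ∉ tsupport f) :
    gradient f x = 0 := by
  rw [gradient, image_eq_zero_of_notMem_tsupport (fun hx => h (tsupport_fderiv_subset ℝ hx)),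
    map_zero]

theorem contDiff_convolution {k v : Sp d → ℝ} (hk : ContDiff ℝ 1 k) (hkc : HasCompactSupport k)
    (hv : LocallyIntegrable v) : ContDiff ℝ 1 (fun y => ∫ h, k h * v (y - h)) :=
  hkc.contDiff_convolution_left (n := 1) (ContinuousLinearMap.lsmul ℝ ℝ) hk hv

theorem gradient_convolution {k v : Sp d → ℝ} (hk : ContDiff ℝ 1 k) (hkc : HasCompactSupport k)
    (hv : LocallyIntegrable v) (y : Sp d) :
    gradient (fun y => ∫ h, k h * v (y - h)) y = ∫ z, v z • gradient k (y - z) := by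
  have h := (hkc.hasFDerivAt_convolution_left (ContinuousLinearMap.lsmul ℝ ℝ) hk hv y).fderiv
  have h' : fderiv ℝ (fun y => ∫ h, k h * v (y - h)) y = ∫ z, v z • fderiv ℝ k (y - z) := by
    refine h.trans ?_
    rw [convolution_eq_swap]
    congr 1
    ext z w
    simp [mul_comm]
  change rieszGradient (fderiv ℝ _ y) = _
  rw [h', ← ContinuousLinearEquiv.integral_comp_comm]
  refine integral_congr_ae (.of_forall fun z => ?_)
  exact map_smul rieszGradient (v z) (fderiv ℝ k (y - z))

/-- Here z ↦ k(y - z)ζ(z) is a legitimate test function, since `hs` puts its support inside Ω.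
Differentiation thus moves from the kernel to ζu extended by zero, although ζu need not vanish near
the boundary. -/
theorem integral_smul_gradient_kernel {Ω : Set (Sp d)} (hΩ : MeasurableSet Ω)
    {u : Sp d → ℝ} {gu : Sp d → Sp d}
    (hu : MemLp u 2 (muOmega Ω)) (hgu : MemLp gu 2 (muOmega Ω)) (hw : IsWeakGradient Ω u gu)
    {ζ k : Sp d → ℝ} (hζ : ContDiff ℝ ∞ ζ) (hζc : HasCompactSupport ζ) (hk : ContDiff ℝ ∞ k)
    (y : Sp d) (hs : ∀ z ∈ tsupport ζ, y - z ∈ tsupport k → z ∈ Ω) :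
    ∫ z, Ω.indicator (fun x => ζ x * u x) z • gradient k (y - z) =
      ∫ z, k (y - z) • Ω.indicator (fun x => ζ x • gu x + u x • gradient ζ x) z := by
  have hk1 : ContDiff ℝ ∞ fun z => k (y - z) := hk.comp (contDiff_const.sub contDiff_id)
  set φ : Sp d → ℝ := fun z => k (y - z) * ζ z
  have hφ : ContDiff ℝ ∞ φ := hk1.mul hζ
  have hφc : HasCompactSupport φ := hζc.mul_left
  have hφs : tsupport φ ⊆ Ω := by
    intro z hz
    refine hs z (tsupport_mul_subset_right hz) ?_
    have h1 := tsupport_mul_subset_left (f := fun z => k (y - z)) hz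
    have h2 := tsupport_comp_subset_preimage k (f := fun z => y - z) (by fun_prop)
    exact h2 h1
  have h := hw φ hφ hφc hφs
  have hkd : Differentiable ℝ k := hk.differentiable (by simp)
  have hζd : Differentiable ℝ ζ := hζ.differentiable (by simp)
  have hgrad : ∀ z, gradient φ z = k (y - z) • gradient ζ z + ζ z • -gradient k (y - z) := by
    intro z
    rw [← gradient_const_sub_comp hkd]
    exact gradient_mul ((hk1.differentiable (by simp)) z) (hζd z)
  have ckζ : MemLp (fun z => ζ z • gradient k (y - z)) 2 (muOmega Ω) := by
    have : Continuous fun z => ζ z • gradient k (y - z) :=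
      hζ.continuous.smul ((continuous_gradient (hk.of_le (by simp))).comp (by fun_prop))
    have h2 : HasCompactSupport fun z => ζ z • gradient k (y - z) :=
      HasCompactSupport.intro hζc.isCompact fun x hx => by
        rw [image_eq_zero_of_notMem_tsupport hx, zero_smul]
    exact (this.memLp_of_hasCompactSupport h2).restrict Ω
  have ckgζ : MemLp (fun z => k (y - z) • gradient ζ z) 2 (muOmega Ω) := by
    have h1 := continuous_gradient (hζ.of_le (by simp))
    have : Continuous fun z => k (y - z) • gradient ζ z := hk1.continuous.smul h1
    have h3 : HasCompactSupport fun z => k (y - z) • gradient ζ z :=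
      HasCompactSupport.intro hζc.isCompact fun x hx => by
        rw [gradient_eq_zero_of_notMem_tsupport hx, smul_zero]
    exact (this.memLp_of_hasCompactSupport h3).restrict Ω
  have i1 : Integrable (fun z => u z • ζ z • gradient k (y - z)) (muOmega Ω) :=
    memLp_one_iff_integrable.1 (ckζ.smul hu)
  have i2 : Integrable (fun z => u z • k (y - z) • gradient ζ z) (muOmega Ω) :=
    memLp_one_iff_integrable.1 (ckgζ.smul hu)
  have i3 : Integrable (fun z => φ z • gu z) (muOmega Ω) :=
    memLp_one_iff_integrable.1 (hgu.smul (memLp_test Ω hφ hφc))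
  have e1 : ∫ z, Ω.indicator (fun x => ζ x * u x) z • gradient k (y - z) =
      ∫ z in Ω, u z • ζ z • gradient k (y - z) := by
    rw [← integral_indicator hΩ]
    congr 1
    ext1 z
    by_cases hz : z ∈ Ω <;> simp [hz, smul_smul, mul_comm]
  have e2 : ∫ z, k (y - z) • Ω.indicator (fun x => ζ x • gu x + u x • gradient ζ x) z =
      ∫ z in Ω, (u z • k (y - z) • gradient ζ z + φ z • gu z) := by
    rw [← integral_indicator hΩ]
    congr 1
    ext1 z
    by_cases hz : z ∈ Ω
    · simp only [hz, indicator_of_mem, smul_add, smul_smul, φ]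
      rw [add_comm, mul_comm (u z)]
    · simp [hz]
  have e3 : ∫ z in Ω, u z • gradient φ z =
      (∫ z in Ω, u z • k (y - z) • gradient ζ z) -
        ∫ z in Ω, u z • ζ z • gradient k (y - z) := by
    rw [← integral_sub i2 i1]
    congr 1
    ext1 z
    rw [hgrad, smul_add, smul_neg, smul_neg]
    exact (sub_eq_add_neg _ _).symm
  rw [e1, e2, integral_add i2 i3]
  rw [e3] at h
  rw [sub_eq_iff_eq_add] at h
  rw [h]; abel

end Gradient

/-- The pair `(v, g)` is a limit in `L²(Ω)` of functions of class `C¹` on the whole space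
together with their gradients. -/
def IsC1Approximable {d : ℕ} (Ω : Set (Sp d)) (v : Sp d → ℝ) (g : Sp d → Sp d) : Prop :=
  ∀ ε : ℝ≥0∞, 0 < ε → ∃ f : Sp d → ℝ, ContDiff ℝ 1 f ∧
    eLpNorm (fun x => f x - v x) 2 (muOmega Ω) ≤ ε ∧
    eLpNorm (fun x => gradient f x - g x) 2 (muOmega Ω) ≤ ε

theorem IsC1Approximable.add {d : ℕ} {Ω : Set (Sp d)} {v₁ v₂ : Sp d → ℝ} {g₁ g₂ : Sp d → Sp d}
    (h₁ : IsC1Approximable Ω v₁ g₁) (h₂ : IsC1Approximable Ω v₂ g₂)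
    (hv₁ : AEStronglyMeasurable v₁ (muOmega Ω)) (hv₂ : AEStronglyMeasurable v₂ (muOmega Ω))
    (hg₁ : AEStronglyMeasurable g₁ (muOmega Ω)) (hg₂ : AEStronglyMeasurable g₂ (muOmega Ω)) :
    IsC1Approximable Ω (fun x => v₁ x + v₂ x) (fun x => g₁ x + g₂ x) := by
  intro ε hε
  obtain ⟨a, ha, a1, a2⟩ := h₁ (ε / 2) (ENNReal.half_pos hε.ne')
  obtain ⟨b, hb, b1, b2⟩ := h₂ (ε / 2) (ENNReal.half_pos hε.ne')
  have had := ha.differentiable one_ne_zero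
  have hbd := hb.differentiable one_ne_zero
  refine ⟨fun x => a x + b x, ha.add hb, ?_, ?_⟩
  · have := eLpNorm_add_le (ha.continuous.aestronglyMeasurable.sub hv₁)
      (hb.continuous.aestronglyMeasurable.sub hv₂) (p := 2) (by norm_num)
    refine le_trans (le_of_eq ?_) (this.trans ((add_le_add a1 b1).trans (ENNReal.add_halves ε).le))
    congr 1; ext x; simp only [Pi.add_apply, Pi.sub_apply]; ring
  · have := eLpNorm_add_le ((continuous_gradient ha).aestronglyMeasurable.sub hg₁)
      ((continuous_gradient hb).aestronglyMeasurable.sub hg₂) (p := 2) (by norm_num)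
    refine le_trans (le_of_eq ?_) (this.trans ((add_le_add a2 b2).trans (ENNReal.add_halves ε).le))
    congr 1; ext1 x; rw [gradient_add (had x) (hbd x)]
    simp only [Pi.add_apply, Pi.sub_apply]; abel

/-- Extend ζu by zero and mollify with a kernel centred at -s•e. The value at y in Ω then only uses
points close to y + s•e, and the cone condition says that those in the support of ζ lie in Ω; so on
Ω the gradient of the mollification is the mollification of the weak gradient. Convergence is
continuity of translation in `L²`. -/
theorem isC1Approximable_of_cone {d : ℕ} {Ω : Set (Sp d)} (hΩ : MeasurableSet Ω)
    {u : Sp d → ℝ} {gu : Sp d → Sp d} (hum : StronglyMeasurable u) (hgum : StronglyMeasurable gu)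
    (hu : MemLp u 2 (muOmega Ω)) (hgu : MemLp gu 2 (muOmega Ω)) (hw : IsWeakGradient Ω u gu)
    {ζ : Sp d → ℝ} (hζ : ContDiff ℝ ∞ ζ) (hζc : HasCompactSupport ζ)
    (e : Sp d) {c s₀ : ℝ} (hc : 0 < c) (hs₀ : 0 < s₀)
    (hcone : ∀ s, 0 < s → s < s₀ → ∀ y ∈ Ω, ∀ z ∈ tsupport ζ, ‖z - y - s • e‖ ≤ c * s → z ∈ Ω) :
    IsC1Approximable Ω (fun x => ζ x * u x) (fun x => ζ x • gu x + u x • gradient ζ x) := by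
  intro ε hε
  set v : Sp d → ℝ := Ω.indicator fun x => ζ x * u x
  set g : Sp d → Sp d := Ω.indicator fun x => ζ x • gu x + u x • gradient ζ x
  have hgc := continuous_gradient (hζ.of_le (m := 1) (by simp))
  have hgζc : HasCompactSupport (gradient ζ) := HasCompactSupport.intro hζc.isCompact
    fun x hx => gradient_eq_zero_of_notMem_tsupport hx
  have hvm : StronglyMeasurable v := (hζ.continuous.stronglyMeasurable.mul hum).indicator hΩ
  have hgm : StronglyMeasurable g :=
    ((hζ.continuous.stronglyMeasurable.smul hgum).add
      (hum.smul hgc.stronglyMeasurable)).indicator hΩ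
  have hζt : MemLp ζ ⊤ (muOmega Ω) :=
    (hζ.continuous.memLp_of_hasCompactSupport hζc (μ := volume)).restrict Ω
  have hgζt : MemLp (gradient ζ) ⊤ (muOmega Ω) :=
    (hgc.memLp_of_hasCompactSupport hgζc (μ := volume)).restrict Ω
  have hv2 : MemLp v 2 volume := (memLp_indicator_iff_restrict hΩ).2 (hu.smul hζt)
  have hg2 : MemLp g 2 volume :=
    (memLp_indicator_iff_restrict hΩ).2 ((hgu.smul hζt).add (hgζt.smul hu))
  obtain ⟨δ₁, hδ₁, H₁⟩ := exists_eLpNorm_translate_sub_le volume hv2 hε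
  obtain ⟨δ₂, hδ₂, H₂⟩ := exists_eLpNorm_translate_sub_le volume hg2 hε
  -- The kernel charges only shifts h with ‖h‖ < s(‖e‖ + c), so s is taken small enough for both
  -- translation estimates.
  obtain ⟨s, hs, hss₀, hsδ₁, hsδ₂⟩ : ∃ s, 0 < s ∧ s < s₀ ∧ s * (‖e‖ + c) < δ₁ ∧
      s * (‖e‖ + c) < δ₂ := by
    have hp : 0 < ‖e‖ + c := by positivity
    refine ⟨min (s₀ / 2) (min (δ₁ / (2 * (‖e‖ + c))) (δ₂ / (2 * (‖e‖ + c)))), by positivity, ?_,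
      ?_, ?_⟩
    · exact (min_le_left _ _).trans_lt (by linarith)
    · calc _ ≤ δ₁ / (2 * (‖e‖ + c)) * (‖e‖ + c) := by
            gcongr; exact (min_le_right _ _).trans (min_le_left _ _)
        _ = δ₁ / 2 := by field_simp
        _ < δ₁ := by linarith
    · calc _ ≤ δ₂ / (2 * (‖e‖ + c)) * (‖e‖ + c) := by
            gcongr; exact (min_le_right _ _).trans (min_le_right _ _)
        _ = δ₂ / 2 := by field_simp
        _ < δ₂ := by linarith
  let φ : ContDiffBump (-(s • e)) := ⟨c * s / 2, c * s, by positivity, by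
    have : 0 < c * s := by positivity
    linarith⟩
  set k : Sp d → ℝ := φ.normed volume
  have hk : ContDiff ℝ ∞ k := φ.contDiff_normed
  have hkc : HasCompactSupport k := φ.hasCompactSupport_normed
  have hk0 : ∀ h, 0 ≤ k h := φ.nonneg_normed
  -- The normalized kernel becomes the density of a probability measure P, so that mollification is
  -- an average of translates.
  let κ : Sp d → ℝ≥0 := fun h => ⟨k h, hk0 h⟩
  have hκ : Measurable κ := hk.continuous.measurable.subtype_mk
  let P : Measure (Sp d) := volume.withDensity fun h => (κ h : ℝ≥0∞)
  have hP : IsProbabilityMeasure P := ⟨by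
    have h1 : ∫⁻ h, (κ h : ℝ≥0∞) = ENNReal.ofReal (∫ h, k h) := by
      rw [ofReal_integral_eq_lintegral_ofReal φ.integrable_normed (.of_forall hk0)]
      congr 1
      ext h
      rw [ENNReal.ofReal_eq_coe_nnreal (hk0 h)]
      rfl
    simp only [P, withDensity_apply _ MeasurableSet.univ, Measure.restrict_univ]
    rw [h1, φ.integral_normed, ENNReal.ofReal_one]⟩
  have hPs : ∀ᵐ h ∂P, ‖h‖ < s * (‖e‖ + c) := by
    refine (ae_withDensity_iff hκ.coe_nnreal_ennreal).2 (.of_forall fun h hh => ?_)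
    have h1 : k h ≠ 0 := fun h0 => hh (by
      simp only [ENNReal.coe_eq_zero]; exact NNReal.eq h0)
    have h2 : h ∈ Function.support k := h1
    rw [φ.support_normed_eq, Metric.mem_ball, dist_eq_norm, sub_neg_eq_add] at h2
    calc ‖h‖ = ‖(h + s • e) - s • e‖ := by rw [add_sub_cancel_right]
      _ ≤ ‖h + s • e‖ + ‖s • e‖ := norm_sub_le _ _
      _ < c * s + s * ‖e‖ := by
          rw [norm_smul, Real.norm_eq_abs, abs_of_pos hs]
          exact add_lt_add_of_lt_of_le h2 le_rfl
      _ = _ := by ring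
  have hvl : LocallyIntegrable v := hv2.locallyIntegrable (by norm_num)
  have hPv : ∀ y, ∫ h, v (y - h) ∂P = ∫ h, k h * v (y - h) := fun y =>
    integral_withDensity_eq_integral_smul hκ _
  have hPg : ∀ y, ∫ h, g (y - h) ∂P = ∫ h, k h • g (y - h) := fun y =>
    integral_withDensity_eq_integral_smul hκ _
  refine ⟨fun y => ∫ h, k h * v (y - h), contDiff_convolution (hk.of_le (by simp)) hkc hvl, ?_, ?_⟩
  · have h1 := eLpNorm_average_translate_sub_le volume hvm P (ε := ε) (by
      filter_upwards [hPs] with h hh using H₁ h (hh.trans hsδ₁))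
    refine le_trans (le_of_eq ?_) ((eLpNorm_mono_measure _ (Measure.restrict_le_self (s := Ω))).trans h1)
    refine eLpNorm_congr_ae ?_
    filter_upwards [ae_restrict_mem hΩ] with y hy
    have e1 : v y = ζ y * u y := indicator_of_mem hy _
    rw [hPv, e1]
  · have h1 := eLpNorm_average_translate_sub_le volume hgm P (ε := ε) (by
      filter_upwards [hPs] with h hh using H₂ h (hh.trans hsδ₂))
    refine le_trans (le_of_eq ?_) ((eLpNorm_mono_measure _ (Measure.restrict_le_self (s := Ω))).trans h1)
    refine eLpNorm_congr_ae ?_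
    filter_upwards [ae_restrict_mem hΩ] with y hy
    have e1 : g y = ζ y • gu y + u y • gradient ζ y := indicator_of_mem hy _
    rw [hPg, e1, gradient_convolution (hk.of_le (by simp)) hkc hvl,
      integral_smul_gradient_kernel hΩ hu hgu hw hζ hζc hk y]
    · rw [← integral_sub_left_eq_self (fun h => k h • g (y - h)) volume y]
      simp only [sub_sub_cancel]
      rfl
    · intro z hz hyz
      refine hcone s hs hss₀ y hy z hz ?_
      rw [φ.tsupport_normed_eq, Metric.mem_closedBall, dist_eq_norm] at hyz
      rw [← norm_neg]
      rw [show -(z - y - s • e) = y - z - -(s • e) by abel]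
      exact hyz

/-- At an interior point a ball inside Ω suffices and the cone plays no role. At a boundary point,
moving from y by s•ν + q raises the height by at least s - ‖q‖, while the graph function rises by at
most L‖q‖; hence the opening 1/(1 + L). -/
theorem exists_ball_cone {d : ℕ} {Ω : Set (Sp d)} (hΩ : IsOpen Ω) (hlip : HasLipschitzBoundary Ω)
    {x : Sp d} (hx : x ∈ closure Ω) :
    ∃ r : ℝ, 0 < r ∧ ∃ (e : Sp d) (c s₀ : ℝ), 0 < c ∧ 0 < s₀ ∧ ∀ s, 0 < s → s < s₀ →
      ∀ y ∈ Ω, ∀ z ∈ Metric.ball x r, ‖z - y - s • e‖ ≤ c * s → z ∈ Ω := by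
  by_cases hxΩ : x ∈ Ω
  · obtain ⟨r, hr, h⟩ := Metric.isOpen_iff.1 hΩ x hxΩ
    exact ⟨r, hr, 0, 1, 1, one_pos, one_pos, fun s _ _ y _ z hz _ => h hz⟩
  have hxf : x ∈ frontier Ω := ⟨hx, fun h => hxΩ (interior_subset h)⟩
  obtain ⟨r, hr, ν, hν, γ, L, hγ, hgraph⟩ := hlip x hxf
  have hL : (0 : ℝ) < 1 + L := by positivity
  -- With s < r/4 one has ‖z - y‖ ≤ 2s < r/2, so y stays in the ball of radius r when z is in the
  -- ball of radius r/2.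
  refine ⟨r / 2, half_pos hr, ν, 1 / (1 + L), r / 4, by positivity, by positivity, ?_⟩
  intro s hs hsr y hy z hz hzy
  have hzr : z ∈ Metric.ball x r := Metric.ball_subset_ball (by linarith) hz
  have hc1 : 1 / (1 + (L : ℝ)) ≤ 1 := by
    rw [div_le_one hL]
    have := L.2
    simp
  have hyr : y ∈ Metric.ball x r := by
    have h1 : ‖z - y‖ ≤ 2 * s := by
      calc ‖z - y‖ = ‖(z - y - s • ν) + s • ν‖ := by rw [sub_add_cancel]
        _ ≤ 1 / (1 + L) * s + s := by
            refine (norm_add_le _ _).trans (add_le_add hzy ?_)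
            rw [norm_smul, hν, mul_one, Real.norm_eq_abs, abs_of_pos hs]
        _ ≤ 1 * s + s := by gcongr
        _ = 2 * s := by ring
    have h2 := dist_triangle_left y x z
    rw [dist_eq_norm z y] at h2
    have h3 := Metric.mem_ball.1 hz
    rw [Metric.mem_ball]
    linarith
  refine (hgraph z hzr).2 ?_
  have hyΩ := (hgraph y hyr).1 hy
  set q := z - y - s • ν
  have hzq : z = y + s • ν + q := by simp only [q]; abel
  have hin : inner ℝ ν z = inner ℝ ν y + s + inner ℝ ν q := by
    rw [hzq, inner_add_right, inner_add_smul_unit hν]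
  have hproj : z - inner ℝ ν z • ν - (y - inner ℝ ν y • ν) = q - inner ℝ ν q • ν := by
    rw [hin, hzq, add_smul, add_smul]; abel
  have hqn : ‖q - inner ℝ ν q • ν‖ ≤ ‖q‖ := by
    have h1 : ‖q - inner ℝ ν q • ν‖ ^ 2 = ‖q‖ ^ 2 - (inner ℝ ν q) ^ 2 := by
      rw [norm_sub_sq_real, norm_smul, hν, inner_smul_right, real_inner_comm, Real.norm_eq_abs,
        mul_one, sq_abs]
      ring
    refine le_of_sq_le_sq ?_ (norm_nonneg _)
    rw [h1]
    nlinarith [sq_nonneg (inner ℝ ν q)]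
  have hγ1 := hγ.dist_le_mul (z - inner ℝ ν z • ν) (y - inner ℝ ν y • ν)
  rw [dist_eq_norm, dist_eq_norm, hproj] at hγ1
  have hγ2 : γ (z - inner ℝ ν z • ν) - γ (y - inner ℝ ν y • ν) ≤ L * ‖q‖ :=
    (le_abs_self _).trans (hγ1.trans (by gcongr))
  have hqi : -‖q‖ ≤ inner ℝ ν q := by
    have := abs_real_inner_le_norm ν q
    rw [hν, one_mul] at this
    exact (abs_le.1 this).1
  have hq : (1 + L) * ‖q‖ ≤ s := by
    calc (1 + L) * ‖q‖ ≤ (1 + L) * (1 / (1 + L) * s) := by gcongr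
      _ = s := by field_simp
  have hlt : inner ℝ ν z = inner ℝ ν y + s + inner ℝ ν q := hin
  linarith

/-- On a bounded Lipschitz domain the functions of class `C¹` up to the boundary are dense
in `H¹`. -/
theorem isC1Approximable_of_isWeakGradient {d : ℕ} {Ω : Set (Sp d)} (hΩ : IsOpen Ω)
    (hb : Bornology.IsBounded Ω) (hlip : HasLipschitzBoundary Ω)
    {u : Sp d → ℝ} {gu : Sp d → Sp d} (hum : StronglyMeasurable u) (hgum : StronglyMeasurable gu)
    (hu : MemLp u 2 (muOmega Ω)) (hgu : MemLp gu 2 (muOmega Ω)) (hw : IsWeakGradient Ω u gu) :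
    IsC1Approximable Ω u gu := by
  have hcomp : IsCompact (closure Ω) :=
    Metric.isCompact_of_isClosed_isBounded isClosed_closure hb.closure
  choose! r hr e c s₀ hc hs₀ hcone using fun x (hx : x ∈ closure Ω) => exists_ball_cone hΩ hlip hx
  obtain ⟨t, ht, hcov⟩ := hcomp.elim_nhds_subcover (fun x => Metric.ball x (r x / 2))
    (fun x hx => Metric.ball_mem_nhds x (half_pos (hr x hx)))
  -- Induction on the balls replaces a partition of unity. With a bump b equal to 1 on the ball at
  -- p, write ζ = ζb + ζ(1 - b): the first term is covered by the cone at p, the second vanishes in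
  -- Ω off the remaining balls.
  have key : ∀ s : Finset (Sp d), (∀ x ∈ s, x ∈ closure Ω) → ∀ ζ : Sp d → ℝ, ContDiff ℝ ∞ ζ →
      (∀ y ∈ Ω, (∀ x ∈ s, y ∉ Metric.ball x (r x / 2)) → ζ y = 0) →
      IsC1Approximable Ω (fun x => ζ x * u x) (fun x => ζ x • gu x + u x • gradient ζ x) := by
    intro s
    induction s using Finset.induction_on with
    | empty =>
      intro _ ζ _ h0 ε hε
      have hζ0 : ∀ y ∈ Ω, ζ y = 0 := fun y hy => h0 y hy (by simp)
      have hζ1 : ∀ y ∈ Ω, gradient ζ y = 0 := fun y hy => by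
        have : ζ =ᶠ[𝓝 y] fun _ => (0 : ℝ) := by
          filter_upwards [hΩ.mem_nhds hy] with z hz using hζ0 z hz
        rw [this.gradient_eq]
        exact gradient_const y 0
      have hg0 : gradient (fun _ : Sp d => (0 : ℝ)) = 0 := by
        ext1 y; exact gradient_const y 0
      refine ⟨fun _ => 0, contDiff_const, ?_, ?_⟩
      · rw [eLpNorm_congr_ae (g := fun _ => (0 : ℝ))]
        · simp
        · filter_upwards [ae_restrict_mem hΩ.measurableSet] with y hy
          simp [hζ0 y hy]
      · rw [eLpNorm_congr_ae (g := fun _ => (0 : Sp d))]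
        · simp
        · filter_upwards [ae_restrict_mem hΩ.measurableSet] with y hy
          simp [hζ0 y hy, hζ1 y hy, hg0]
    | insert p s hps ih =>
      intro hs ζ hζ h0
      have hp := hs p (Finset.mem_insert_self _ _)
      have hrp := hr p hp
      let b : ContDiffBump p := ⟨r p / 2, r p * (3 / 4), by positivity, by linarith⟩
      have hbd : ContDiff ℝ ∞ b := b.contDiff
      have hbc : tsupport (fun x => ζ x * b x) ⊆ Metric.ball p (r p) := by
        refine (tsupport_mul_subset_right).trans ?_
        change tsupport b ⊆ _
        rw [b.tsupport_eq]
        exact Metric.closedBall_subset_ball (by simp only [b]; linarith)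
      have h1 := isC1Approximable_of_cone hΩ.measurableSet hum hgum hu hgu hw (hζ.mul hbd)
        b.hasCompactSupport.mul_left (e p) (hc p hp) (hs₀ p hp)
        (fun σ hσ hσ' y hy z hz h => hcone p hp σ hσ hσ' y hy z (hbc hz) h)
      have hcd : ContDiff ℝ ∞ fun x => ζ x * (1 - b x) := hζ.mul (contDiff_const.sub hbd)
      have h2 := ih (fun x hx => hs x (Finset.mem_insert_of_mem hx)) _ hcd (by
        intro y hy hys
        by_cases hyp : y ∈ Metric.ball p (r p / 2)
        · rw [b.one_of_mem_closedBall (Metric.ball_subset_closedBall hyp)]; ring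
        · rw [h0 y hy, zero_mul]
          intro x hx
          rcases Finset.mem_insert.1 hx with rfl | hx
          · exact hyp
          · exact hys x hx)
      have m : ∀ η : Sp d → ℝ, ContDiff ℝ ∞ η →
          AEStronglyMeasurable (fun x => η x * u x) (muOmega Ω) ∧
          AEStronglyMeasurable (fun x => η x • gu x + u x • gradient η x) (muOmega Ω) :=
        fun η hη => ⟨(hη.continuous.stronglyMeasurable.mul hum).aestronglyMeasurable,
          ((hη.continuous.stronglyMeasurable.smul hgum).add (hum.smul
            (continuous_gradient (hη.of_le (by simp))).stronglyMeasurable)).aestronglyMeasurable⟩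
      have h3 := h1.add h2 (m _ (hζ.mul hbd)).1 (m _ hcd).1 (m _ (hζ.mul hbd)).2 (m _ hcd).2
      have e1 : (fun x => ζ x * u x) = fun x => ζ x * b x * u x + ζ x * (1 - b x) * u x := by
        ext x; ring
      have e2 : (fun x => ζ x • gu x + u x • gradient ζ x) = fun x =>
          ((ζ x * b x) • gu x + u x • gradient (fun y => ζ y * b y) x) +
          ((ζ x * (1 - b x)) • gu x + u x • gradient (fun y => ζ y * (1 - b y)) x) := by
        ext1 x
        have hζ' : ζ = fun y => ζ y * b y + ζ y * (1 - b y) := by ext y; ring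
        have := gradient_add (((hζ.mul hbd).differentiable (by simp)) x)
          ((hcd.differentiable (by simp)) x)
        rw [← hζ'] at this
        rw [this]
        module
      rw [e1, e2]
      exact h3
  have h1 := key t ht (fun _ => 1) contDiff_const (fun y hy hn => by
    obtain ⟨x, hx, hyx⟩ := mem_iUnion₂.1 (hcov (subset_closure hy))
    exact absurd hyx (hn x hx))
  have hg1 : gradient (fun _ : Sp d => (1 : ℝ)) = 0 := by
    ext1 y; exact gradient_const y 1
  simpa [hg1] using h1

end CrowdControl

/-! ### The Hilbert space `H¹` and its trace operator -/

namespace CrowdControl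

variable {d : ℕ} {Ω : Set (Sp d)}

/-- If `f n → f` in `L²` then `∫ f n • g → ∫ f • g` for `g ∈ L²`. -/
theorem tendsto_integral_smul_left {α F : Type*} [MeasurableSpace α] {μ : Measure α}
    [NormedAddCommGroup F] [NormedSpace ℝ F] {f : ℕ → α → ℝ} {f₀ : α → ℝ} {g : α → F}
    (hf : ∀ n, MemLp (f n) 2 μ) (hf₀ : MemLp f₀ 2 μ) (hg : MemLp g 2 μ)
    (h : Tendsto (fun n => eLpNorm (fun x => f n x - f₀ x) 2 μ) atTop (𝓝 0)) :
    Tendsto (fun n => ∫ x, f n x • g x ∂μ) atTop (𝓝 (∫ x, f₀ x • g x ∂μ)) := by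
  have i₀ : Integrable (fun x => f₀ x • g x) μ := memLp_one_iff_integrable.1 (hg.smul hf₀)
  have i₁ : ∀ n, Integrable (fun x => f n x • g x) μ := fun n =>
    memLp_one_iff_integrable.1 (hg.smul (hf n))
  refine tendsto_integral_of_L1' _ i₀.aestronglyMeasurable (.of_forall i₁) ?_
  have h1 : Tendsto (fun n => eLpNorm (fun x => f n x - f₀ x) 2 μ * eLpNorm g 2 μ) atTop (𝓝 0) := by
    simpa using ENNReal.Tendsto.mul_const h (.inr hg.eLpNorm_lt_top.ne)
  refine tendsto_of_tendsto_of_tendsto_of_le_of_le tendsto_const_nhds h1 (fun _ => zero_le) ?_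
  intro n
  refine le_trans (le_of_eq ?_) (eLpNorm_smul_le_mul_eLpNorm (p := 2) (q := 2)
    (r := 1) hg.aestronglyMeasurable
    ((hf n).sub hf₀).aestronglyMeasurable)
  exact eLpNorm_congr_ae (.of_forall fun x => (sub_smul (f n x) (f₀ x) (g x)).symm)

theorem tendsto_integral_smul_right {α F : Type*} [MeasurableSpace α] {μ : Measure α}
    [NormedAddCommGroup F] [NormedSpace ℝ F] {g : ℕ → α → F} {g₀ : α → F} {f : α → ℝ}
    (hg : ∀ n, MemLp (g n) 2 μ) (hg₀ : MemLp g₀ 2 μ) (hf : MemLp f 2 μ)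
    (h : Tendsto (fun n => eLpNorm (fun x => g n x - g₀ x) 2 μ) atTop (𝓝 0)) :
    Tendsto (fun n => ∫ x, f x • g n x ∂μ) atTop (𝓝 (∫ x, f x • g₀ x ∂μ)) := by
  have i₀ : Integrable (fun x => f x • g₀ x) μ := memLp_one_iff_integrable.1 (hg₀.smul hf)
  have i₁ : ∀ n, Integrable (fun x => f x • g n x) μ := fun n =>
    memLp_one_iff_integrable.1 ((hg n).smul hf)
  refine tendsto_integral_of_L1' _ i₀.aestronglyMeasurable (.of_forall i₁) ?_
  have h1 : Tendsto (fun n => eLpNorm f 2 μ * eLpNorm (fun x => g n x - g₀ x) 2 μ) atTop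
      (𝓝 0) := by
    simpa using ENNReal.Tendsto.const_mul h (.inr hf.eLpNorm_lt_top.ne)
  refine tendsto_of_tendsto_of_tendsto_of_le_of_le tendsto_const_nhds h1 (fun _ => zero_le) ?_
  intro n
  refine le_trans (le_of_eq ?_) (eLpNorm_smul_le_mul_eLpNorm (p := 2) (q := 2)
    (r := 1)
    ((hg n).sub hg₀).aestronglyMeasurable hf.aestronglyMeasurable)
  exact eLpNorm_congr_ae (.of_forall fun x => (smul_sub (f x) (g n x) (g₀ x)).symm)

theorem isWeakGradient_of_tendsto {u : ℕ → Sp d → ℝ} {g : ℕ → Sp d → Sp d} {u₀ : Sp d → ℝ}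
    {g₀ : Sp d → Sp d} (hu : ∀ n, MemLp (u n) 2 (muOmega Ω)) (hu₀ : MemLp u₀ 2 (muOmega Ω))
    (hg : ∀ n, MemLp (g n) 2 (muOmega Ω)) (hg₀ : MemLp g₀ 2 (muOmega Ω))
    (hw : ∀ n, IsWeakGradient Ω (u n) (g n))
    (h : Tendsto (fun n => eLpNorm (fun x => u n x - u₀ x) 2 (muOmega Ω)) atTop (𝓝 0))
    (h' : Tendsto (fun n => eLpNorm (fun x => g n x - g₀ x) 2 (muOmega Ω)) atTop (𝓝 0)) :
    IsWeakGradient Ω u₀ g₀ := by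
  intro φ hφ hφc hφs
  have h1 := tendsto_integral_smul_left hu hu₀ (memLp_gradient_test Ω hφ hφc) h
  have h2 := (tendsto_integral_smul_right hg hg₀ (memLp_test Ω hφ hφc) h').neg
  refine tendsto_nhds_unique h1 (h2.congr fun n => ?_)
  exact (hw n φ hφ hφc hφs).symm

/-- The test function vanishes outside Ω, so this is integration by parts on the whole space and
needs nothing of the boundary. -/
theorem isWeakGradient_gradient {f : Sp d → ℝ} (hf : ContDiff ℝ 1 f) :
    IsWeakGradient Ω f (gradient f) := by
  intro φ hφ hφc hφs
  have hz : ∀ x, x ∉ Ω → φ x = 0 := fun x hx =>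
    image_eq_zero_of_notMem_tsupport fun h => hx (hφs h)
  have hz' : ∀ x, x ∉ Ω → gradient φ x = 0 := fun x hx =>
    gradient_eq_zero_of_notMem_tsupport fun h => hx (hφs h)
  rw [setIntegral_eq_integral_of_forall_compl_eq_zero fun x hx => by rw [hz' x hx, smul_zero],
    setIntegral_eq_integral_of_forall_compl_eq_zero fun x hx => by rw [hz x hx, zero_smul]]
  have hfd := hf.differentiable one_ne_zero
  have hφd := hφ.differentiable (by simp)
  have hgf := continuous_gradient hf
  have hgφ := continuous_gradient (hφ.of_le (m := 1) (by simp))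
  have i1 : Integrable fun x => f x • gradient φ x :=
    (hf.continuous.smul hgφ).integrable_of_hasCompactSupport
      (HasCompactSupport.intro hφc.isCompact fun x hx => by
        change f x • gradient φ x = 0
        rw [gradient_eq_zero_of_notMem_tsupport hx, smul_zero])
  have i2 : Integrable fun x => φ x • gradient f x :=
    (hφ.continuous.smul hgf).integrable_of_hasCompactSupport
      (HasCompactSupport.intro hφc.isCompact fun x hx => by
        change φ x • gradient f x = 0
        rw [image_eq_zero_of_notMem_tsupport hx, zero_smul])
  have i3 : Integrable fun x => f x * φ x :=
    (hf.continuous.mul hφ.continuous).integrable_of_hasCompactSupport hφc.mul_left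
  refine ext_inner_left ℝ fun w => ?_
  rw [inner_neg_right, ← integral_inner i1, ← integral_inner i2]
  have e1 : ∀ x, inner ℝ w (f x • gradient φ x) = f x * fderiv ℝ φ x w := fun x => by
    rw [inner_smul_right, inner_gradient_right]; rfl
  have e2 : ∀ x, inner ℝ w (φ x • gradient f x) = fderiv ℝ f x w * φ x := fun x => by
    rw [inner_smul_right, inner_gradient_right, mul_comm]; rfl
  simp_rw [e1, e2]
  refine integral_mul_fderiv_eq_neg_fderiv_mul_of_integrable ?_ ?_ i3 (fun x _ => hfd x)
    (fun x _ => hφd x)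
  · exact (i2.const_inner (𝕜 := ℝ) w).congr (.of_forall e2)
  · exact (i1.const_inner (𝕜 := ℝ) w).congr (.of_forall e1)

/-- A bounded open set with Lipschitz boundary. -/
structure IsLipschitzDomain (Ω : Set (Sp d)) : Prop where
  isOpen : IsOpen Ω
  isBounded : Bornology.IsBounded Ω
  lip : HasLipschitzBoundary Ω

theorem IsLipschitzDomain.isFiniteMeasure (hΩ : IsLipschitzDomain Ω) :
    IsFiniteMeasure (muOmega Ω) :=
  ⟨by rw [Measure.restrict_apply_univ]; exact hΩ.isBounded.measure_lt_top⟩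

theorem IsLipschitzDomain.memLp_of_continuous {F : Type*} [NormedAddCommGroup F]
    (hΩ : IsLipschitzDomain Ω) {f : Sp d → F} (hf : Continuous f) : MemLp f 2 (muOmega Ω) := by
  have hc : IsCompact (closure Ω) :=
    Metric.isCompact_of_isClosed_isBounded isClosed_closure hΩ.isBounded.closure
  obtain ⟨C, hC⟩ := hc.exists_bound_of_continuousOn hf.continuousOn
  have := hΩ.isFiniteMeasure
  refine MemLp.of_bound hf.aestronglyMeasurable C ?_
  filter_upwards [ae_restrict_mem hΩ.isOpen.measurableSet] with x hx using hC x (subset_closure hx)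

theorem isClosed_h1Submodule : IsClosed (h1Submodule Ω : Set
    (WithLp 2 (Lp ℝ 2 (muOmega Ω) × Lp (Sp d) 2 (muOmega Ω)))) := by
  refine isSeqClosed_iff_isClosed.1 fun p q hp hpq => ?_
  have h1 := ((WithLp.fstL 2 ℝ (Lp ℝ 2 (muOmega Ω)) (Lp (Sp d) 2 (muOmega Ω))).continuous.tendsto q).comp hpq
  have h2 := ((WithLp.sndL 2 ℝ (Lp ℝ 2 (muOmega Ω)) (Lp (Sp d) 2 (muOmega Ω))).continuous.tendsto q).comp hpq
  exact isWeakGradient_of_tendsto (fun n => Lp.memLp _) (Lp.memLp _) (fun n => Lp.memLp _)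
    (Lp.memLp _) hp ((Lp.tendsto_Lp_iff_tendsto_eLpNorm' _ _).1 h1)
    ((Lp.tendsto_Lp_iff_tendsto_eLpNorm' _ _).1 h2)

instance : CompleteSpace (H1 Ω) := isClosed_h1Submodule.completeSpace_coe

/-- The embedding of `H¹(Ω)` in `L²(Ω)`. -/
noncomputable def h1fnL (Ω : Set (Sp d)) : H1 Ω →L[ℝ] Lp ℝ 2 (muOmega Ω) :=
  (WithLp.fstL 2 ℝ _ _).comp (h1Submodule Ω).subtypeL

/-- The gradient on `H¹(Ω)`. -/
noncomputable def h1gradL (Ω : Set (Sp d)) : H1 Ω →L[ℝ] Lp (Sp d) 2 (muOmega Ω) :=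
  (WithLp.sndL 2 ℝ _ _).comp (h1Submodule Ω).subtypeL

theorem h1fnL_apply (u : H1 Ω) : h1fnL Ω u = h1fn u := rfl

theorem h1gradL_apply (u : H1 Ω) : h1gradL Ω u = h1grad u := rfl

theorem h1_norm_sq (u : H1 Ω) : ‖u‖ ^ 2 = ‖h1fn u‖ ^ 2 + ‖h1grad u‖ ^ 2 :=
  WithLp.prod_norm_sq_eq_of_L2 u.1

theorem norm_h1fn_le (u : H1 Ω) : ‖h1fn u‖ ≤ ‖u‖ :=
  le_of_sq_le_sq (by rw [h1_norm_sq]; nlinarith [sq_nonneg ‖h1grad u‖]) (norm_nonneg _)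

theorem norm_h1grad_le (u : H1 Ω) : ‖h1grad u‖ ≤ ‖u‖ :=
  le_of_sq_le_sq (by rw [h1_norm_sq]; nlinarith [sq_nonneg ‖h1fn u‖]) (norm_nonneg _)

theorem tendsto_h1_iff {u : ℕ → H1 Ω} {u₀ : H1 Ω} : Tendsto u atTop (𝓝 u₀) ↔
    Tendsto (fun n => h1fn (u n)) atTop (𝓝 (h1fn u₀)) ∧
    Tendsto (fun n => h1grad (u n)) atTop (𝓝 (h1grad u₀)) := by
  refine ⟨fun h => ⟨((h1fnL Ω).continuous.tendsto u₀).comp h,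
    ((h1gradL Ω).continuous.tendsto u₀).comp h⟩, fun ⟨h1, h2⟩ => ?_⟩
  rw [tendsto_iff_norm_sub_tendsto_zero] at *
  have h3 := (h1.pow 2).add (h2.pow 2)
  have h4 : Tendsto (fun n => ‖u n - u₀‖ ^ 2) atTop (𝓝 0) := by
    simp only [ne_eq, OfNat.ofNat_ne_zero, not_false_eq_true, zero_pow, add_zero] at h3
    refine h3.congr fun n => ?_
    rw [h1_norm_sq]; rfl
  simpa using h4.sqrt

theorem gradient_sub {f g : Sp d → ℝ} {x : Sp d} (hf : DifferentiableAt ℝ f x)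
    (hg : DifferentiableAt ℝ g x) :
    gradient (fun y => f y - g y) x = gradient f x - gradient g x := by
  rw [gradient, fderiv_fun_sub hf hg, map_sub]
  simp [gradient]

theorem gradient_const_mul {f : Sp d → ℝ} {x : Sp d} (hf : DifferentiableAt ℝ f x) (c : ℝ) :
    gradient (fun y => c * f y) x = c • gradient f x := by
  rw [gradient, fderiv_const_mul hf, map_smulₛₗ]
  simp [gradient]

theorem IsLipschitzDomain.exists_eLpNorm_surf_le (hΩ : IsLipschitzDomain Ω) :
    ∃ C : ℝ≥0∞, C ≠ ⊤ ∧ ∀ f : Sp d → ℝ, ContDiff ℝ 1 f → eLpNorm f 2 (surf Ω) ≤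
      C * (eLpNorm f 2 (muOmega Ω) + eLpNorm (gradient f) 2 (muOmega Ω)) := by
  obtain ⟨C, hC, h⟩ := exists_trace_inequality hΩ.isOpen hΩ.isBounded hΩ.lip
  -- The inequality C ≤ (C + 1)² avoids taking a square root of the constant.
  refine ⟨C + 1, by simp [hC], fun f hf => ?_⟩
  rw [eLpNorm_two_le_iff]
  refine (h f hf).trans ?_
  rw [lintegral_add_left (hf.continuous.enorm.measurable.pow_const 2), ← sq_eLpNorm_two,
    ← sq_eLpNorm_two, mul_pow]
  refine mul_le_mul' ?_ ?_
  · calc C ≤ (C + 1) * 1 := by rw [mul_one]; exact le_self_add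
      _ ≤ (C + 1) * (C + 1) := mul_le_mul' le_rfl le_add_self
      _ = _ := (sq _).symm
  · rw [add_sq]
    have : ∀ a b c : ℝ≥0∞, a + c ≤ a + b + c := fun a b c => by
      gcongr; exact le_self_add
    exact this _ _ _

theorem IsLipschitzDomain.memLp_surf (hΩ : IsLipschitzDomain Ω) {f : Sp d → ℝ}
    (hf : ContDiff ℝ 1 f) : MemLp f 2 (surf Ω) := by
  obtain ⟨C, hC, h⟩ := hΩ.exists_eLpNorm_surf_le
  refine ⟨hf.continuous.aestronglyMeasurable, (h f hf).trans_lt ?_⟩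
  exact ENNReal.mul_lt_top (lt_top_iff_ne_top.2 hC) (ENNReal.add_lt_top.2
    ⟨(hΩ.memLp_of_continuous hf.continuous).2, (hΩ.memLp_of_continuous (continuous_gradient hf)).2⟩)

theorem eLpNorm_sub_le_of_center {α F : Type*} [MeasurableSpace α] {μ : Measure α}
    [NormedAddCommGroup F] {f g u : α → F} (hf : AEStronglyMeasurable f μ)
    (hg : AEStronglyMeasurable g μ) (hu : AEStronglyMeasurable u μ) :
    eLpNorm (fun x => f x - g x) 2 μ ≤
      eLpNorm (fun x => f x - u x) 2 μ + eLpNorm (fun x => g x - u x) 2 μ := by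
  refine le_trans (le_of_eq ?_) (eLpNorm_sub_le (hf.sub hu) (hg.sub hu) (by norm_num))
  congr 1; ext x; simp

/-- The trace inequality applied to differences of `C¹` approximants makes their boundary values a
Cauchy sequence in `L²` of the boundary. -/
theorem IsLipschitzDomain.exists_isTrace (hΩ : IsLipschitzDomain Ω) (u : H1 Ω) :
    ∃ g, IsTrace u g := by
  obtain ⟨C, hC, hCf⟩ := hΩ.exists_eLpNorm_surf_le
  have happ := isC1Approximable_of_isWeakGradient hΩ.isOpen hΩ.isBounded hΩ.lip
    (Lp.stronglyMeasurable (h1fn u)) (Lp.stronglyMeasurable (h1grad u)) (Lp.memLp _) (Lp.memLp _)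
    u.2
  have hε : ∀ n : ℕ, (0 : ℝ≥0∞) < ((n : ℝ≥0∞) + 1)⁻¹ := fun n => by simp
  have hε0 : Tendsto (fun n : ℕ => ((n : ℝ≥0∞) + 1)⁻¹) atTop (𝓝 0) := by
    have := (tendsto_add_atTop_iff_nat 1).2 ENNReal.tendsto_inv_nat_nhds_zero
    simpa using this
  choose f hf h1 h2 using fun n => happ _ (hε n)
  have hs : ∀ n, MemLp (f n) 2 (surf Ω) := fun n => hΩ.memLp_surf (hf n)
  have hcau : CauchySeq fun n => (hs n).toLp := by
    rw [Lp.cauchySeq_Lp_iff_cauchySeq_eLpNorm]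
    have hb : ∀ n : ℕ × ℕ, eLpNorm (⇑(hs n.1).toLp - ⇑(hs n.2).toLp) 2 (surf Ω) ≤
        C * (2 * (((n.1 : ℝ≥0∞) + 1)⁻¹ + ((n.2 : ℝ≥0∞) + 1)⁻¹)) := by
      intro n
      have e1 : eLpNorm (⇑(hs n.1).toLp - ⇑(hs n.2).toLp) 2 (surf Ω) =
          eLpNorm (fun x => f n.1 x - f n.2 x) 2 (surf Ω) := by
        refine eLpNorm_congr_ae ?_
        filter_upwards [(hs n.1).coeFn_toLp, (hs n.2).coeFn_toLp] with x hx hy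
        rw [Pi.sub_apply, hx, hy]
      rw [e1]
      refine (hCf _ ((hf n.1).sub (hf n.2))).trans (mul_le_mul' le_rfl ?_)
      have e2 : gradient (fun x => f n.1 x - f n.2 x) =
          fun x => gradient (f n.1) x - gradient (f n.2) x := by
        ext1 x
        exact gradient_sub ((hf n.1).differentiable one_ne_zero x)
          ((hf n.2).differentiable one_ne_zero x)
      rw [e2, two_mul]
      refine add_le_add ?_ ?_
      · exact (eLpNorm_sub_le_of_center (hf n.1).continuous.aestronglyMeasurable
          (hf n.2).continuous.aestronglyMeasurable (Lp.aestronglyMeasurable (h1fn u))).trans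
          (add_le_add (h1 _) (h1 _))
      · exact (eLpNorm_sub_le_of_center (continuous_gradient (hf n.1)).aestronglyMeasurable
          (continuous_gradient (hf n.2)).aestronglyMeasurable
          (Lp.aestronglyMeasurable (h1grad u))).trans (add_le_add (h2 _) (h2 _))
    refine tendsto_of_tendsto_of_tendsto_of_le_of_le tendsto_const_nhds ?_ (fun _ => zero_le) hb
    rw [← prod_atTop_atTop_eq]
    have := (hε0.comp (tendsto_fst (f := atTop) (g := (atTop : Filter ℕ)))).add
      (hε0.comp (tendsto_snd (f := (atTop : Filter ℕ)) (g := atTop)))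
    have := ENNReal.Tendsto.const_mul (ENNReal.Tendsto.const_mul this
      (.inr (by norm_num : (2 : ℝ≥0∞) ≠ ⊤))) (.inr hC)
    simpa using this
  obtain ⟨g, hg⟩ := cauchySeq_tendsto_of_complete hcau
  refine ⟨g, f, hf, ?_, ?_, ?_⟩
  · exact tendsto_of_tendsto_of_tendsto_of_le_of_le tendsto_const_nhds hε0 (fun _ => zero_le) h1
  · exact tendsto_of_tendsto_of_tendsto_of_le_of_le tendsto_const_nhds hε0 (fun _ => zero_le) h2
  · rw [Lp.tendsto_Lp_iff_tendsto_eLpNorm'] at hg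
    refine hg.congr fun n => eLpNorm_congr_ae ?_
    filter_upwards [(hs n).coeFn_toLp] with x hx
    rw [Pi.sub_apply, hx]

theorem IsTrace.sub {u v : H1 Ω} {g h : Lp ℝ 2 (surf Ω)} (hu : IsTrace u g) (hv : IsTrace v h) :
    IsTrace (u - v) (g - h) := by
  obtain ⟨a, ha, a1, a2, a3⟩ := hu
  obtain ⟨b, hb, b1, b2, b3⟩ := hv
  refine ⟨fun n x => a n x - b n x, fun n => (ha n).sub (hb n), ?_, ?_, ?_⟩
  · have := a1.add b1
    rw [add_zero] at this
    refine tendsto_of_tendsto_of_tendsto_of_le_of_le tendsto_const_nhds this (fun _ => zero_le) ?_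
    intro n
    refine le_trans (le_of_eq ?_) (eLpNorm_sub_le
      ((ha n).continuous.aestronglyMeasurable.sub (Lp.aestronglyMeasurable _))
      ((hb n).continuous.aestronglyMeasurable.sub (Lp.aestronglyMeasurable _)) (by norm_num))
    refine eLpNorm_congr_ae ?_
    filter_upwards [Lp.coeFn_sub (h1fn u) (h1fn v)] with x hx
    change a n x - b n x - (h1fn u - h1fn v : Lp ℝ 2 (muOmega Ω)) x = _
    rw [hx]; simp only [Pi.sub_apply]; ring
  · have := a2.add b2
    rw [add_zero] at this
    refine tendsto_of_tendsto_of_tendsto_of_le_of_le tendsto_const_nhds this (fun _ => zero_le) ?_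
    intro n
    refine le_trans (le_of_eq ?_) (eLpNorm_sub_le
      ((continuous_gradient (ha n)).aestronglyMeasurable.sub (Lp.aestronglyMeasurable _))
      ((continuous_gradient (hb n)).aestronglyMeasurable.sub (Lp.aestronglyMeasurable _))
      (by norm_num))
    refine eLpNorm_congr_ae ?_
    filter_upwards [Lp.coeFn_sub (h1grad u) (h1grad v)] with x hx
    change gradient (fun y => a n y - b n y) x -
      (h1grad u - h1grad v : Lp (Sp d) 2 (muOmega Ω)) x = _
    rw [hx, gradient_sub ((ha n).differentiable one_ne_zero x)
      ((hb n).differentiable one_ne_zero x)]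
    simp only [Pi.sub_apply]; abel
  · have := a3.add b3
    rw [add_zero] at this
    refine tendsto_of_tendsto_of_tendsto_of_le_of_le tendsto_const_nhds this (fun _ => zero_le) ?_
    intro n
    refine le_trans (le_of_eq ?_) (eLpNorm_sub_le
      ((ha n).continuous.aestronglyMeasurable.sub (Lp.aestronglyMeasurable _))
      ((hb n).continuous.aestronglyMeasurable.sub (Lp.aestronglyMeasurable _)) (by norm_num))
    refine eLpNorm_congr_ae ?_
    filter_upwards [Lp.coeFn_sub g h] with x hx
    rw [hx]; simp only [Pi.sub_apply]; ring

theorem IsTrace.smul {u : H1 Ω} {g : Lp ℝ 2 (surf Ω)} (c : ℝ) (hu : IsTrace u g) :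
    IsTrace (c • u) (c • g) := by
  obtain ⟨a, ha, a1, a2, a3⟩ := hu
  have key : ∀ {x : ℕ → ℝ≥0∞}, Tendsto x atTop (𝓝 0) →
      Tendsto (fun n => ‖c‖ₑ * x n) atTop (𝓝 0) := fun h => by
    simpa using ENNReal.Tendsto.const_mul h (.inr enorm_ne_top)
  refine ⟨fun n x => c * a n x, fun n => contDiff_const.mul (ha n), ?_, ?_, ?_⟩
  · refine tendsto_of_tendsto_of_tendsto_of_le_of_le tendsto_const_nhds (key a1)
      (fun _ => zero_le) fun n => le_trans (le_of_eq ?_)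
        (eLpNorm_const_smul_le (c := c) (f := fun x => a n x - h1fn u x))
    refine eLpNorm_congr_ae ?_
    filter_upwards [Lp.coeFn_smul c (h1fn u)] with x hx
    change c * a n x - (c • h1fn u : Lp ℝ 2 (muOmega Ω)) x = _
    rw [hx]; simp only [Pi.smul_apply, smul_eq_mul]; ring
  · refine tendsto_of_tendsto_of_tendsto_of_le_of_le tendsto_const_nhds (key a2)
      (fun _ => zero_le) fun n => le_trans (le_of_eq ?_)
        (eLpNorm_const_smul_le (c := c) (f := fun x => gradient (a n) x - h1grad u x))
    refine eLpNorm_congr_ae ?_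
    filter_upwards [Lp.coeFn_smul c (h1grad u)] with x hx
    change gradient (fun y => c * a n y) x - (c • h1grad u : Lp (Sp d) 2 (muOmega Ω)) x = _
    rw [hx, gradient_const_mul ((ha n).differentiable one_ne_zero x)]
    simp only [Pi.smul_apply, smul_sub]
  · refine tendsto_of_tendsto_of_tendsto_of_le_of_le tendsto_const_nhds (key a3)
      (fun _ => zero_le) fun n => le_trans (le_of_eq ?_)
        (eLpNorm_const_smul_le (c := c) (f := fun x => a n x - g x))
    refine eLpNorm_congr_ae ?_
    filter_upwards [Lp.coeFn_smul c g] with x hx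
    rw [hx]; simp only [Pi.smul_apply, smul_eq_mul]; ring

/-- The trace inequality passes to the limit along any sequence defining a trace. Applied to the
zero function it yields uniqueness, and in general the continuity of the trace operator. -/
theorem IsLipschitzDomain.exists_norm_isTrace_le (hΩ : IsLipschitzDomain Ω) :
    ∃ C : ℝ, 0 ≤ C ∧ ∀ (u : H1 Ω) (g : Lp ℝ 2 (surf Ω)), IsTrace u g → ‖g‖ ≤ C * ‖u‖ := by
  obtain ⟨C, hC, hCf⟩ := hΩ.exists_eLpNorm_surf_le
  -- The factor 2 comes from bounding the norms of u and of its gradient each by the `H¹` norm.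
  refine ⟨C.toReal * 2, by positivity, ?_⟩
  rintro u g ⟨f, hf, h1, h2, h3⟩
  set A := eLpNorm (h1fn u) 2 (muOmega Ω)
  set B := eLpNorm (h1grad u) 2 (muOmega Ω)
  have hle : ∀ n, eLpNorm g 2 (surf Ω) ≤ eLpNorm (fun x => f n x - g x) 2 (surf Ω) +
      C * ((eLpNorm (fun x => f n x - h1fn u x) 2 (muOmega Ω) + A) +
        (eLpNorm (fun x => gradient (f n) x - h1grad u x) 2 (muOmega Ω) + B)) := by
    intro n
    have m1 : AEStronglyMeasurable (f n) (surf Ω) := (hf n).continuous.aestronglyMeasurable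
    have m2 : AEStronglyMeasurable (f n) (muOmega Ω) := (hf n).continuous.aestronglyMeasurable
    have m3 : AEStronglyMeasurable (gradient (f n)) (muOmega Ω) :=
      (continuous_gradient (hf n)).aestronglyMeasurable
    have a1 : eLpNorm g 2 (surf Ω) ≤
        eLpNorm (f n) 2 (surf Ω) + eLpNorm (fun x => f n x - g x) 2 (surf Ω) := by
      refine le_trans (le_of_eq ?_) (eLpNorm_sub_le m1 (m1.sub (Lp.aestronglyMeasurable g))
        (by norm_num))
      congr 1; ext x; simp
    have a2 : eLpNorm (f n) 2 (muOmega Ω) ≤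
        eLpNorm (fun x => f n x - h1fn u x) 2 (muOmega Ω) + A := by
      refine le_trans (le_of_eq ?_) (eLpNorm_add_le (m2.sub (Lp.aestronglyMeasurable (h1fn u)))
        (Lp.aestronglyMeasurable (h1fn u)) (by norm_num))
      congr 1; ext x; simp
    have a3 : eLpNorm (gradient (f n)) 2 (muOmega Ω) ≤
        eLpNorm (fun x => gradient (f n) x - h1grad u x) 2 (muOmega Ω) + B := by
      refine le_trans (le_of_eq ?_) (eLpNorm_add_le (m3.sub (Lp.aestronglyMeasurable (h1grad u)))
        (Lp.aestronglyMeasurable (h1grad u)) (by norm_num))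
      congr 1; ext1 x; simp
    rw [add_comm] at a1
    exact a1.trans (add_le_add le_rfl ((hCf _ (hf n)).trans
      (mul_le_mul' le_rfl (add_le_add a2 a3))))
  have hlim := h3.add (ENNReal.Tendsto.const_mul ((h1.add_const A).add (h2.add_const B))
    (.inr hC))
  have h4 := ge_of_tendsto hlim (.of_forall hle)
  simp only [zero_add] at h4
  have hA : A ≠ ⊤ := (Lp.memLp (h1fn u)).eLpNorm_ne_top
  have hB : B ≠ ⊤ := (Lp.memLp (h1grad u)).eLpNorm_ne_top
  have h5 := ENNReal.toReal_mono (ENNReal.mul_ne_top hC (ENNReal.add_ne_top.2 ⟨hA, hB⟩)) h4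
  rw [ENNReal.toReal_mul, ENNReal.toReal_add hA hB, ← Lp.norm_def] at h5
  have h6 : A.toReal = ‖h1fn u‖ := (Lp.norm_def _).symm
  have h7 : B.toReal = ‖h1grad u‖ := (Lp.norm_def _).symm
  rw [h6, h7] at h5
  have h8 := norm_h1fn_le u
  have h9 := norm_h1grad_le u
  have h10 : (0 : ℝ) ≤ C.toReal := ENNReal.toReal_nonneg
  nlinarith

theorem IsLipschitzDomain.isTrace_unique (hΩ : IsLipschitzDomain Ω) {u : H1 Ω}
    {g h : Lp ℝ 2 (surf Ω)} (hg : IsTrace u g) (hh : IsTrace u h) : g = h := by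
  obtain ⟨C, _, hC⟩ := hΩ.exists_norm_isTrace_le
  have := hC _ _ (hg.sub hh)
  rw [sub_self, norm_zero, mul_zero] at this
  exact sub_eq_zero.1 (norm_le_zero_iff.1 this)

theorem IsLipschitzDomain.isTrace_trace (hΩ : IsLipschitzDomain Ω) (u : H1 Ω) :
    IsTrace u (trace u) :=
  Classical.epsilon_spec (hΩ.exists_isTrace u)

theorem IsLipschitzDomain.trace_eq (hΩ : IsLipschitzDomain Ω) {u : H1 Ω} {g : Lp ℝ 2 (surf Ω)}
    (h : IsTrace u g) : trace u = g :=
  hΩ.isTrace_unique (hΩ.isTrace_trace u) h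

/-- The trace operator. -/
noncomputable def IsLipschitzDomain.traceL (hΩ : IsLipschitzDomain Ω) :
    H1 Ω →L[ℝ] Lp ℝ 2 (surf Ω) :=
  have h : ∀ u v : H1 Ω, ∀ c : ℝ, trace (c • u) = c • trace u ∧
      trace (u - v) = trace u - trace v := fun u v c =>
    ⟨hΩ.trace_eq ((hΩ.isTrace_trace u).smul c),
      hΩ.trace_eq ((hΩ.isTrace_trace u).sub (hΩ.isTrace_trace v))⟩
  LinearMap.mkContinuousOfExistsBound
    { toFun := trace
      map_add' := fun u v => by
        have h1 := (h u ((-1 : ℝ) • v) 0).2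
        rw [(h v v (-1)).1] at h1
        simpa using h1
      map_smul' := fun c u => (h u u c).1 }
    (by
      obtain ⟨C, _, hC⟩ := hΩ.exists_norm_isTrace_le
      exact ⟨C, fun u => hC u _ (hΩ.isTrace_trace u)⟩)

theorem IsLipschitzDomain.traceL_apply (hΩ : IsLipschitzDomain Ω) (u : H1 Ω) :
    hΩ.traceL u = trace u := rfl

end CrowdControl

/-! ### The chain rule in `H¹` -/

namespace CrowdControl

theorem exists_subseq_ae_tendsto_of_eLpNorm {α F : Type*} [MeasurableSpace α] {μ : Measure α}
    [NormedAddCommGroup F] {v : ℕ → α → F} {v₀ : α → F}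
    (hv : ∀ n, AEStronglyMeasurable (v n) μ) (hv₀ : AEStronglyMeasurable v₀ μ)
    (h : Tendsto (fun n => eLpNorm (fun x => v n x - v₀ x) 2 μ) atTop (𝓝 0)) :
    ∃ ns : ℕ → ℕ, StrictMono ns ∧
      ∀ᵐ x ∂μ, Tendsto (fun i => v (ns i) x) atTop (𝓝 (v₀ x)) :=
  (tendstoInMeasure_of_tendsto_eLpNorm two_ne_zero hv hv₀ h).exists_seq_tendsto_ae

/-- Multiplication by a bounded continuous function of a convergent sequence. -/
theorem tendsto_eLpNorm_comp_smul {α F : Type*} [MeasurableSpace α] {μ : Measure α}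
    [NormedAddCommGroup F] [NormedSpace ℝ F] {v : ℕ → α → ℝ} {v₀ : α → ℝ} {g : ℕ → α → F}
    {g₀ : α → F} {c : ℝ → ℝ} (hc : Continuous c) {M : ℝ} (hM : ∀ r, |c r| ≤ M)
    (hv : ∀ n, AEStronglyMeasurable (v n) μ) (hv₀ : AEStronglyMeasurable v₀ μ)
    (hg : ∀ n, AEStronglyMeasurable (g n) μ) (hg₀ : MemLp g₀ 2 μ)
    (h : Tendsto (fun n => eLpNorm (fun x => v n x - v₀ x) 2 μ) atTop (𝓝 0))
    (h' : Tendsto (fun n => eLpNorm (fun x => g n x - g₀ x) 2 μ) atTop (𝓝 0)) :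
    Tendsto (fun n => eLpNorm (fun x => c (v n x) • g n x - c (v₀ x) • g₀ x) 2 μ) atTop
      (𝓝 0) := by
  have hM0 : 0 ≤ M := (abs_nonneg _).trans (hM 0)
  have mcn : ∀ n, AEStronglyMeasurable (fun x => c (v n x)) μ := fun n =>
    hc.comp_aestronglyMeasurable (hv n)
  have mc : AEStronglyMeasurable (fun x => c (v₀ x)) μ := hc.comp_aestronglyMeasurable hv₀
  -- The difference splits as c(vₙ)(gₙ - g₀) + (c(vₙ) - c(v₀))g₀. The first term is bounded by M‖gₙ
  -- - g₀‖; the second is handled by dominated convergence.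
  have hA : Tendsto (fun n => eLpNorm (fun x => (c (v n x) - c (v₀ x)) • g₀ x) 2 μ) atTop
      (𝓝 0) := by
    -- Convergence in `L²` gives a.e. convergence only along subsequences, which is enough.
    refine tendsto_of_subseq_tendsto fun ns hns => ?_
    obtain ⟨ms, -, hae⟩ := exists_subseq_ae_tendsto_of_eLpNorm (fun n => hv (ns n)) hv₀
      (h.comp hns)
    refine ⟨ms, ?_⟩
    have hsq : Tendsto (fun n => ∫⁻ x, ‖(c (v (ns (ms n)) x) - c (v₀ x)) • g₀ x‖ₑ ^ 2 ∂μ) atTop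
        (𝓝 (∫⁻ _x, 0 ∂μ)) := by
      refine tendsto_lintegral_of_dominated_convergence'
        (fun x => (ENNReal.ofReal (2 * M) * ‖g₀ x‖ₑ) ^ 2) ?_ ?_ ?_ ?_
      · intro n
        exact (((mcn _).sub mc).smul hg₀.aestronglyMeasurable).enorm.pow_const 2
      · intro n
        refine .of_forall fun x => pow_le_pow_left' ?_ 2
        rw [enorm_smul]
        refine mul_le_mul' ?_ le_rfl
        rw [← ofReal_norm, Real.norm_eq_abs]
        refine ENNReal.ofReal_le_ofReal ((abs_sub _ _).trans ?_)
        linarith [hM (v (ns (ms n)) x), hM (v₀ x)]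
      · simp_rw [mul_pow]
        rw [lintegral_const_mul' _ _ (ENNReal.pow_ne_top ENNReal.ofReal_ne_top), ← sq_eLpNorm_two]
        exact ENNReal.mul_ne_top (ENNReal.pow_ne_top ENNReal.ofReal_ne_top)
          (ENNReal.pow_ne_top hg₀.eLpNorm_ne_top)
      · filter_upwards [hae] with x hx
        have h1 : Tendsto (fun n => (c (v (ns (ms n)) x) - c (v₀ x)) • g₀ x) atTop (𝓝 0) := by
          have := (((hc.tendsto _).comp hx).sub_const (c (v₀ x))).smul_const (g₀ x)
          simpa using this
        have h2 := ((ENNReal.continuous_pow 2).tendsto 0).comp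
          (by simpa using h1.enorm : Tendsto (fun n =>
            ‖(c (v (ns (ms n)) x) - c (v₀ x)) • g₀ x‖ₑ) atTop (𝓝 0))
        simpa [Function.comp_def] using h2
    rw [lintegral_zero] at hsq
    have h3 := (ENNReal.continuous_rpow_const (y := 1 / 2)).tendsto 0 |>.comp hsq
    rw [ENNReal.zero_rpow_of_pos (by norm_num)] at h3
    refine h3.congr fun n => ?_
    simp only [Function.comp_apply]
    rw [← sq_eLpNorm_two, ← ENNReal.rpow_natCast, ← ENNReal.rpow_mul]
    simp
  have hB : Tendsto (fun n => ENNReal.ofReal M * eLpNorm (fun x => g n x - g₀ x) 2 μ +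
      eLpNorm (fun x => (c (v n x) - c (v₀ x)) • g₀ x) 2 μ) atTop (𝓝 0) := by
    simpa using (ENNReal.Tendsto.const_mul h' (.inr ENNReal.ofReal_ne_top)).add hA
  refine tendsto_of_tendsto_of_tendsto_of_le_of_le tendsto_const_nhds hB (fun _ => zero_le) ?_
  intro n
  have m1 : AEStronglyMeasurable (fun x => c (v n x) • (g n x - g₀ x)) μ :=
    (mcn n).smul ((hg n).sub hg₀.aestronglyMeasurable)
  have m2 : AEStronglyMeasurable (fun x => (c (v n x) - c (v₀ x)) • g₀ x) μ :=
    ((mcn n).sub mc).smul hg₀.aestronglyMeasurable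
  calc _ = eLpNorm ((fun x => c (v n x) • (g n x - g₀ x)) +
        fun x => (c (v n x) - c (v₀ x)) • g₀ x) 2 μ := by
        refine eLpNorm_congr_ae (.of_forall fun x => ?_)
        simp only [Pi.add_apply, smul_sub, sub_smul]; abel
    _ ≤ _ := (eLpNorm_add_le m1 m2 (by norm_num)).trans (add_le_add ?_ le_rfl)
  refine eLpNorm_le_mul_eLpNorm_of_ae_le_mul (.of_forall fun x => ?_) 2
  rw [norm_smul]
  gcongr
  exact hM _

/-- A `C¹` function with bounded derivative that vanishes at the origin. -/
structure IsC1Lipschitz (G : ℝ → ℝ) (M : ℝ) : Prop where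
  contDiff : ContDiff ℝ 1 G
  zero : G 0 = 0
  bound : ∀ r, |deriv G r| ≤ M

namespace IsC1Lipschitz

variable {G : ℝ → ℝ} {M : ℝ}

theorem continuous_deriv (hG : IsC1Lipschitz G M) : Continuous (deriv G) :=
  hG.contDiff.continuous_deriv le_rfl

theorem abs_sub_le (hG : IsC1Lipschitz G M) (a b : ℝ) : |G a - G b| ≤ M * |a - b| := by
  have := convex_univ.norm_image_sub_le_of_norm_deriv_le (f := G) (C := M) (x := b) (y := a)
    (fun x _ => hG.contDiff.differentiable one_ne_zero x) (fun x _ => hG.bound x) (mem_univ _)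
    (mem_univ _)
  simpa using this

theorem abs_le (hG : IsC1Lipschitz G M) (a : ℝ) : |G a| ≤ M * |a| := by
  simpa [hG.zero] using hG.abs_sub_le a 0

theorem nonneg (hG : IsC1Lipschitz G M) : 0 ≤ M := (abs_nonneg _).trans (hG.bound 0)

theorem memLp (hG : IsC1Lipschitz G M) {α : Type*} [MeasurableSpace α] {μ : Measure α}
    {f : α → ℝ} (hf : MemLp f 2 μ) : MemLp (fun x => G (f x)) 2 μ :=
  hf.of_le_mul (hG.contDiff.continuous.comp_aestronglyMeasurable hf.1)
    (.of_forall fun x => hG.abs_le (f x))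

theorem tendsto_eLpNorm (hG : IsC1Lipschitz G M) {α : Type*} [MeasurableSpace α] {μ : Measure α}
    {v : ℕ → α → ℝ} {v₀ : α → ℝ}
    (h : Tendsto (fun n => eLpNorm (fun x => v n x - v₀ x) 2 μ) atTop (𝓝 0)) :
    Tendsto (fun n => eLpNorm (fun x => G (v n x) - G (v₀ x)) 2 μ) atTop (𝓝 0) := by
  have hB : Tendsto (fun n => ENNReal.ofReal M * eLpNorm (fun x => v n x - v₀ x) 2 μ) atTop
      (𝓝 0) := by
    simpa using ENNReal.Tendsto.const_mul h (.inr (ENNReal.ofReal_ne_top (r := M)))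
  exact tendsto_of_tendsto_of_tendsto_of_le_of_le tendsto_const_nhds hB (fun _ => zero_le)
    fun n => eLpNorm_le_mul_eLpNorm_of_ae_le_mul (.of_forall fun x => hG.abs_sub_le _ _) 2

theorem gradient_comp (hG : IsC1Lipschitz G M) {d : ℕ} {f : Sp d → ℝ} {x : Sp d}
    (hf : DifferentiableAt ℝ f x) :
    gradient (fun y => G (f y)) x = deriv G (f x) • gradient f x := by
  have h1 := ((hG.contDiff.differentiable one_ne_zero (f x)).hasDerivAt.comp_hasFDerivAt x
    hf.hasFDerivAt).fderiv
  change (InnerProductSpace.toDual ℝ (Sp d)).symm (fderiv ℝ (G ∘ f) x) = _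
  rw [h1, map_smulₛₗ]
  simp [gradient]

variable {d : ℕ} {Ω : Set (Sp d)}

/-- The chain rule in `H¹(Ω)`, together with the trace of the composition. -/
theorem exists_comp (hG : IsC1Lipschitz G M) (hΩ : IsLipschitzDomain Ω) (u : H1 Ω) :
    ∃ v : H1 Ω, (∀ᵐ x ∂(muOmega Ω), h1fn v x = G (h1fn u x)) ∧
      (∀ᵐ x ∂(muOmega Ω), h1grad v x = deriv G (h1fn u x) • h1grad u x) ∧
      ∀ᵐ x ∂(surf Ω), trace v x = G (trace u x) := by
  obtain ⟨f, hf, h1, h2, h3⟩ := hΩ.isTrace_trace u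
  have hGf : ∀ n, ContDiff ℝ 1 fun x => G (f n x) := fun n => hG.contDiff.comp (hf n)
  have m1 : MemLp (fun x => G (h1fn u x)) 2 (muOmega Ω) := hG.memLp (Lp.memLp _)
  have m2 : MemLp (fun x => deriv G (h1fn u x) • h1grad u x) 2 (muOmega Ω) := by
    refine (Lp.memLp (h1grad u)).of_le_mul (c := M) ?_ (.of_forall fun x => ?_)
    · exact (hG.continuous_deriv.comp_aestronglyMeasurable (Lp.aestronglyMeasurable _)).smul
        (Lp.aestronglyMeasurable _)
    · rw [norm_smul]; gcongr; exact hG.bound _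
  have m3 : MemLp (fun x => G (trace u x)) 2 (surf Ω) := hG.memLp (Lp.memLp _)
  have t1 := hG.tendsto_eLpNorm h1
  have t3 := hG.tendsto_eLpNorm h3
  -- If fₙ approximates u up to the boundary, then G ∘ fₙ approximates G(u) in all three norms, so
  -- the weak gradient and the trace of G(u) are found at once.
  have t2 : Tendsto (fun n => eLpNorm (fun x => gradient (fun y => G (f n y)) x -
      deriv G (h1fn u x) • h1grad u x) 2 (muOmega Ω)) atTop (𝓝 0) := by
    have := tendsto_eLpNorm_comp_smul hG.continuous_deriv hG.bound
      (fun n => (hf n).continuous.aestronglyMeasurable) (Lp.aestronglyMeasurable (h1fn u))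
      (fun n => (continuous_gradient (hf n)).aestronglyMeasurable) (Lp.memLp (h1grad u)) h1 h2
    refine this.congr fun n => eLpNorm_congr_ae (.of_forall fun x => ?_)
    simp only
    rw [hG.gradient_comp ((hf n).differentiable one_ne_zero x)]
  obtain ⟨a₁, e1⟩ : ∃ a : Lp ℝ 2 (muOmega Ω), ∀ᵐ x ∂(muOmega Ω), a x = G (h1fn u x) :=
    ⟨m1.toLp, m1.coeFn_toLp⟩
  obtain ⟨a₂, e2⟩ : ∃ a : Lp (Sp d) 2 (muOmega Ω), ∀ᵐ x ∂(muOmega Ω),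
      a x = deriv G (h1fn u x) • h1grad u x := ⟨m2.toLp, m2.coeFn_toLp⟩
  obtain ⟨a₃, e3⟩ : ∃ a : Lp ℝ 2 (surf Ω), ∀ᵐ x ∂(surf Ω), a x = G (trace u x) :=
    ⟨m3.toLp, m3.coeFn_toLp⟩
  have t1' : Tendsto (fun n => eLpNorm (fun x => G (f n x) - a₁ x) 2 (muOmega Ω)) atTop
      (𝓝 0) := t1.congr fun n => eLpNorm_congr_ae (by
    filter_upwards [e1] with x hx using by rw [hx])
  have t2' : Tendsto (fun n => eLpNorm (fun x => gradient (fun y => G (f n y)) x - a₂ x) 2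
      (muOmega Ω)) atTop (𝓝 0) := t2.congr fun n => eLpNorm_congr_ae (by
    filter_upwards [e2] with x hx using by rw [hx])
  have t3' : Tendsto (fun n => eLpNorm (fun x => G (f n x) - a₃ x) 2 (surf Ω)) atTop
      (𝓝 0) := t3.congr fun n => eLpNorm_congr_ae (by
    filter_upwards [e3] with x hx using by rw [hx])
  have hw : IsWeakGradient Ω a₁ a₂ := isWeakGradient_of_tendsto
    (fun n => hΩ.memLp_of_continuous (hGf n).continuous) (Lp.memLp _)
    (fun n => hΩ.memLp_of_continuous (continuous_gradient (hGf n))) (Lp.memLp _)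
    (fun n => isWeakGradient_gradient (hGf n)) t1' t2'
  let v : H1 Ω := ⟨WithLp.toLp 2 (a₁, a₂), hw⟩
  have htr : trace v = a₃ := hΩ.trace_eq ⟨fun n x => G (f n x), hGf, t1', t2', t3'⟩
  refine ⟨v, e1, e2, ?_⟩
  rwa [htr]

/-- Composition with `G`, as a map of `H¹(Ω)` into itself. -/
noncomputable def compH1 (hG : IsC1Lipschitz G M) (hΩ : IsLipschitzDomain Ω) (u : H1 Ω) : H1 Ω :=
  (hG.exists_comp hΩ u).choose

theorem h1fn_compH1 (hG : IsC1Lipschitz G M) (hΩ : IsLipschitzDomain Ω) (u : H1 Ω) :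
    ∀ᵐ x ∂(muOmega Ω), h1fn (hG.compH1 hΩ u) x = G (h1fn u x) :=
  (hG.exists_comp hΩ u).choose_spec.1

theorem h1grad_compH1 (hG : IsC1Lipschitz G M) (hΩ : IsLipschitzDomain Ω) (u : H1 Ω) :
    ∀ᵐ x ∂(muOmega Ω), h1grad (hG.compH1 hΩ u) x = deriv G (h1fn u x) • h1grad u x :=
  (hG.exists_comp hΩ u).choose_spec.2.1

theorem trace_compH1 (hG : IsC1Lipschitz G M) (hΩ : IsLipschitzDomain Ω) (u : H1 Ω) :
    ∀ᵐ x ∂(surf Ω), trace (hG.compH1 hΩ u) x = G (trace u x) :=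
  (hG.exists_comp hΩ u).choose_spec.2.2

/-- Continuity and linear growth make t ↦ G(u(t)) a measurable, square integrable test function in
the energy inequality. -/
theorem continuous_compH1 (hG : IsC1Lipschitz G M) (hΩ : IsLipschitzDomain Ω) :
    Continuous (hG.compH1 hΩ) := by
  refine continuous_iff_seqContinuous.2 fun u u₀ h => ?_
  obtain ⟨h1, h2⟩ := tendsto_h1_iff.1 h
  rw [Lp.tendsto_Lp_iff_tendsto_eLpNorm'] at h1 h2
  refine tendsto_h1_iff.2 ⟨?_, ?_⟩
  · rw [Lp.tendsto_Lp_iff_tendsto_eLpNorm']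
    refine (hG.tendsto_eLpNorm h1).congr fun n => eLpNorm_congr_ae ?_
    filter_upwards [hG.h1fn_compH1 hΩ (u n), hG.h1fn_compH1 hΩ u₀] with x hx hy
    rw [Pi.sub_apply, ← hx, ← hy]; rfl
  · rw [Lp.tendsto_Lp_iff_tendsto_eLpNorm']
    refine (tendsto_eLpNorm_comp_smul hG.continuous_deriv hG.bound
      (fun n => Lp.aestronglyMeasurable (h1fn (u n))) (Lp.aestronglyMeasurable (h1fn u₀))
      (fun n => Lp.aestronglyMeasurable (h1grad (u n))) (Lp.memLp (h1grad u₀)) h1 h2).congr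
      fun n => eLpNorm_congr_ae ?_
    filter_upwards [hG.h1grad_compH1 hΩ (u n), hG.h1grad_compH1 hΩ u₀] with x hx hy
    rw [Pi.sub_apply, ← hx, ← hy]; rfl

theorem norm_compH1_le (hG : IsC1Lipschitz G M) (hΩ : IsLipschitzDomain Ω) (u : H1 Ω) :
    ‖hG.compH1 hΩ u‖ ≤ M * ‖u‖ := by
  have h1 : ‖h1fn (hG.compH1 hΩ u)‖ ≤ M * ‖h1fn u‖ := by
    refine Lp.norm_le_mul_norm_of_ae_le_mul ?_
    filter_upwards [hG.h1fn_compH1 hΩ u] with x hx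
    rw [hx]; exact hG.abs_le _
  have h2 : ‖h1grad (hG.compH1 hΩ u)‖ ≤ M * ‖h1grad u‖ := by
    refine Lp.norm_le_mul_norm_of_ae_le_mul ?_
    filter_upwards [hG.h1grad_compH1 hΩ u] with x hx
    rw [hx, norm_smul]; gcongr; exact hG.bound _
  refine le_of_sq_le_sq ?_ (mul_nonneg hG.nonneg (norm_nonneg _))
  rw [mul_pow, h1_norm_sq, h1_norm_sq, mul_add, ← mul_pow, ← mul_pow]
  gcongr

end IsC1Lipschitz

end CrowdControl

/-! ### Parabolic paths and the energy inequality -/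

namespace CrowdControl

section Duality

variable {α V : Type*} [MeasurableSpace α] {μ : Measure α} [NormedAddCommGroup V]
  [NormedSpace ℝ V]

theorem eLpNorm_dual_apply_le {f : α → StrongDual ℝ V} {g : α → V}
    (hf : AEStronglyMeasurable f μ) (hg : AEStronglyMeasurable g μ) :
    eLpNorm (fun t => f t (g t)) 1 μ ≤ eLpNorm f 2 μ * eLpNorm g 2 μ := by
  have := eLpNorm_le_eLpNorm_mul_eLpNorm_of_nnnorm (p := 2) (q := 2) (r := 1) hf hg
    (fun a b => a b) 1 (.of_forall fun x => by
      rw [one_mul]; exact (f x).le_opNNNorm _)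
  simpa using this

theorem aestronglyMeasurable_dual_apply {f : α → StrongDual ℝ V} {g : α → V}
    (hf : AEStronglyMeasurable f μ) (hg : AEStronglyMeasurable g μ) :
    AEStronglyMeasurable (fun t => f t (g t)) μ :=
  (ContinuousLinearMap.id ℝ (StrongDual ℝ V)).aestronglyMeasurable_comp₂ hf hg

theorem integrable_dual_apply {f : α → StrongDual ℝ V} {g : α → V}
    (hf : MemLp f 2 μ) (hg : MemLp g 2 μ) : Integrable (fun t => f t (g t)) μ :=
  memLp_one_iff_integrable.1 ⟨aestronglyMeasurable_dual_apply hf.1 hg.1,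
    (eLpNorm_dual_apply_le hf.1 hg.1).trans_lt (ENNReal.mul_lt_top hf.2 hg.2)⟩

theorem abs_integral_dual_apply_le {f : α → StrongDual ℝ V} {g : α → V}
    (hf : AEStronglyMeasurable f μ) (hg : AEStronglyMeasurable g μ) {a b : ℝ} (ha : 0 ≤ a)
    (hb : 0 ≤ b) (hfa : eLpNorm f 2 μ ≤ ENNReal.ofReal a) (hgb : eLpNorm g 2 μ ≤ ENNReal.ofReal b) :
    |∫ t, f t (g t) ∂μ| ≤ a * b := by
  have h1 : ‖∫ t, f t (g t) ∂μ‖ₑ ≤ ENNReal.ofReal (a * b) := by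
    refine (enorm_integral_le_lintegral_enorm _).trans ?_
    rw [← eLpNorm_one_eq_lintegral_enorm, ENNReal.ofReal_mul ha]
    exact (eLpNorm_dual_apply_le hf hg).trans (mul_le_mul' hfa hgb)
  rw [← ofReal_norm] at h1
  exact (ENNReal.ofReal_le_ofReal_iff (mul_nonneg ha hb)).1 h1

end Duality

/-- The backward average of `f` over the interval `(t - h, t)`. -/
noncomputable def backwardAverage {F : Type*} [NormedAddCommGroup F] [NormedSpace ℝ F] (h : ℝ)
    (f : ℝ → F) (t : ℝ) : F :=
  h⁻¹ • ∫ s in (t - h)..t, f s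

/-- Written over a probability measure on the shifts, the average falls under
`eLpNorm_average_translate_sub_le`. -/
theorem backwardAverage_eq {F : Type*} [NormedAddCommGroup F] [NormedSpace ℝ F] {h : ℝ}
    (hh : 0 < h) (f : ℝ → F) (t : ℝ) : backwardAverage h f t =
      ∫ s, f (t - s) ∂((ENNReal.ofReal h)⁻¹ • volume.restrict (Ioc 0 h)) := by
  rw [integral_smul_measure, ENNReal.toReal_inv, ENNReal.toReal_ofReal hh.le,
    ← intervalIntegral.integral_of_le hh.le, intervalIntegral.integral_comp_sub_left, sub_zero]
  rfl

/-- Backward averages converge in `L²(ℝ)`. -/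
theorem exists_eLpNorm_backwardAverage_sub_le {F : Type*} [NormedAddCommGroup F] [NormedSpace ℝ F]
    [CompleteSpace F] {f : ℝ → F} (hfm : StronglyMeasurable f) (hf : MemLp f 2 volume)
    {ε : ℝ≥0∞} (hε : 0 < ε) : ∃ δ : ℝ, 0 < δ ∧ ∀ h, 0 < h → h < δ →
      eLpNorm (fun t => backwardAverage h f t - f t) 2 volume ≤ ε := by
  obtain ⟨δ, hδ, H⟩ := exists_eLpNorm_translate_sub_le volume hf hε
  refine ⟨δ, hδ, fun h hh hhδ => ?_⟩
  have hP : IsProbabilityMeasure ((ENNReal.ofReal h)⁻¹ • volume.restrict (Ioc 0 h) : Measure ℝ) :=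
    ⟨by
      rw [Measure.smul_apply, Measure.restrict_apply_univ, Real.volume_Ioc, sub_zero, smul_eq_mul]
      exact ENNReal.inv_mul_cancel (by simpa using hh) ENNReal.ofReal_ne_top⟩
  simp_rw [backwardAverage_eq hh]
  refine eLpNorm_average_translate_sub_le volume hfm _ ?_
  refine Measure.ae_smul_measure ?_ _
  filter_upwards [ae_restrict_mem measurableSet_Ioc] with s hs
  refine H s ?_
  rw [Real.norm_eq_abs, abs_of_pos hs.1]
  exact hs.2.trans_lt hhδ

theorem aestronglyMeasurable_backwardAverage {F : Type*} [NormedAddCommGroup F] [NormedSpace ℝ F]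
    {f : ℝ → F} (hfm : StronglyMeasurable f) {h : ℝ} (hh : 0 < h) :
    StronglyMeasurable (backwardAverage h f) := by
  have h1 : StronglyMeasurable fun p : ℝ × ℝ => f (p.1 - p.2) :=
    hfm.comp_measurable (measurable_fst.sub measurable_snd)
  have : backwardAverage h f = fun t => ∫ s, f (t - s)
      ∂((ENNReal.ofReal h)⁻¹ • volume.restrict (Ioc 0 h)) := by
    ext1 t; exact backwardAverage_eq hh f t
  rw [this]
  have : IsFiniteMeasure ((ENNReal.ofReal h)⁻¹ • volume.restrict (Ioc 0 h) : Measure ℝ) :=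
    ⟨by
      rw [Measure.smul_apply, Measure.restrict_apply_univ, Real.volume_Ioc, sub_zero, smul_eq_mul]
      rw [ENNReal.inv_mul_cancel (by simpa using hh) ENNReal.ofReal_ne_top]
      simp⟩
  exact h1.integral_prod_right

theorem memLp_of_memLp_sub {α F : Type*} [MeasurableSpace α] {μ : Measure α}
    [NormedAddCommGroup F] {f g : α → F} (h : MemLp (fun t => f t - g t) 2 μ)
    (hg : MemLp g 2 μ) : MemLp f 2 μ := by
  have e : f = (fun t => f t - g t) + g := by funext t; exact (sub_add_cancel _ _).symm
  rw [e]; exact h.add hg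

theorem memLp_sub_of_le {α F : Type*} [MeasurableSpace α] {μ : Measure α}
    [NormedAddCommGroup F] {f g : α → F} (hf : StronglyMeasurable f) (hg : StronglyMeasurable g)
    {c : ℝ≥0∞} (h : eLpNorm (fun t => f t - g t) 2 μ ≤ c) (hc : c < ⊤) :
    MemLp (fun t => f t - g t) 2 μ :=
  ⟨(hf.sub hg).aestronglyMeasurable, h.trans_lt hc⟩

section Parabolic

variable {V H : Type*} [NormedAddCommGroup V] [InnerProductSpace ℝ V]
  [NormedAddCommGroup H] [InnerProductSpace ℝ H]

/-- `w` is the continuous representative in `H` of `u ∈ L²(0,T; V)`, whose time derivative is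
`u' ∈ L²(0,T; V*)`; the space `V` is mapped to `H` by `ι`. -/
structure IsParabolicPath (ι : V →L[ℝ] H) (T : ℝ) (u : Lp V 2 (muTime T))
    (u' : Lp (StrongDual ℝ V) 2 (muTime T)) (w : ℝ → H) : Prop where
  cont : ContinuousOn w (Icc 0 T)
  ae_eq : ∀ᵐ t ∂(muTime T), w t = ι (u t)
  deriv : ∀ ψ : V, ∀ s ∈ Icc 0 T, ∀ t ∈ Icc 0 T, s ≤ t →
    inner ℝ (w t) (ι ψ) - inner ℝ (w s) (ι ψ) = ∫ r in s..t, u' r ψ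

variable {ι : V →L[ℝ] H} {T : ℝ} {u : Lp V 2 (muTime T)}
  {u' : Lp (StrongDual ℝ V) 2 (muTime T)} {w : ℝ → H}

/-- The energy inequality. -/
theorem IsParabolicPath.energy_le (hp : IsParabolicPath ι T u u' w) {N : V → V}
    (hN : Continuous N) {K : ℝ} (hNb : ∀ v, ‖N v‖ ≤ K * ‖v‖) {Ψ : H → ℝ} (hΨ : Continuous Ψ)
    (hconv : ∀ a b : V, Ψ (ι b) - Ψ (ι a) ≤ inner ℝ (ι b - ι a) (ι (N b))) {τ : ℝ}
    (hτ : τ ∈ Ioc 0 T) :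
    Ψ (w τ) ≤ Ψ (w 0) + ∫ t in (0 : ℝ)..τ, u' t (N (u t)) := by
  -- Extension by zero outside (0,T) lets averages and translations be taken on the whole line.
  set U' : ℝ → StrongDual ℝ V := (Ioo 0 T).indicator u'
  set NU : ℝ → V := (Ioo 0 T).indicator fun t => N (u t)
  have hU'm : StronglyMeasurable U' := (Lp.stronglyMeasurable u').indicator measurableSet_Ioo
  have hNUm : StronglyMeasurable NU :=
    (hN.comp_stronglyMeasurable (Lp.stronglyMeasurable u)).indicator measurableSet_Ioo
  have hU' : MemLp U' 2 volume := (memLp_indicator_iff_restrict measurableSet_Ioo).2 (Lp.memLp u')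
  have hNU : MemLp NU 2 volume := (memLp_indicator_iff_restrict measurableSet_Ioo).2
    ((Lp.memLp u).of_le_mul (hN.comp_aestronglyMeasurable (Lp.aestronglyMeasurable u))
      (.of_forall fun t => hNb (u t)))
  set B : ℝ := (eLpNorm NU 2 volume).toReal
  have hB0 : 0 ≤ B := ENNReal.toReal_nonneg
  have hNUB : eLpNorm NU 2 volume ≤ ENNReal.ofReal B :=
    (ENNReal.ofReal_toReal hNU.eLpNorm_ne_top).ge
  have hint : Integrable (fun t => U' t (NU t)) := integrable_dual_apply hU' hNU
  set g : ℝ → ℝ := fun t => Ψ (w t)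
  have hg : ContinuousOn g (Icc 0 T) := hΨ.comp_continuousOn hp.cont
  have hgi : ∀ a ∈ Icc 0 T, ∀ b ∈ Icc 0 T, IntervalIntegrable g volume a b := fun a ha b hb =>
    (hg.mono (uIcc_subset_Icc ha hb)).intervalIntegrable
  have hI : ∫ t in (0 : ℝ)..τ, u' t (N (u t)) = ∫ t in (0 : ℝ)..τ, U' t (NU t) := by
    rw [intervalIntegral.integral_of_le hτ.1.le, intervalIntegral.integral_of_le hτ.1.le,
      integral_Ioc_eq_integral_Ioo, integral_Ioc_eq_integral_Ioo]
    refine setIntegral_congr_fun measurableSet_Ioo fun t ht => ?_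
    have : t ∈ Ioo 0 T := ⟨ht.1, ht.2.trans_le hτ.2⟩
    simp only [U', NU, indicator_of_mem this]
  rw [hI]
  set I := ∫ t in (0 : ℝ)..τ, U' t (NU t)
  -- Apply convexity to the states at s - h and s, with N(u(s)) as a fixed test vector: the pairing
  -- with w(s) - w(s - h) is h times the backward average of u'. Integrating over s makes the left
  -- side telescope. Thus u itself is never regularized in time.
  have step : ∀ h, 0 < h → h < τ → MemLp (backwardAverage h U') 2 volume →
      (∫ s in (τ - h)..τ, g s) - ∫ s in (0 : ℝ)..h, g s ≤
        h * ∫ s in h..τ, backwardAverage h U' s (NU s) := by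
    intro h hh hhτ havg
    have e1 : (∫ s in (τ - h)..τ, g s) - ∫ s in (0 : ℝ)..h, g s =
        ∫ s in h..τ, (g s - g (s - h)) := by
      have m0 : (0 : ℝ) ∈ Icc 0 T := ⟨le_rfl, hτ.1.le.trans hτ.2⟩
      have mh : h ∈ Icc 0 T := ⟨hh.le, hhτ.le.trans hτ.2⟩
      have mτ : τ ∈ Icc 0 T := ⟨hτ.1.le, hτ.2⟩
      have mτh : τ - h ∈ Icc 0 T := ⟨by linarith, by linarith [hτ.2]⟩
      have e2 : ∫ s in h..τ, g (s - h) = ∫ s in (0 : ℝ)..(τ - h), g s := by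
        rw [intervalIntegral.integral_comp_sub_right, sub_self]
      have i2 : IntervalIntegrable (fun s => g (s - h)) volume h τ := by
        have := (hgi 0 m0 _ mτh).comp_sub_right h
        simpa using this
      rw [intervalIntegral.integral_sub (hgi h mh τ mτ) i2, e2]
      have a1 := intervalIntegral.integral_add_adjacent_intervals (hgi 0 m0 h mh) (hgi h mh τ mτ)
      have a2 := intervalIntegral.integral_add_adjacent_intervals (hgi 0 m0 _ mτh)
        (hgi _ mτh τ mτ)
      linarith
    have hae : ∀ᵐ s, s ∈ Ioo 0 T → w s = ι (u s) := by
      have := hp.ae_eq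
      rwa [ae_restrict_iff' measurableSet_Ioo] at this
    have hae2 : ∀ᵐ s, s - h ∈ Ioo 0 T → w (s - h) = ι (u (s - h)) :=
      (measurePreserving_sub_right volume h).quasiMeasurePreserving.ae hae
    have e3 : ∀ᵐ s ∂(volume.restrict (Ioo h τ)),
        g s - g (s - h) ≤ h * backwardAverage h U' s (NU s) := by
      rw [ae_restrict_iff' measurableSet_Ioo]
      filter_upwards [hae, hae2] with s h1 h2 hs
      have ms : s ∈ Ioo 0 T := ⟨hh.trans hs.1, hs.2.trans_le hτ.2⟩
      have msh : s - h ∈ Ioo 0 T := ⟨by linarith [hs.1], by linarith [ms.2]⟩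
      have h3 := hconv (u (s - h)) (u s)
      rw [← h1 ms, ← h2 msh, inner_sub_left, hp.deriv (N (u s)) (s - h)
        (Ioo_subset_Icc_self msh) s (Ioo_subset_Icc_self ms) (by linarith)] at h3
      refine h3.trans (le_of_eq ?_)
      have e4 : NU s = N (u s) := indicator_of_mem ms _
      have i4 : IntervalIntegrable U' volume (s - h) s :=
        ((hU'.locallyIntegrable (by norm_num)).integrableOn_isCompact
          isCompact_uIcc).intervalIntegrable
      rw [e4, backwardAverage, _root_.smul_apply, smul_eq_mul, ← mul_assoc,
        mul_inv_cancel₀ hh.ne', one_mul, ContinuousLinearMap.intervalIntegral_apply i4]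
      rw [intervalIntegral.integral_of_le (by linarith), intervalIntegral.integral_of_le
        (by linarith)]
      refine setIntegral_congr_fun measurableSet_Ioc fun r hr => ?_
      have : r ∈ Ioo 0 T := ⟨by linarith [hr.1, msh.1], by linarith [hr.2, ms.2]⟩
      simp only [U', indicator_of_mem this]
    have m0 : (0 : ℝ) ∈ Icc 0 T := ⟨le_rfl, hτ.1.le.trans hτ.2⟩
    have mh : h ∈ Icc 0 T := ⟨hh.le, hhτ.le.trans hτ.2⟩
    have mτ : τ ∈ Icc 0 T := ⟨hτ.1.le, hτ.2⟩
    have mτh : τ - h ∈ Icc 0 T := ⟨by linarith, by linarith [hτ.2]⟩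
    have i3 : IntervalIntegrable (fun s => g s - g (s - h)) volume h τ :=
      (hgi h mh τ mτ).sub (by simpa using (hgi 0 m0 _ mτh).comp_sub_right h)
    rw [e1, ← intervalIntegral.integral_const_mul]
    refine intervalIntegral.integral_mono_ae_restrict hhτ.le i3
      ((integrable_dual_apply havg hNU).const_mul h).intervalIntegrable ?_
    rw [restrict_Ioo_eq_restrict_Icc] at e3
    exact e3
  -- Divide by h. Continuity of g at 0 and at τ costs ε each, the missing piece of the integral over
  -- (0,h) another ε, and replacing the average of u' by u' costs εB.
  have main : ∀ ε, 0 < ε → g τ ≤ g 0 + I + ε * (3 + B) := by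
    intro ε hε
    obtain ⟨δ, hδ, hδ'⟩ := exists_eLpNorm_backwardAverage_sub_le hU'm hU'
      (ENNReal.ofReal_pos.2 hε)
    have ev1 : ∀ᶠ h in 𝓝[>] (0 : ℝ), h < min δ τ :=
      (eventually_lt_nhds (lt_min hδ hτ.1)).filter_mono nhdsWithin_le_nhds
    have ev2 : ∀ᶠ h in 𝓝[>] (0 : ℝ), ∀ s ∈ Icc 0 h, g s ≤ g 0 + ε := by
      have h1 := (hg 0 ⟨le_rfl, hτ.1.le.trans hτ.2⟩).eventually_lt_const
        (u := g 0 + ε) (by linarith)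
      obtain ⟨r, hr, h2⟩ := Metric.mem_nhdsWithin_iff.1 h1
      filter_upwards [Ioo_mem_nhdsGT (lt_min hr hτ.1)] with h hh s hs
      have hs1 := hs.2.trans_lt (hh.2.trans_le (min_le_left _ _))
      have hs2 := hs.2.trans_lt (hh.2.trans_le (min_le_right _ _))
      refine le_of_lt (h2 ⟨?_, hs.1, hs2.le.trans hτ.2⟩)
      rw [Metric.mem_ball, Real.dist_eq, sub_zero, abs_of_nonneg hs.1]; exact hs1
    have ev3 : ∀ᶠ h in 𝓝[>] (0 : ℝ), ∀ s ∈ Icc (τ - h) τ, g τ - ε ≤ g s := by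
      have h1 := (hg τ ⟨hτ.1.le, hτ.2⟩).eventually_const_lt (u := g τ - ε) (by linarith)
      obtain ⟨r, hr, h2⟩ := Metric.mem_nhdsWithin_iff.1 h1
      filter_upwards [Ioo_mem_nhdsGT (lt_min hr hτ.1)] with h hh s hs
      have hs1 := (hh.2.trans_le (min_le_left _ _))
      have hs2 := (hh.2.trans_le (min_le_right _ _))
      refine le_of_lt (h2 ⟨?_, by linarith [hs.1], hs.2.trans hτ.2⟩)
      rw [Metric.mem_ball, Real.dist_eq, abs_of_nonpos (by linarith [hs.2])]
      linarith [hs.1]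
    have ev4 : ∀ᶠ h in 𝓝[>] (0 : ℝ), |∫ t in (0 : ℝ)..h, U' t (NU t)| < ε := by
      have hc := intervalIntegral.continuous_primitive
        (fun a b => hint.intervalIntegrable (a := a) (b := b)) 0
      have := hc.abs.tendsto 0
      rw [intervalIntegral.integral_same, abs_zero] at this
      exact (this.eventually_lt_const hε).filter_mono nhdsWithin_le_nhds
    obtain ⟨h, ⟨⟨⟨h1, h2⟩, h3⟩, h4⟩, hh⟩ :=
      ((((ev1.and ev2).and ev3).and ev4).and self_mem_nhdsWithin).exists
    have hhδ := h1.trans_le (min_le_left _ _)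
    have hhτ := h1.trans_le (min_le_right _ _)
    have hdiff := hδ' h hh hhδ
    have havgm := aestronglyMeasurable_backwardAverage hU'm hh
    have hdm : MemLp (fun t => backwardAverage h U' t - U' t) 2 volume :=
      memLp_sub_of_le havgm hU'm hdiff ENNReal.ofReal_lt_top
    have havg : MemLp (backwardAverage h U') 2 volume := memLp_of_memLp_sub hdm hU'
    have s1 := step h hh hhτ havg
    have m0 : (0 : ℝ) ∈ Icc 0 T := ⟨le_rfl, hτ.1.le.trans hτ.2⟩
    have mh : h ∈ Icc 0 T := ⟨hh.le, hhτ.le.trans hτ.2⟩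
    have mτ : τ ∈ Icc 0 T := ⟨hτ.1.le, hτ.2⟩
    have mτh : τ - h ∈ Icc 0 T := ⟨by linarith, by linarith [hτ.2]⟩
    have s2 : h * (g τ - ε) ≤ ∫ s in (τ - h)..τ, g s := by
      have := intervalIntegral.integral_mono_on (by linarith) intervalIntegrable_const
        (hgi _ mτh τ mτ) h3
      rwa [intervalIntegral.integral_const, sub_sub_cancel, smul_eq_mul] at this
    have s3 : ∫ s in (0 : ℝ)..h, g s ≤ h * (g 0 + ε) := by
      have := intervalIntegral.integral_mono_on hh.le (hgi 0 m0 h mh) intervalIntegrable_const h2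
      rwa [intervalIntegral.integral_const, sub_zero, smul_eq_mul] at this
    have s4 : ∫ s in h..τ, backwardAverage h U' s (NU s) ≤ I + ε + ε * B := by
      have e1 : ∫ s in h..τ, backwardAverage h U' s (NU s) =
          (∫ s in h..τ, (backwardAverage h U' s - U' s) (NU s)) + ∫ s in h..τ, U' s (NU s) := by
        rw [← intervalIntegral.integral_add
          (integrable_dual_apply hdm hNU).intervalIntegrable hint.intervalIntegrable]
        refine intervalIntegral.integral_congr fun s _ => ?_
        simp
      have e2 : (∫ s in (0 : ℝ)..h, U' s (NU s)) + ∫ s in h..τ, U' s (NU s) = I :=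
        intervalIntegral.integral_add_adjacent_intervals hint.intervalIntegrable
          hint.intervalIntegrable
      have e3 : |∫ s in h..τ, (backwardAverage h U' s - U' s) (NU s)| ≤ ε * B := by
        rw [intervalIntegral.integral_of_le hhτ.le]
        exact abs_integral_dual_apply_le hdm.1.restrict hNU.1.restrict hε.le hB0
          ((eLpNorm_mono_measure _ Measure.restrict_le_self).trans hdiff)
          ((eLpNorm_mono_measure _ Measure.restrict_le_self).trans hNUB)
      have e4 := (abs_le.1 h4.le).1
      have e5 := (abs_le.1 e3).2
      linarith
    have s5 : h * (g τ - ε) ≤ h * (g 0 + ε + (I + ε + ε * B)) := by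
      calc h * (g τ - ε) ≤ h * (g 0 + ε) +
            h * ∫ s in h..τ, backwardAverage h U' s (NU s) := by linarith
        _ ≤ h * (g 0 + ε) + h * (I + ε + ε * B) := by gcongr
        _ = _ := by ring
    have s6 := le_of_mul_le_mul_left s5 hh
    linarith
  refine le_of_forall_pos_le_add fun ε hε => ?_
  have hB3 : 0 < 3 + B := by positivity
  have := main (ε / (3 + B)) (by positivity)
  rwa [div_mul_cancel₀ _ hB3.ne'] at this

end Parabolic

end CrowdControl

/-! ### Weak derivatives on a time interval -/

namespace CrowdControl

section WeakDerivative

variable {T : ℝ} {φ g : ℝ → ℝ}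

theorem intervalIntegrable_of_integrableOn_Ioo (hT : 0 ≤ T) (hg : IntegrableOn g (Ioo 0 T)) :
    IntervalIntegrable g volume 0 T :=
  (intervalIntegrable_iff_integrableOn_Ioo_of_le hT).2 hg

theorem integral_deriv_mul_of_sub_eq_integral (hT : 0 ≤ T) (hg : IntegrableOn g (Ioo 0 T))
    (hφ : ∀ t ∈ Icc 0 T, φ t - φ 0 = ∫ r in (0 : ℝ)..t, g r) {η : ℝ → ℝ} (hη : ContDiff ℝ ∞ η)
    (hs : tsupport η ⊆ Ioo 0 T) :
    ∫ t in Ioo 0 T, deriv η t * φ t = - ∫ t in Ioo 0 T, η t * g t := by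
  have hgi := intervalIntegrable_of_integrableOn_Ioo hT hg
  set G : ℝ → ℝ := fun t => φ 0 + ∫ r in (0 : ℝ)..t, g r
  have hG : AbsolutelyContinuousOnInterval G 0 T :=
    (contDiffOn_const (n := 1)).absolutelyContinuousOnInterval.add
      (hgi.absolutelyContinuousOnInterval_intervalIntegral (c := 0) (by simp))
  have hηA : AbsolutelyContinuousOnInterval η 0 T :=
    (hη.of_le (by simp)).contDiffOn.absolutelyContinuousOnInterval
  have h0 : η 0 = 0 := image_eq_zero_of_notMem_tsupport fun h => lt_irrefl _ (hs h).1
  have h1 : η T = 0 := image_eq_zero_of_notMem_tsupport fun h => lt_irrefl _ (hs h).2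
  have key := hηA.integral_mul_deriv_eq_deriv_mul hG
  rw [h0, h1, zero_mul, zero_mul, sub_zero, zero_sub] at key
  have e1 : ∫ t in (0 : ℝ)..T, η t * deriv G t = ∫ t in (0 : ℝ)..T, η t * g t := by
    apply intervalIntegral.integral_congr_ae
    filter_upwards [hgi.ae_hasDerivAt_integral] with t ht hm
    have := (ht (uIoc_subset_uIcc hm) 0 (by simp)).const_add (φ 0)
    rw [this.deriv]
  have e2 : ∫ t in (0 : ℝ)..T, deriv η t * G t = ∫ t in (0 : ℝ)..T, deriv η t * φ t := by
    refine intervalIntegral.integral_congr fun t ht => ?_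
    rw [uIcc_of_le hT] at ht
    simp only [G, ← hφ t ht, add_sub_cancel]
  rw [e1, e2] at key
  rw [← integral_Ioc_eq_integral_Ioo, ← integral_Ioc_eq_integral_Ioo,
    ← intervalIntegral.integral_of_le hT, ← intervalIntegral.integral_of_le hT, key, neg_neg]

/-- Zero mean makes the primitive vanish to the right of the support as well as to its left. -/
theorem exists_primitive_test {ζ : ℝ → ℝ} (hζ : ContDiff ℝ ∞ ζ) (hζc : HasCompactSupport ζ)
    (hs : tsupport ζ ⊆ Ioo 0 T) (h0 : ∫ t, ζ t = 0) :
    ∃ η : ℝ → ℝ, ContDiff ℝ ∞ η ∧ HasCompactSupport η ∧ tsupport η ⊆ Ioo 0 T ∧ deriv η = ζ := by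
  rcases (tsupport ζ).eq_empty_or_nonempty with he | hne
  · refine ⟨0, contDiff_const, .zero, by simp [tsupport], ?_⟩
    rw [tsupport_eq_empty_iff.1 he]; simp
  obtain ⟨a, ha⟩ := hζc.isCompact.exists_isLeast hne
  obtain ⟨b, hb⟩ := hζc.isCompact.exists_isGreatest hne
  have hζi : Integrable ζ := hζ.continuous.integrable_of_hasCompactSupport hζc
  set η : ℝ → ℝ := fun t => ∫ s in (0 : ℝ)..t, ζ s
  have hder : ∀ t, HasDerivAt η (ζ t) t := fun t =>
    hζ.continuous.integral_hasStrictDerivAt 0 t |>.hasDerivAt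
  have hd : deriv η = ζ := funext fun t => (hder t).deriv
  have z : ∀ t, t ∉ Icc a b → ζ t = 0 := fun t ht =>
    image_eq_zero_of_notMem_tsupport fun h => ht ⟨ha.2 h, hb.2 h⟩
  have zη : ∀ t, t ∉ Icc a b → η t = 0 := by
    intro t ht
    have hIi : ∀ t, ∫ s in Iic t, ζ s = η t := by
      intro t
      have e : ∫ s in Iic (0 : ℝ), ζ s = 0 := setIntegral_eq_zero_of_forall_eq_zero fun s hs' =>
        z s fun h => by
          have := (hs ha.1).1
          have h2 : s ≤ 0 := hs'
          linarith [h.1]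
      have := intervalIntegral.integral_Iic_sub_Iic (a := 0) (b := t) hζi.integrableOn
        hζi.integrableOn
      rw [e, sub_zero] at this
      exact this
    rw [← hIi]
    by_cases hta : t < a
    · exact setIntegral_eq_zero_of_forall_eq_zero fun s hs' => z s fun h => by
        have h2 : s ≤ t := hs'
        linarith [h.1]
    · rw [setIntegral_eq_integral_of_forall_compl_eq_zero, h0]
      intro s hs'
      refine z s fun h => ht ⟨not_lt.1 hta, ?_⟩
      have : t < s := not_le.1 hs'
      linarith [h.2]
  have hsub : tsupport η ⊆ Icc a b := closure_minimal (fun t ht => by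
    by_contra h; exact ht (zη t h)) isClosed_Icc
  refine ⟨η, ?_, HasCompactSupport.intro isCompact_Icc zη, hsub.trans fun t ht =>
    ⟨(hs ha.1).1.trans_le ht.1, ht.2.trans_lt (hs hb.1).2⟩, hd⟩
  rw [contDiff_infty_iff_deriv, hd]
  exact ⟨fun t => (hder t).differentiableAt, hζ⟩

/-- The du Bois-Reymond argument: φ minus the primitive of g has zero weak derivative, hence is a.e.
constant, and by continuity constant on the closed interval. -/
theorem sub_eq_integral_of_weak_deriv (hT : 0 < T) (hφ : ContinuousOn φ (Icc 0 T))
    (hg : IntegrableOn g (Ioo 0 T))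
    (h : ∀ η : ℝ → ℝ, ContDiff ℝ ∞ η → HasCompactSupport η → tsupport η ⊆ Ioo 0 T →
      ∫ t in Ioo 0 T, deriv η t * φ t = - ∫ t in Ioo 0 T, η t * g t) :
    ∀ t ∈ Icc 0 T, φ t - φ 0 = ∫ r in (0 : ℝ)..t, g r := by
  have hgi := intervalIntegrable_of_integrableOn_Ioo hT.le hg
  set G : ℝ → ℝ := fun t => ∫ r in (0 : ℝ)..t, g r
  have hG : ContinuousOn G (Icc 0 T) := by
    have := (hgi.absolutelyContinuousOnInterval_intervalIntegral (c := 0) (by simp)).continuousOn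
    rwa [uIcc_of_le hT.le] at this
  set k : ℝ → ℝ := fun t => φ t - G t
  have hk : ContinuousOn k (Icc 0 T) := hφ.sub hG
  have hmul : ∀ {η f : ℝ → ℝ}, Continuous η → ContinuousOn f (Icc 0 T) →
      IntegrableOn (fun t => η t * f t) (Ioo 0 T) := fun hη hf =>
    ((hη.continuousOn.mul hf).integrableOn_compact isCompact_Icc).mono_set Ioo_subset_Icc_self
  have hk0 : ∀ η : ℝ → ℝ, ContDiff ℝ ∞ η → HasCompactSupport η → tsupport η ⊆ Ioo 0 T →
      ∫ t in Ioo 0 T, deriv η t * k t = 0 := by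
    intro η h1 h2 h3
    have h1' : Continuous (deriv η) := h1.continuous_deriv (by simp)
    have e := integral_deriv_mul_of_sub_eq_integral (φ := G) hT.le hg (fun t _ => by simp [G]) h1 h3
    simp only [k, mul_sub]
    rw [integral_sub (hmul h1' hφ) (hmul h1' hG), h η h1 h2 h3, e, sub_self]
  -- A fixed bump θ of integral one inside (0,T). For any test function ζ of integral m, the
  -- function ζ - mθ has mean zero and is therefore the derivative of a test function.
  let b : ContDiffBump (T / 2) := ⟨T / 8, T / 4, by positivity, by linarith⟩
  set θ := b.normed volume
  have hθ : ContDiff ℝ ∞ θ := b.contDiff_normed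
  have hθc : HasCompactSupport θ := b.hasCompactSupport_normed
  have hθs : tsupport θ ⊆ Ioo 0 T := by
    rw [b.tsupport_normed_eq, Real.closedBall_eq_Icc]
    intro t ht
    simp only [b] at ht
    exact ⟨by linarith [ht.1], by linarith [ht.2]⟩
  set c : ℝ := ∫ t in Ioo 0 T, θ t * k t
  have hfull : ∀ {ζ f : ℝ → ℝ}, tsupport ζ ⊆ Ioo 0 T →
      ∫ t in Ioo 0 T, ζ t * f t = ∫ t, ζ t * f t := fun hs =>
    setIntegral_eq_integral_of_forall_compl_eq_zero fun t ht => by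
      rw [image_eq_zero_of_notMem_tsupport fun hh => ht (hs hh), zero_mul]
  have hae : ∀ᵐ t, t ∈ Ioo 0 T → k t - c = 0 := by
    refine isOpen_Ioo.ae_eq_zero_of_integral_contDiff_smul_eq_zero
      (((hk.sub continuousOn_const).mono Ioo_subset_Icc_self).locallyIntegrableOn
        measurableSet_Ioo) fun ζ hζ hζc hζs => ?_
    set m : ℝ := ∫ t, ζ t
    have hi1 : Integrable ζ := hζ.continuous.integrable_of_hasCompactSupport hζc
    have hi2 : Integrable θ := hθ.continuous.integrable_of_hasCompactSupport hθc
    have hζ2 : ContDiff ℝ ∞ fun t => ζ t - m * θ t := hζ.sub (contDiff_const.mul hθ)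
    have hz : ∀ t, t ∉ tsupport ζ ∪ tsupport θ → ζ t - m * θ t = 0 := fun t ht => by
      rw [image_eq_zero_of_notMem_tsupport fun hh => ht (.inl hh),
        image_eq_zero_of_notMem_tsupport fun hh => ht (.inr hh)]
      simp
    have hss : tsupport (fun t => ζ t - m * θ t) ⊆ tsupport ζ ∪ tsupport θ :=
      closure_minimal (fun t ht => by by_contra hh; exact ht (hz t hh))
        ((isClosed_tsupport _).union (isClosed_tsupport _))
    obtain ⟨η, h1, h2, h3, h4⟩ := exists_primitive_test (T := T) hζ2
      (HasCompactSupport.intro (hζc.isCompact.union hθc.isCompact) hz)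
      (hss.trans (union_subset hζs hθs)) (by
        rw [integral_sub hi1 (hi2.const_mul m), integral_const_mul, b.integral_normed, mul_one,
          sub_self])
    have e := hk0 η h1 h2 h3
    rw [h4] at e
    simp only [sub_mul, mul_assoc] at e
    rw [integral_sub (hmul hζ.continuous hk) ((hmul hθ.continuous hk).const_mul m),
      integral_const_mul] at e
    simp only [smul_eq_mul]
    rw [← hfull hζs]
    simp only [mul_sub]
    rw [integral_sub (hmul hζ.continuous hk) (hi1.mul_const c).integrableOn, integral_mul_const]
    have e5 : ∫ t in Ioo 0 T, ζ t = m := by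
      have := hfull (f := fun _ => 1) hζs
      simpa using this
    rw [e5]
    exact e
  have hae2 : k =ᵐ[volume.restrict (Icc 0 T)] fun _ => c := by
    rw [← restrict_Ioo_eq_restrict_Icc]
    rw [EventuallyEq, ae_restrict_iff' measurableSet_Ioo]
    filter_upwards [hae] with t ht hm using sub_eq_zero.1 (ht hm)
  have heq := Measure.eqOn_Icc_of_ae_eq volume hT.ne hae2 hk continuousOn_const
  intro t ht
  have h1 : φ t - G t = c := heq ht
  have h2 : φ 0 - G 0 = c := heq ⟨le_rfl, hT.le⟩
  have h3 : G 0 = 0 := intervalIntegral.integral_same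
  change φ t - φ 0 = G t
  linarith

end WeakDerivative

end CrowdControl

/-! ### A priori estimate and stability for the linear parabolic equation -/

namespace CrowdControl

section WeakTimeDeriv

variable {d : ℕ} {Ω : Set (Sp d)} {T : ℝ} {u : Lp (H1 Ω) 2 (muTime T)}
  {u' : Lp (StrongDual ℝ (H1 Ω)) 2 (muTime T)} {w : ℝ → Lp ℝ 2 (muOmega Ω)}

theorem inner_h1fn (v : Lp ℝ 2 (muOmega Ω)) (ψ : H1 Ω) :
    inner ℝ v (h1fnL Ω ψ) = ∫ x in Ω, v x * h1fn ψ x := by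
  rw [L2.inner_def]
  exact integral_congr_ae (.of_forall fun x => by
    simp only [h1fnL_apply, RCLike.inner_apply, conj_trivial]
    ring)

theorem integrableOn_dual_apply_const {V : Type*} [NormedAddCommGroup V] [NormedSpace ℝ V]
    (u' : Lp (StrongDual ℝ V) 2 (muTime T)) (ψ : V) :
    IntegrableOn (fun t => u' t ψ) (Ioo 0 T) :=
  integrable_dual_apply (Lp.memLp u') (memLp_const ψ)

/-- For each fixed ψ the scalar result applies to t ↦ ⟨w(t), ψ⟩, which is continuous. -/
theorem IsWeakTimeDeriv.isParabolicPath (hT : 0 < T) (hd : IsWeakTimeDeriv T u u')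
    (hw : ContinuousOn w (Icc 0 T)) (hae : ∀ᵐ t ∂(muTime T), w t = h1fn (u t)) :
    IsParabolicPath (h1fnL Ω) T u u' w := by
  refine ⟨hw, hae, fun ψ s hs t ht _ => ?_⟩
  have hi := integrableOn_dual_apply_const u' ψ
  have key := sub_eq_integral_of_weak_deriv (φ := fun t => inner ℝ (w t) (h1fnL Ω ψ)) hT
    (hw.inner continuousOn_const) hi fun η h1 h2 h3 => by
      rw [← hd η h1 h2 h3 ψ]
      refine integral_congr_ae ?_
      filter_upwards [hae] with t ht
      rw [inner_h1fn, ht]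
  have hii := intervalIntegrable_of_integrableOn_Ioo hT.le hi
  have a := intervalIntegral.integral_add_adjacent_intervals
    (hii.mono_set (c := 0) (d := s) (uIcc_subset_uIcc (by simp) (by rwa [uIcc_of_le hT.le])))
    (hii.mono_set (c := s) (d := t) (uIcc_subset_uIcc (by rwa [uIcc_of_le hT.le])
      (by rwa [uIcc_of_le hT.le])))
  have k1 := key s hs
  have k2 := key t ht
  linarith

theorem IsParabolicPath.isWeakTimeDeriv (hT : 0 < T) (hp : IsParabolicPath (h1fnL Ω) T u u' w) :
    IsWeakTimeDeriv T u u' := by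
  intro η h1 h2 h3 ψ
  have := integral_deriv_mul_of_sub_eq_integral (φ := fun t => inner ℝ (w t) (h1fnL Ω ψ)) hT.le
    (integrableOn_dual_apply_const u' ψ)
    (fun t ht => hp.deriv ψ 0 ⟨le_rfl, hT.le⟩ t ht ht.1) h1 h3
  rw [← this]
  refine integral_congr_ae ?_
  filter_upwards [hp.ae_eq] with t ht
  simp only [inner_h1fn, ht]
  rfl

end WeakTimeDeriv

theorem norm_sq_eq_integral_norm_sq {α E : Type*} [MeasurableSpace α] {μ : Measure α}
    [NormedAddCommGroup E] (f : Lp E 2 μ) : ‖f‖ ^ 2 = ∫ t, ‖f t‖ ^ 2 ∂μ := by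
  rw [Lp.norm_def, ← ENNReal.toReal_pow, sq_eLpNorm_two, integral_eq_lintegral_of_nonneg_ae
    (.of_forall fun t => sq_nonneg _) ((Lp.aestronglyMeasurable f).norm.pow 2)]
  congr 1
  refine lintegral_congr fun t => ?_
  rw [ENNReal.ofReal_pow (norm_nonneg _), ofReal_norm]

theorem integrable_norm_sq {α E : Type*} [MeasurableSpace α] {μ : Measure α}
    [NormedAddCommGroup E] (f : Lp E 2 μ) : Integrable (fun t => ‖f t‖ ^ 2) μ :=
  (Lp.memLp f).integrable_norm_pow (by norm_num)

/-- Grönwall's lemma for the primitive of y, whose right derivative is y. The bound is stated for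
the whole right-hand side, since in the a priori estimate that quantity also dominates the
dissipation. -/
theorem le_mul_exp_of_le_add_integral {T K D : ℝ} (hK : 0 < K) {y : ℝ → ℝ}
    (hy : ContinuousOn y (Icc 0 T)) (hy0 : ∀ t ∈ Icc 0 T, 0 ≤ y t)
    (h : ∀ t ∈ Icc 0 T, y t ≤ D + K * ∫ s in (0 : ℝ)..t, y s) :
    ∀ t ∈ Icc 0 T, D + K * ∫ s in (0 : ℝ)..t, y s ≤ D * Real.exp (K * t) := by
  intro t ht
  have hT : 0 ≤ T := ht.1.trans ht.2
  set Y : ℝ → ℝ := fun t => ∫ s in (0 : ℝ)..t, y s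
  have hyi : IntervalIntegrable y volume 0 T := by
    rw [← uIcc_of_le hT] at hy; exact hy.intervalIntegrable
  have hYc : ContinuousOn Y (Icc 0 T) := by
    have := (hyi.absolutelyContinuousOnInterval_intervalIntegral (c := 0) (by simp)).continuousOn
    rwa [uIcc_of_le hT] at this
  have hY0 : ∀ t ∈ Icc 0 T, 0 ≤ Y t := fun t ht =>
    intervalIntegral.integral_nonneg ht.1 fun s hs => hy0 s ⟨hs.1, hs.2.trans ht.2⟩
  have := norm_le_gronwallBound_of_norm_deriv_right_le (f := Y) (f' := y) (δ := 0) (K := K)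
    (ε := D) hYc (fun x hx => by
      have hmem : Icc 0 T ∈ 𝓝[≥] x := by
        exact mem_of_superset (Icc_mem_nhdsGE hx.2) (Icc_subset_Icc_left hx.1)
      refine intervalIntegral.integral_hasDerivWithinAt_right
        (hyi.mono_set (by rw [uIcc_of_le hx.1, uIcc_of_le hT]; exact Icc_subset_Icc_right hx.2.le))
        (t := Ioi x) ?_ ?_
      · exact (hy.stronglyMeasurableAtFilter_nhdsWithin measurableSet_Icc x).filter_mono
          (by
            refine nhdsWithin_le_iff.2 ?_
            exact nhdsWithin_mono _ Ioi_subset_Ici_self hmem)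
      · exact ((hy x ⟨hx.1, hx.2.le⟩).mono_of_mem_nhdsWithin
          (nhdsWithin_mono _ Ioi_subset_Ici_self hmem)))
    (by simp [Y]) (fun x hx => by
      have hx' : x ∈ Icc 0 T := ⟨hx.1, hx.2.le⟩
      rw [Real.norm_of_nonneg (hy0 x hx'), Real.norm_of_nonneg (hY0 x hx')]
      linarith [h x hx']) t ht
  rw [gronwallBound_of_K_ne_0 hK.ne', Real.norm_of_nonneg (hY0 t ht)] at this
  simp only [zero_mul, zero_add, sub_zero] at this
  have h2 := mul_le_mul_of_nonneg_left this hK.le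
  have e : K * (D / K * (Real.exp (K * t) - 1)) = D * Real.exp (K * t) - D := by
    field_simp
  change D + K * Y t ≤ _
  linarith

section Parabolic

variable {V H : Type*} [NormedAddCommGroup V] [InnerProductSpace ℝ V]
  [NormedAddCommGroup H] [InnerProductSpace ℝ H]
  {ι : V →L[ℝ] H} {T : ℝ} {A : V →L[ℝ] StrongDual ℝ V} {α κ : ℝ}

theorem IsParabolicPath.sub {u v : Lp V 2 (muTime T)} {u' v' : Lp (StrongDual ℝ V) 2 (muTime T)}
    {w z : ℝ → H} (hp : IsParabolicPath ι T u u' w) (hq : IsParabolicPath ι T v v' z) :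
    IsParabolicPath ι T (u - v) (u' - v') (fun t => w t - z t) := by
  refine ⟨hp.cont.sub hq.cont, ?_, fun ψ s hs t ht hst => ?_⟩
  · filter_upwards [hp.ae_eq, hq.ae_eq, Lp.coeFn_sub u v] with t h1 h2 h3
    rw [h1, h2, h3, Pi.sub_apply, map_sub]
  · have hi : ∀ v' : Lp (StrongDual ℝ V) 2 (muTime T),
        IntervalIntegrable (fun t => v' t ψ) volume s t := fun v' => by
      rw [intervalIntegrable_iff_integrableOn_Ioo_of_le hst]
      exact (integrableOn_dual_apply_const v' ψ).mono_set (Ioo_subset_Ioo hs.1 ht.2)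
    have e : ∫ r in s..t, (u' - v') r ψ = ∫ r in s..t, (u' r ψ - v' r ψ) := by
      rw [intervalIntegral.integral_of_le hst, intervalIntegral.integral_of_le hst,
        integral_Ioc_eq_integral_Ioo, integral_Ioc_eq_integral_Ioo]
      refine integral_congr_ae ?_
      filter_upwards [ae_restrict_of_ae_restrict_of_subset (Ioo_subset_Ioo hs.1 ht.2)
        (Lp.coeFn_sub u' v')] with r hr
      rw [hr]; rfl
    rw [e, intervalIntegral.integral_sub (hi u') (hi v'), ← hp.deriv ψ s hs t ht hst,
      ← hq.deriv ψ s hs t ht hst, inner_sub_left, inner_sub_left]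
    ring

/-- The energy inequality for ‖·‖²/2, tested with u itself; coercivity of A up to the H-norm,
Young's inequality and Grönwall give both bounds. -/
theorem IsParabolicPath.apriori_sq (hT : 0 < T) (hα : 0 < α) (hκ : 0 < κ)
    (hA : ∀ v, α * ‖v‖ ^ 2 - κ * ‖ι v‖ ^ 2 ≤ A v v)
    {u : Lp V 2 (muTime T)} {u' f : Lp (StrongDual ℝ V) 2 (muTime T)} {w : ℝ → H}
    (hp : IsParabolicPath ι T u u' w) (he : ∀ᵐ t ∂(muTime T), u' t = f t - A (u t)) :
    (∀ t ∈ Icc 0 T, ‖w t‖ ^ 2 ≤ (‖w 0‖ ^ 2 + α⁻¹ * ‖f‖ ^ 2) * Real.exp (2 * κ * T)) ∧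
      α * ‖u‖ ^ 2 ≤ (‖w 0‖ ^ 2 + α⁻¹ * ‖f‖ ^ 2) * Real.exp (2 * κ * T) := by
  set D := ‖w 0‖ ^ 2 + α⁻¹ * ‖f‖ ^ 2
  have hD : 0 ≤ D := by positivity
  have hyc : ContinuousOn (fun t => ‖w t‖ ^ 2) (Icc 0 T) := hp.cont.norm.pow 2
  have main : ∀ τ ∈ Ioc 0 T, ‖w τ‖ ^ 2 + α * ∫ t in Ioo 0 τ, ‖u t‖ ^ 2 ≤
      D + 2 * κ * ∫ t in (0 : ℝ)..τ, ‖w t‖ ^ 2 := by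
    intro τ hτ
    have hsub : Ioo 0 τ ⊆ Ioo 0 T := Ioo_subset_Ioo_right hτ.2
    have h1 := hp.energy_le (N := id) (K := 1) (Ψ := fun h => ‖h‖ ^ 2 / 2) continuous_id
      (fun v => by simp) (by fun_prop) (fun a b => by
        have e := norm_sub_sq_real (ι b) (ι a)
        have e2 : inner ℝ (ι b - ι a) (ι b) = ‖ι b‖ ^ 2 - inner ℝ (ι b) (ι a) := by
          rw [inner_sub_left, real_inner_self_eq_norm_sq, real_inner_comm]
        simp only [id]
        rw [e2]
        nlinarith [sq_nonneg ‖ι b - ι a‖]) hτ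
    have i1 : IntegrableOn (fun t => ‖f t‖ ^ 2) (Ioo 0 τ) :=
      (integrable_norm_sq f).mono_measure (Measure.restrict_mono_set _ hsub)
    have i2 : IntegrableOn (fun t => ‖u t‖ ^ 2) (Ioo 0 τ) :=
      (integrable_norm_sq u).mono_measure (Measure.restrict_mono_set _ hsub)
    have i3 : IntegrableOn (fun t => ‖w t‖ ^ 2) (Ioo 0 τ) :=
      ((hyc.mono (Icc_subset_Icc_right hτ.2)).integrableOn_compact isCompact_Icc).mono_set
        Ioo_subset_Icc_self
    have i4 : IntegrableOn (fun t => u' t (u t)) (Ioo 0 τ) :=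
      (integrable_dual_apply (Lp.memLp u') (Lp.memLp u)).mono_measure
        (Measure.restrict_mono_set _ hsub)
    have h2 : ∫ t in (0 : ℝ)..τ, u' t (id (u t)) ≤
        ∫ t in Ioo 0 τ, ((2 * α)⁻¹ * ‖f t‖ ^ 2 - α / 2 * ‖u t‖ ^ 2 + κ * ‖w t‖ ^ 2) := by
      rw [intervalIntegral.integral_of_le hτ.1.le, integral_Ioc_eq_integral_Ioo]
      refine integral_mono_ae i4 (((i1.const_mul _).sub (i2.const_mul _)).add (i3.const_mul _)) ?_
      filter_upwards [ae_restrict_of_ae_restrict_of_subset hsub he,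
        ae_restrict_of_ae_restrict_of_subset hsub hp.ae_eq] with t h3 h4
      have h5 : f t (u t) ≤ ‖f t‖ * ‖u t‖ := (le_abs_self _).trans ((f t).le_opNorm _)
      -- Young's inequality with this weight spends half of the coercivity, leaving α/2 for the
      -- bound on u.
      have h6 : ‖f t‖ * ‖u t‖ ≤ (2 * α)⁻¹ * ‖f t‖ ^ 2 + α / 2 * ‖u t‖ ^ 2 := by
        have : (2 * α)⁻¹ * ‖f t‖ ^ 2 + α / 2 * ‖u t‖ ^ 2 - ‖f t‖ * ‖u t‖ =
          (2 * α)⁻¹ * (‖f t‖ - α * ‖u t‖) ^ 2 := by field_simp; ring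
        have : 0 ≤ (2 * α)⁻¹ * (‖f t‖ - α * ‖u t‖) ^ 2 := by positivity
        linarith
      have h7 := hA (u t)
      change u' t (u t) ≤ _
      rw [h3, _root_.sub_apply, h4]
      linarith
    have i5 : IntegrableOn (fun t => (2 * α)⁻¹ * ‖f t‖ ^ 2 - α / 2 * ‖u t‖ ^ 2) (Ioo 0 τ) :=
      (i1.const_mul _).sub (i2.const_mul _)
    rw [integral_add i5 (i3.const_mul _),
      integral_sub (i1.const_mul _) (i2.const_mul _), integral_const_mul, integral_const_mul,
      integral_const_mul] at h2
    have h8 : ∫ t in Ioo 0 τ, ‖f t‖ ^ 2 ≤ ‖f‖ ^ 2 := by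
      rw [norm_sq_eq_integral_norm_sq]
      exact setIntegral_mono_set (integrable_norm_sq f) (.of_forall fun t => sq_nonneg _)
        hsub.eventuallyLE
    have h9 : ∫ t in (0 : ℝ)..τ, ‖w t‖ ^ 2 = ∫ t in Ioo 0 τ, ‖w t‖ ^ 2 := by
      rw [intervalIntegral.integral_of_le hτ.1.le, integral_Ioc_eq_integral_Ioo]
    have h10 : (2 * α)⁻¹ * ∫ t in Ioo 0 τ, ‖f t‖ ^ 2 ≤ (2 * α)⁻¹ * ‖f‖ ^ 2 := by gcongr
    have h11 : (2 * α)⁻¹ * ‖f‖ ^ 2 = α⁻¹ * ‖f‖ ^ 2 / 2 := by rw [mul_inv]; ring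
    rw [h9]
    simp only [D]
    linarith
  have hle : ∀ t ∈ Icc 0 T, ‖w t‖ ^ 2 ≤ D + 2 * κ * ∫ s in (0 : ℝ)..t, ‖w s‖ ^ 2 := by
    intro t ht
    rcases ht.1.eq_or_lt with rfl | h0
    · rw [intervalIntegral.integral_same, mul_zero, add_zero]
      exact le_add_of_nonneg_right (by positivity)
    · have := main t ⟨h0, ht.2⟩
      have h2 : 0 ≤ α * ∫ t in Ioo 0 t, ‖u t‖ ^ 2 :=
        mul_nonneg hα.le (integral_nonneg fun t => sq_nonneg _)
      linarith
  have hG := le_mul_exp_of_le_add_integral (by positivity : 0 < 2 * κ) hyc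
    (fun t _ => sq_nonneg _) hle
  refine ⟨fun t ht => (hle t ht).trans ((hG t ht).trans ?_), ?_⟩
  · gcongr; exact ht.2
  · have h1 := main T ⟨hT, le_rfl⟩
    rw [← norm_sq_eq_integral_norm_sq] at h1
    have h2 := hG T ⟨hT.le, le_rfl⟩
    nlinarith [sq_nonneg ‖w T‖]

/-- The a priori estimate for `u' + A u = f`. -/
theorem exists_apriori (hT : 0 < T) (hα : 0 < α) (hκ : 0 < κ)
    (hA : ∀ v, α * ‖v‖ ^ 2 - κ * ‖ι v‖ ^ 2 ≤ A v v) :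
    ∃ C : ℝ, 0 ≤ C ∧ ∀ (u : Lp V 2 (muTime T)) (u' f : Lp (StrongDual ℝ V) 2 (muTime T))
      (w : ℝ → H), IsParabolicPath ι T u u' w → (∀ᵐ t ∂(muTime T), u' t = f t - A (u t)) →
      (∀ t ∈ Icc 0 T, ‖w t‖ ≤ C * ‖(w 0, f)‖) ∧ ‖u‖ ≤ C * ‖(w 0, f)‖ := by
  set e := Real.exp (2 * κ * T)
  -- The first root bounds w, the second u; their sum serves for both.
  set C := Real.sqrt ((1 + α⁻¹) * e) + Real.sqrt (α⁻¹ * ((1 + α⁻¹) * e))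
  have hC : 0 ≤ C := by positivity
  refine ⟨C, hC, fun u u' f w hp he => ?_⟩
  obtain ⟨h1, h2⟩ := hp.apriori_sq hT hα hκ hA he
  set M := ‖(w 0, f)‖
  have hM : 0 ≤ M := norm_nonneg _
  have m1 : ‖w 0‖ ≤ M := norm_fst_le (w 0, f)
  have m2 : ‖f‖ ≤ M := norm_snd_le (w 0, f)
  have hD : (‖w 0‖ ^ 2 + α⁻¹ * ‖f‖ ^ 2) * e ≤ (1 + α⁻¹) * e * M ^ 2 := by
    have : ‖w 0‖ ^ 2 + α⁻¹ * ‖f‖ ^ 2 ≤ M ^ 2 + α⁻¹ * M ^ 2 := by gcongr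
    calc _ ≤ (M ^ 2 + α⁻¹ * M ^ 2) * e := by gcongr
      _ = _ := by ring
  have aux : ∀ x k : ℝ, 0 ≤ k → x ^ 2 ≤ k * M ^ 2 → x ≤ Real.sqrt k * M := fun x k hk hx => by
    refine le_of_sq_le_sq ?_ (by positivity)
    rwa [mul_pow, Real.sq_sqrt hk]
  constructor
  · intro t ht
    refine (aux _ _ (by positivity) ((h1 t ht).trans hD)).trans ?_
    exact mul_le_mul_of_nonneg_right (le_add_of_nonneg_right (Real.sqrt_nonneg _)) hM
  · have : ‖u‖ ^ 2 ≤ α⁻¹ * ((1 + α⁻¹) * e) * M ^ 2 := by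
      have h3 := h2.trans hD
      calc ‖u‖ ^ 2 = α⁻¹ * (α * ‖u‖ ^ 2) := by field_simp
        _ ≤ α⁻¹ * ((1 + α⁻¹) * e * M ^ 2) := by gcongr
        _ = _ := by ring
    refine (aux _ _ (by positivity) this).trans ?_
    exact mul_le_mul_of_nonneg_right (le_add_of_nonneg_left (Real.sqrt_nonneg _)) hM

theorem abs_integral_dual_const_le (v : Lp (StrongDual ℝ V) 2 (muTime T)) (ψ : V) {s t : ℝ}
    (hs : 0 ≤ s) (hst : s ≤ t) (ht : t ≤ T) :
    |∫ r in s..t, v r ψ| ≤ ‖v‖ * (eLpNorm (fun _ : ℝ => ψ) 2 (muTime T)).toReal := by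
  have hm : volume.restrict (Ioo s t) ≤ muTime T :=
    Measure.restrict_mono_set _ (Ioo_subset_Ioo hs ht)
  rw [intervalIntegral.integral_of_le hst, integral_Ioc_eq_integral_Ioo]
  refine abs_integral_dual_apply_le ((Lp.aestronglyMeasurable v).mono_measure hm)
    aestronglyMeasurable_const (norm_nonneg _) ENNReal.toReal_nonneg ?_ ?_
  · refine (eLpNorm_mono_measure _ hm).trans ?_
    rw [Lp.norm_def, ENNReal.ofReal_toReal (Lp.eLpNorm_ne_top v)]
  · refine (eLpNorm_mono_measure _ hm).trans ?_
    rw [ENNReal.ofReal_toReal (memLp_const ψ).eLpNorm_ne_top]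

theorem exists_subseq_ae_tendsto_Lp {E : Type*} [NormedAddCommGroup E] {μ : Measure ℝ}
    {u : ℕ → Lp E 2 μ} {v : Lp E 2 μ} (h : Tendsto u atTop (𝓝 v)) :
    ∃ ns : ℕ → ℕ, StrictMono ns ∧ ∀ᵐ x ∂μ, Tendsto (fun i => u (ns i) x) atTop (𝓝 (v x)) :=
  (tendstoInMeasure_of_tendsto_Lp h).exists_seq_tendsto_ae

/-- The solutions of `u' + A u = f` depend continuously on the data. -/
theorem exists_isParabolicPath_of_tendsto [CompleteSpace V] [CompleteSpace H] (hT : 0 < T)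
    (hα : 0 < α) (hκ : 0 < κ) (hA : ∀ v, α * ‖v‖ ^ 2 - κ * ‖ι v‖ ^ 2 ≤ A v v)
    {u : ℕ → Lp V 2 (muTime T)} {u' f : ℕ → Lp (StrongDual ℝ V) 2 (muTime T)} {w : ℕ → ℝ → H}
    (hp : ∀ n, IsParabolicPath ι T (u n) (u' n) (w n))
    (he : ∀ n, ∀ᵐ t ∂(muTime T), u' n t = f n t - A (u n t))
    {g : Lp (StrongDual ℝ V) 2 (muTime T)} (hf : Tendsto f atTop (𝓝 g)) {h : H}
    (hw : Tendsto (fun n => w n 0) atTop (𝓝 h)) :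
    ∃ (v : Lp V 2 (muTime T)) (v' : Lp (StrongDual ℝ V) 2 (muTime T)) (z : ℝ → H),
      Tendsto u atTop (𝓝 v) ∧ IsParabolicPath ι T v v' z ∧
      (∀ᵐ t ∂(muTime T), v' t = g t - A (v t)) ∧ z 0 = h := by
  obtain ⟨C, hC, hest⟩ := exists_apriori (T := T) hT hα hκ hA
  -- By linearity the difference of two solutions solves the equation with the difference of the
  -- data, so convergent data make u and w Cauchy, the latter uniformly in time.
  have hdiff : ∀ n m, (∀ t ∈ Icc 0 T, ‖w n t - w m t‖ ≤ C * ‖(w n 0 - w m 0, f n - f m)‖) ∧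
      ‖u n - u m‖ ≤ C * ‖(w n 0 - w m 0, f n - f m)‖ := fun n m => by
    refine hest _ _ (f n - f m) _ ((hp n).sub (hp m)) ?_
    filter_upwards [he n, he m, Lp.coeFn_sub (u n) (u m), Lp.coeFn_sub (u' n) (u' m),
      Lp.coeFn_sub (f n) (f m)] with t h1 h2 h3 h4 h5
    rw [h3, h4, h5, Pi.sub_apply, Pi.sub_apply, Pi.sub_apply, h1, h2, map_sub]
    abel
  have hz : Tendsto (fun n => (w n 0, f n)) atTop (𝓝 (h, g)) := hw.prodMk_nhds hf
  have hcau : ∀ ε > 0, ∃ N, ∀ n ≥ N, ∀ m ≥ N, C * ‖(w n 0 - w m 0, f n - f m)‖ < ε := by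
    intro ε hε
    obtain ⟨N, hN⟩ := Metric.cauchySeq_iff.1 hz.cauchySeq (ε / (C + 1)) (by positivity)
    refine ⟨N, fun n hn m hm => ?_⟩
    have h1 := hN n hn m hm
    rw [dist_eq_norm, Prod.mk_sub_mk] at h1
    calc C * ‖(w n 0 - w m 0, f n - f m)‖ ≤ C * (ε / (C + 1)) := by gcongr
      _ < (C + 1) * (ε / (C + 1)) := by
        apply mul_lt_mul_of_pos_right (by linarith) (by positivity)
      _ = ε := by field_simp
  have hu : CauchySeq u := Metric.cauchySeq_iff.2 fun ε hε => by
    obtain ⟨N, hN⟩ := hcau ε hε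
    exact ⟨N, fun n hn m hm => by
      rw [dist_eq_norm]; exact (hdiff n m).2.trans_lt (hN n hn m hm)⟩
  obtain ⟨v, hv⟩ := cauchySeq_tendsto_of_complete hu
  have hwc : ∀ t ∈ Icc 0 T, ∃ y, Tendsto (fun n => w n t) atTop (𝓝 y) := fun t ht =>
    cauchySeq_tendsto_of_complete (Metric.cauchySeq_iff.2 fun ε hε => by
      obtain ⟨N, hN⟩ := hcau ε hε
      exact ⟨N, fun n hn m hm => by
        rw [dist_eq_norm]; exact ((hdiff n m).1 t ht).trans_lt (hN n hn m hm)⟩)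
  choose! z hzt using hwc
  set Ã := ContinuousLinearMap.compLpL 2 (muTime T) A
  have hu'eq : ∀ n, u' n = f n - Ã (u n) := fun n => Lp.ext (by
    filter_upwards [he n, Lp.coeFn_sub (f n) (Ã (u n)), A.coeFn_compLpL (u n)] with t h1 h2 h3
    rw [h1, h2, Pi.sub_apply, h3])
  set v' := g - Ã v
  -- The time derivatives converge because the equation expresses them through f and u.
  have hu' : Tendsto u' atTop (𝓝 v') := by
    rw [show u' = fun n => f n - Ã (u n) from funext hu'eq]
    exact hf.sub ((Ã.continuous.tendsto v).comp hv)
  refine ⟨v, v', z, hv, ⟨?_, ?_, ?_⟩, ?_,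
    tendsto_nhds_unique (hzt 0 ⟨le_rfl, hT.le⟩) hw⟩
  · have hU : TendstoUniformlyOn w z atTop (Icc 0 T) := by
      rw [Metric.tendstoUniformlyOn_iff]
      intro ε hε
      obtain ⟨N, hN⟩ := hcau (ε / 2) (by positivity)
      filter_upwards [eventually_ge_atTop N] with n hn t ht
      have : dist (z t) (w n t) ≤ ε / 2 := by
        refine le_of_tendsto ((hzt t ht).dist tendsto_const_nhds) ?_
        filter_upwards [eventually_ge_atTop N] with m hm
        rw [dist_eq_norm]
        exact ((hdiff m n).1 t ht).trans (hN m hm n hn).le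
      linarith
    exact hU.continuousOn (.of_forall fun n => (hp n).cont)
  · obtain ⟨ns, hns, hae⟩ := exists_subseq_ae_tendsto_Lp hv
    filter_upwards [hae, ae_all_iff.2 fun n => (hp n).ae_eq,
      ae_restrict_mem measurableSet_Ioo] with t h1 h2 h3
    refine tendsto_nhds_unique ((hzt t (Ioo_subset_Icc_self h3)).comp hns.tendsto_atTop) ?_
    exact ((ι.continuous.tendsto _).comp h1).congr fun n => (h2 (ns n)).symm
  · intro ψ s hs t ht hst
    have l1 : Tendsto (fun n => inner ℝ (w n t) (ι ψ) - inner ℝ (w n s) (ι ψ)) atTop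
        (𝓝 (inner ℝ (z t) (ι ψ) - inner ℝ (z s) (ι ψ))) :=
      ((hzt t ht).inner tendsto_const_nhds).sub ((hzt s hs).inner tendsto_const_nhds)
    refine tendsto_nhds_unique l1 ?_
    have l2 : Tendsto (fun n => ∫ r in s..t, u' n r ψ) atTop (𝓝 (∫ r in s..t, v' r ψ)) := by
      rw [tendsto_iff_dist_tendsto_zero]
      have h0 : Tendsto (fun n => ‖u' n - v'‖ *
          (eLpNorm (fun _ : ℝ => ψ) 2 (muTime T)).toReal) atTop (𝓝 0) := by
        have := (tendsto_iff_norm_sub_tendsto_zero.1 hu').mul_const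
          (eLpNorm (fun _ : ℝ => ψ) 2 (muTime T)).toReal
        rwa [zero_mul] at this
      refine squeeze_zero (fun _ => dist_nonneg) (fun n => ?_) h0
      have hi : ∀ v' : Lp (StrongDual ℝ V) 2 (muTime T),
          IntervalIntegrable (fun t => v' t ψ) volume s t := fun v' => by
        rw [intervalIntegrable_iff_integrableOn_Ioo_of_le hst]
        exact (integrableOn_dual_apply_const v' ψ).mono_set (Ioo_subset_Ioo hs.1 ht.2)
      rw [Real.dist_eq, ← intervalIntegral.integral_sub (hi _) (hi _)]
      refine le_trans (le_of_eq ?_) (abs_integral_dual_const_le (u' n - v') ψ hs.1 hst ht.2)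
      congr 1
      rw [intervalIntegral.integral_of_le hst, intervalIntegral.integral_of_le hst,
        integral_Ioc_eq_integral_Ioo, integral_Ioc_eq_integral_Ioo]
      refine integral_congr_ae ?_
      filter_upwards [ae_restrict_of_ae_restrict_of_subset (Ioo_subset_Ioo hs.1 ht.2)
        (Lp.coeFn_sub (u' n) v')] with r hr
      rw [hr]; rfl
    exact l2.congr fun n => ((hp n).deriv ψ s hs t ht hst).symm
  · filter_upwards [Lp.coeFn_sub g (Ã v), A.coeFn_compLpL v] with t h2 h3
    rw [h2, Pi.sub_apply, h3]

end Parabolic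

end CrowdControl

/-! ### Existence for the linear equation -/

namespace CrowdControl

section Existence

variable {V H : Type*} [NormedAddCommGroup V] [InnerProductSpace ℝ V] [CompleteSpace V]
  [NormedAddCommGroup H] [InnerProductSpace ℝ H]
  {ι : V →L[ℝ] H} {T : ℝ} {A : V →L[ℝ] StrongDual ℝ V} {α κ : ℝ}

theorem memLp_muTime_of_continuous {E : Type*} [NormedAddCommGroup E] {f : ℝ → E}
    (hf : Continuous f) (T : ℝ) : MemLp f 2 (muTime T) := by
  obtain ⟨C, hC⟩ := (isCompact_Icc (a := (0 : ℝ)) (b := T)).exists_bound_of_continuousOn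
    hf.continuousOn
  exact MemLp.of_bound hf.aestronglyMeasurable C
    (ae_restrict_of_forall_mem measurableSet_Ioo fun t ht => hC t (Ioo_subset_Icc_self ht))

/-- The added ε makes the form on the left coercive on V, so Lax–Milgram inverts it. The regularized
problem becomes an ODE in V with a bounded operator. -/
theorem exists_operator_inner_add (ι : V →L[ℝ] H) (A : V →L[ℝ] StrongDual ℝ V) {ε : ℝ}
    (hε : 0 < ε) : ∃ B : V →L[ℝ] V, ∀ v ψ,
      inner ℝ (ι (B v)) (ι ψ) + ε * inner ℝ (B v) ψ = A v ψ := by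
  let M : V →L[ℝ] V →L[ℝ] ℝ := (innerSL ℝ).bilinearComp ι ι + ε • innerSL ℝ
  have hM : ∀ v ψ, M v ψ = inner ℝ (ι v) (ι ψ) + ε * inner ℝ v ψ := fun v ψ => rfl
  have hc : IsCoercive M := ⟨ε, hε, fun v => by
    rw [hM, real_inner_self_eq_norm_mul_norm, real_inner_self_eq_norm_mul_norm]
    nlinarith [mul_self_nonneg ‖ι v‖]⟩
  let A' : V →L[ℝ] V := InnerProductSpace.continuousLinearMapOfBilin (𝕜 := ℝ) A
  have hA' : ∀ v ψ, inner ℝ (A' v) ψ = A v ψ :=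
    InnerProductSpace.continuousLinearMapOfBilin_apply A
  refine ⟨(hc.continuousLinearEquivOfBilin.symm : V →L[ℝ] V).comp A', fun v ψ => ?_⟩
  rw [← hM, ← hc.continuousLinearEquivOfBilin_apply]
  simp [hA']

/-- Solve U' = -BU by the exponential; it satisfies u' + Au = f with residual f = ε⟨BU, ·⟩. Symmetry
of A gives d/dt A(U,U) = -2A(U,BU) ≤ -2ε‖BU‖², and integrating in time with A ≥ 0 yields the bound
on f. -/
theorem exists_approximate_isParabolicPath (hT : 0 < T) (hsymm : ∀ u v, A u v = A v u)
    (hnn : ∀ v, 0 ≤ A v v) (v₀ : V) {ε : ℝ} (hε : 0 < ε) :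
    ∃ (u : Lp V 2 (muTime T)) (u' f : Lp (StrongDual ℝ V) 2 (muTime T)) (w : ℝ → H),
      IsParabolicPath ι T u u' w ∧ (∀ᵐ t ∂(muTime T), u' t = f t - A (u t)) ∧ w 0 = ι v₀ ∧
      ‖f‖ ^ 2 ≤ ε / 2 * A v₀ v₀ := by
  obtain ⟨B, hB⟩ := exists_operator_inner_add ι A hε
  set U : ℝ → V := fun t => NormedSpace.exp (t • (-B)) v₀
  have hU : ∀ t, HasDerivAt U (-B (U t)) t := fun t =>
    ((ContinuousLinearMap.apply ℝ V v₀).hasFDerivAt.comp_hasDerivAt t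
      (hasDerivAt_exp_smul_const' (-B) t))
  have hUc : Continuous U := continuous_iff_continuousAt.2 fun t => (hU t).continuousAt
  have hU0 : U 0 = v₀ := by simp [U]
  have hfc : Continuous fun t => ε • innerSL ℝ (B (U t)) := by fun_prop
  have hu'c : Continuous fun t => ε • innerSL ℝ (B (U t)) - A (U t) := by fun_prop
  have mu := memLp_muTime_of_continuous hUc T
  have mf := memLp_muTime_of_continuous hfc T
  have mu' := memLp_muTime_of_continuous hu'c T
  refine ⟨mu.toLp, mu'.toLp, mf.toLp, fun t => ι (U t), ⟨?_, ?_, ?_⟩, ?_, congrArg ι hU0, ?_⟩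
  · exact (ι.continuous.comp hUc).continuousOn
  · filter_upwards [mu.coeFn_toLp] with t ht
    rw [ht]
  · intro ψ s hs t ht hst
    have e : ∫ r in s..t, mu'.toLp _ r ψ = ∫ r in s..t, inner ℝ (ι (-B (U r))) (ι ψ) := by
      rw [intervalIntegral.integral_of_le hst, intervalIntegral.integral_of_le hst,
        integral_Ioc_eq_integral_Ioo, integral_Ioc_eq_integral_Ioo]
      refine integral_congr_ae ?_
      filter_upwards [ae_restrict_of_ae_restrict_of_subset (Ioo_subset_Ioo hs.1 ht.2)
        mu'.coeFn_toLp] with r hr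
      rw [hr]
      have := hB (U r) ψ
      change ε * inner ℝ (B (U r)) ψ - A (U r) ψ = _
      rw [map_neg, inner_neg_left]
      linarith
    rw [e]
    refine (intervalIntegral.integral_eq_sub_of_hasDerivAt
      (f := fun r => inner ℝ (ι (U r)) (ι ψ)) (fun r _ => ?_) ?_).symm
    · have h1 : HasDerivAt (fun r => ι (U r)) (ι (-B (U r))) r :=
        ι.hasFDerivAt.comp_hasDerivAt r (hU r)
      have h2 := h1.inner ℝ (hasDerivAt_const r (ι ψ))
      simpa using h2
    · exact Continuous.intervalIntegrable (by fun_prop) _ _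
  · filter_upwards [mu.coeFn_toLp, mu'.coeFn_toLp, mf.coeFn_toLp] with t h1 h2 h3
    rw [h1, h2, h3]
  · have hder : ∀ t, HasDerivAt (fun t => A (U t) (U t)) (-(2 * A (U t) (B (U t)))) t := by
      intro t
      have h1 : HasDerivAt (fun r => A (U r)) (A (-B (U t))) t :=
        A.hasFDerivAt.comp_hasDerivAt t (hU t)
      have h2 := h1.clm_apply (hU t)
      have e : A (-B (U t)) (U t) + A (U t) (-B (U t)) = -(2 * A (U t) (B (U t))) := by
        rw [hsymm (-B (U t)) (U t), map_neg]
        ring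
      rwa [e] at h2
    have hFTC := intervalIntegral.integral_eq_sub_of_hasDerivAt (a := 0) (b := T)
      (fun t _ => hder t) (Continuous.intervalIntegrable (by fun_prop) _ _)
    rw [hU0] at hFTC
    have hn : ‖mf.toLp‖ ^ 2 = ∫ t in (0 : ℝ)..T, ε ^ 2 * ‖B (U t)‖ ^ 2 := by
      rw [norm_sq_eq_integral_norm_sq, intervalIntegral.integral_of_le hT.le,
        integral_Ioc_eq_integral_Ioo]
      refine integral_congr_ae ?_
      filter_upwards [mf.coeFn_toLp] with t ht
      rw [ht, norm_smul, innerSL_apply_norm, mul_pow, Real.norm_of_nonneg hε.le]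
    have hle : ∫ t in (0 : ℝ)..T, ε ^ 2 * ‖B (U t)‖ ^ 2 ≤
        ∫ t in (0 : ℝ)..T, -(ε / 2) * (-(2 * A (U t) (B (U t)))) := by
      refine intervalIntegral.integral_mono_on hT.le
        (Continuous.intervalIntegrable (by fun_prop) _ _)
        (Continuous.intervalIntegrable (by fun_prop) _ _) fun t _ => ?_
      have h1 := hB (U t) (B (U t))
      rw [real_inner_self_eq_norm_sq, real_inner_self_eq_norm_sq] at h1
      nlinarith [sq_nonneg ‖ι (B (U t))‖]
    rw [intervalIntegral.integral_const_mul (-(ε / 2)), hFTC] at hle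
    rw [hn]
    nlinarith [hnn (U T)]

/-- Existence of solutions of `u' + A u = 0`. -/
theorem exists_isParabolicPath [CompleteSpace H] (hT : 0 < T)
    (hα : 0 < α) (hκ : 0 < κ) (hA : ∀ v, α * ‖v‖ ^ 2 - κ * ‖ι v‖ ^ 2 ≤ A v v)
    (hsymm : ∀ u v, A u v = A v u) (hnn : ∀ v, 0 ≤ A v v) (hι : DenseRange ι) (h : H) :
    ∃ (u : Lp V 2 (muTime T)) (u' : Lp (StrongDual ℝ V) 2 (muTime T)) (w : ℝ → H),
      IsParabolicPath ι T u u' w ∧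
      (∀ᵐ t ∂(muTime T), u' t = (0 : Lp (StrongDual ℝ V) 2 (muTime T)) t - A (u t)) ∧
      w 0 = h := by
  -- Initial values from V come first, with ε = 1/(n+1) and stability as the residual tends to zero.
  -- General ones follow by density of V in H and stability once more.
  have step : ∀ v₀ : V, ∃ (u : Lp V 2 (muTime T)) (u' : Lp (StrongDual ℝ V) 2 (muTime T))
      (w : ℝ → H), IsParabolicPath ι T u u' w ∧
      (∀ᵐ t ∂(muTime T), u' t = (0 : Lp (StrongDual ℝ V) 2 (muTime T)) t - A (u t)) ∧
      w 0 = ι v₀ := by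
    intro v₀
    choose u u' f w hp he h0 hf using fun n : ℕ =>
      exists_approximate_isParabolicPath (ι := ι) hT hsymm hnn v₀
        (Nat.one_div_pos_of_nat (α := ℝ) (n := n))
    have hf0 : Tendsto f atTop (𝓝 0) := by
      rw [tendsto_zero_iff_norm_tendsto_zero]
      have h1 : Tendsto (fun n : ℕ => (1 / ((n : ℝ) + 1)) / 2 * A v₀ v₀) atTop (𝓝 0) := by
        have := (tendsto_one_div_add_atTop_nhds_zero_nat (𝕜 := ℝ)).mul_const (A v₀ v₀ / 2)
        rw [zero_mul] at this
        exact this.congr fun n => by ring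
      have h2 : Tendsto (fun n => ‖f n‖ ^ 2) atTop (𝓝 0) :=
        squeeze_zero (fun _ => sq_nonneg _) hf h1
      have h3 := (Real.continuous_sqrt.tendsto 0).comp h2
      rw [Real.sqrt_zero] at h3
      exact h3.congr fun n => Real.sqrt_sq (norm_nonneg _)
    obtain ⟨v, v', z, -, h1, h2, h3⟩ := exists_isParabolicPath_of_tendsto hT hα hκ hA hp he hf0
      (tendsto_const_nhds.congr fun n => (h0 n).symm)
    exact ⟨v, v', z, h1, h2, h3⟩
  obtain ⟨y, hy, hyh⟩ := mem_closure_iff_seq_limit.1 (hι h)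
  choose v hv using hy
  choose u u' w hp he h0 using fun n => step (v n)
  obtain ⟨v, v', z, -, h1, h2, h3⟩ := exists_isParabolicPath_of_tendsto hT hα hκ hA hp he
    tendsto_const_nhds (hyh.congr fun n => by rw [h0, hv])
  exact ⟨v, v', z, h1, h2, h3⟩

end Existence

end CrowdControl

/-! ### Functions on the cylinder as functions of time with values in `L²` -/

namespace CrowdControl

section Slice

variable {α S E : Type*} [MeasurableSpace α] [MeasurableSpace S] {μ : Measure α} {ν : Measure S}
  [NormedAddCommGroup E]

/-- `J` is `f`, regarded as a function of the second variable with values in `L²`. -/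
def IsSlice (f : Lp E 2 (μ.prod ν)) (J : Lp (Lp E 2 μ) 2 ν) : Prop :=
  ∀ᵐ t ∂ν, ∀ᵐ x ∂μ, f (x, t) = J t x

theorem ae_ae_of_ae_prod_swap [SFinite μ] [SFinite ν] {p : α × S → Prop} (h : ∀ᵐ z ∂(μ.prod ν), p z) :
    ∀ᵐ t ∂ν, ∀ᵐ x ∂μ, p (x, t) := by
  have : ∀ᵐ z ∂(ν.prod μ), p z.swap :=
    (Measure.measurePreserving_swap (μ := ν) (ν := μ)).quasiMeasurePreserving.ae h
  exact Measure.ae_ae_of_ae_prod this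

theorem IsSlice.add [SFinite μ] [SFinite ν] {f g : Lp E 2 (μ.prod ν)} {J K : Lp (Lp E 2 μ) 2 ν} (hf : IsSlice f J)
    (hg : IsSlice g K) : IsSlice (f + g) (J + K) := by
  filter_upwards [hf, hg, ae_ae_of_ae_prod_swap (Lp.coeFn_add f g), Lp.coeFn_add J K]
    with t h1 h2 h3 h4
  rw [h4, Pi.add_apply]
  filter_upwards [h1, h2, h3, Lp.coeFn_add (J t) (K t)] with x h5 h6 h7 h8
  rw [h7, h8, Pi.add_apply, Pi.add_apply, h5, h6]

theorem IsSlice.smul [SFinite μ] [SFinite ν] [NormedSpace ℝ E] {f : Lp E 2 (μ.prod ν)} {J : Lp (Lp E 2 μ) 2 ν} (c : ℝ) (hf : IsSlice f J) :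
    IsSlice (c • f) (c • J) := by
  filter_upwards [hf, ae_ae_of_ae_prod_swap (Lp.coeFn_smul c f), Lp.coeFn_smul c J]
    with t h1 h3 h4
  rw [h4, Pi.smul_apply]
  filter_upwards [h1, h3, Lp.coeFn_smul c (J t)] with x h5 h7 h8
  rw [h7, h8, Pi.smul_apply, Pi.smul_apply, h5]

theorem IsSlice.right_unique {f : Lp E 2 (μ.prod ν)} {J K : Lp (Lp E 2 μ) 2 ν} (hf : IsSlice f J)
    (hg : IsSlice f K) : J = K := by
  refine Lp.ext ?_
  filter_upwards [hf, hg] with t h1 h2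
  refine Lp.ext ?_
  filter_upwards [h1, h2] with x h3 h4
  rw [← h3, h4]

theorem IsSlice.norm_eq [SFinite μ] [SFinite ν] {f : Lp E 2 (μ.prod ν)} {J : Lp (Lp E 2 μ) 2 ν} (hf : IsSlice f J) :
    ‖J‖ = ‖f‖ := by
  have h : eLpNorm J 2 ν ^ 2 = eLpNorm f 2 (μ.prod ν) ^ 2 := by
    rw [sq_eLpNorm_two, sq_eLpNorm_two,
      lintegral_prod_symm _ ((Lp.aestronglyMeasurable f).enorm.pow_const 2)]
    refine lintegral_congr_ae ?_
    filter_upwards [hf] with t ht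
    rw [Lp.enorm_def, sq_eLpNorm_two]
    refine lintegral_congr_ae ?_
    filter_upwards [ht] with x hx
    rw [hx]
  rw [Lp.norm_def, Lp.norm_def]
  congr 1
  exact (ENNReal.pow_right_strictMono two_ne_zero).injective h

variable [SFinite μ] [SFinite ν] [InnerProductSpace ℝ E]
  [SecondCountableTopology (Lp E 2 μ)]

/-- By Tonelli almost every slice is in `L²`; the others are replaced by 0. Measurability in t is
weak measurability, inner products of slices being partial integrals. -/
theorem exists_isSlice (f : Lp E 2 (μ.prod ν)) : ∃ J : Lp (Lp E 2 μ) 2 ν, IsSlice f J := by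
  have hfm : StronglyMeasurable f := Lp.stronglyMeasurable f
  have hsec : ∀ t, StronglyMeasurable fun x => f (x, t) := fun t =>
    hfm.comp_measurable (measurable_id.prodMk measurable_const)
  set N : S → ℝ≥0∞ := fun t => ∫⁻ x, ‖f (x, t)‖ₑ ^ 2 ∂μ
  have hN : Measurable N := (hfm.enorm.pow_const 2).lintegral_prod_left'
  set G : Set S := {t | N t < ⊤}
  have hG : MeasurableSet G := measurableSet_lt hN measurable_const
  have hmem : ∀ t ∈ G, MemLp (fun x => f (x, t)) 2 μ := fun t ht =>
    ⟨(hsec t).aestronglyMeasurable, by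
      have h1 : eLpNorm (fun x => f (x, t)) 2 μ ^ 2 < ⊤ := by rw [sq_eLpNorm_two]; exact ht
      by_contra h2
      rw [not_lt, top_le_iff] at h2
      rw [h2] at h1
      simp at h1⟩
  have hNint : ∫⁻ t, N t ∂ν < ⊤ := by
    have h1 : eLpNorm f 2 (μ.prod ν) ^ 2 < ⊤ := ENNReal.pow_lt_top (Lp.eLpNorm_lt_top f)
    rwa [sq_eLpNorm_two,
      lintegral_prod_symm _ ((Lp.aestronglyMeasurable f).enorm.pow_const 2)] at h1
  classical
  set J : S → Lp E 2 μ := fun t => if ht : t ∈ G then (hmem t ht).toLp _ else 0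
  have hJ : ∀ t ∈ G, J t =ᵐ[μ] fun x => f (x, t) := fun t ht => by
    simp only [J, dif_pos ht]; exact (hmem t ht).coeFn_toLp
  have hJm : StronglyMeasurable J := by
    borelize ↥(Lp E 2 μ)
    refine stronglyMeasurable_of_inner fun e => ?_
    have h1 : Measurable fun t => ∫ x, inner ℝ (e x) (f (x, t)) ∂μ :=
      (StronglyMeasurable.integral_prod_left'
        (f := fun z : α × S => inner ℝ (e z.1) (f z))
        (((Lp.stronglyMeasurable e).comp_measurable measurable_fst).inner hfm)).measurable
    have h2 : (fun t => inner ℝ e (J t)) =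
        G.indicator fun t => ∫ x, inner ℝ (e x) (f (x, t)) ∂μ := by
      ext1 t
      by_cases ht : t ∈ G
      · rw [indicator_of_mem ht, L2.inner_def]
        refine integral_congr_ae ?_
        filter_upwards [hJ t ht] with x hx
        rw [hx]
      · rw [indicator_of_notMem ht]
        simp only [J, dif_neg ht, inner_zero_right]
    rw [h2]
    exact h1.indicator hG
  have hGae : ∀ᵐ t ∂ν, t ∈ G := ae_lt_top hN hNint.ne
  have hJL : MemLp J 2 ν := by
    refine ⟨hJm.aestronglyMeasurable, ?_⟩
    have h1 : eLpNorm J 2 ν ^ 2 = ∫⁻ t, N t ∂ν := by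
      rw [sq_eLpNorm_two]
      refine lintegral_congr_ae ?_
      filter_upwards [hGae] with t ht
      rw [Lp.enorm_def, sq_eLpNorm_two]
      refine lintegral_congr_ae ?_
      filter_upwards [hJ t ht] with x hx
      rw [hx]
    by_contra h2
    rw [not_lt, top_le_iff] at h2
    rw [h2] at h1
    rw [← h1] at hNint
    simp at hNint
  refine ⟨hJL.toLp J, ?_⟩
  filter_upwards [hGae, hJL.coeFn_toLp] with t h1 h2
  rw [h2]
  exact (hJ t h1).symm

/-- The isometry of `L²(μ × ν; E)` to `L²(ν; L²(μ; E))`. -/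
noncomputable def sliceL : Lp E 2 (μ.prod ν) →ₗᵢ[ℝ] Lp (Lp E 2 μ) 2 ν where
  toFun f := (exists_isSlice f).choose
  map_add' f g := (exists_isSlice (f + g)).choose_spec.right_unique
    ((exists_isSlice f).choose_spec.add (exists_isSlice g).choose_spec)
  map_smul' c f := (exists_isSlice (c • f)).choose_spec.right_unique
    ((exists_isSlice f).choose_spec.smul c)
  norm_map' f := (exists_isSlice f).choose_spec.norm_eq

theorem isSlice_sliceL (f : Lp E 2 (μ.prod ν)) : IsSlice f (sliceL f) :=
  (exists_isSlice f).choose_spec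

theorem isSlice_iff {f : Lp E 2 (μ.prod ν)} {J : Lp (Lp E 2 μ) 2 ν} :
    IsSlice f J ↔ sliceL f = J :=
  ⟨fun h => (isSlice_sliceL f).right_unique h, fun h => h ▸ isSlice_sliceL f⟩

/-- The range contains the vector-valued indicators, is closed under sums, and is topologically
closed because the map is an isometry. Surjectivity turns a solution of the abstract equation into a
density on the cylinder. -/
theorem surjective_sliceL [CompleteSpace E] :
    Function.Surjective (sliceL : Lp E 2 (μ.prod ν) →ₗᵢ[ℝ] Lp (Lp E 2 μ) 2 ν) := by
  refine Lp.induction (by norm_num) _ ?_ ?_ ?_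
  · intro c s hs hμs
    set g : α × S → E := fun z => s.indicator (fun _ => c z.1) z.2
    have hgs : g = (univ ×ˢ s).indicator fun z => c z.1 := by
      ext1 ⟨x, t⟩
      by_cases ht : t ∈ s <;> simp [g, ht]
    have hgm : StronglyMeasurable g := by
      rw [hgs]
      exact ((Lp.stronglyMeasurable c).comp_measurable measurable_fst).indicator
        (MeasurableSet.univ.prod hs)
    have hg : MemLp g 2 (μ.prod ν) := by
      refine ⟨hgm.aestronglyMeasurable, ?_⟩
      have h1 : eLpNorm g 2 (μ.prod ν) ^ 2 = eLpNorm c 2 μ ^ 2 * ν s := by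
        rw [sq_eLpNorm_two, sq_eLpNorm_two,
          lintegral_prod_symm _ (hgm.enorm.pow_const 2).aemeasurable,
          ← setLIntegral_const, ← lintegral_indicator hs]
        refine lintegral_congr fun t => ?_
        by_cases ht : t ∈ s
        · simp only [g, indicator_of_mem ht]
        · simp [g, indicator_of_notMem ht]
      have h3 : eLpNorm c 2 μ ^ 2 * ν s < ⊤ :=
        ENNReal.mul_lt_top (ENNReal.pow_lt_top (Lp.eLpNorm_lt_top c)) hμs
      by_contra h2
      rw [not_lt, top_le_iff] at h2
      rw [h2] at h1
      rw [← h1] at h3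
      simp at h3
    refine ⟨hg.toLp g, isSlice_iff.1 ?_⟩
    rw [Lp.simpleFunc.coe_indicatorConst]
    filter_upwards [ae_ae_of_ae_prod_swap hg.coeFn_toLp,
      indicatorConstLp_coeFn (p := 2) (hs := hs) (hμs := hμs.ne) (c := c)] with t h1 h2
    rw [h2]
    by_cases ht : t ∈ s
    · rw [indicator_of_mem ht]
      filter_upwards [h1] with x h3
      rw [h3]
      simp only [g, indicator_of_mem ht]
    · rw [indicator_of_notMem ht]
      filter_upwards [h1, Lp.coeFn_zero E 2 μ] with x h3 h4
      rw [h3, h4]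
      simp [g, indicator_of_notMem ht]
  · rintro f g hf hg - ⟨a, ha⟩ ⟨b, hb⟩
    exact ⟨a + b, by rw [map_add, ha, hb]⟩
  · exact sliceL.isometry.isClosedEmbedding.isClosed_range

end Slice

instance : Fact ((2 : ℝ≥0∞) ≠ ⊤) := ⟨ENNReal.ofNat_ne_top⟩

/-! ### The constraint as an equation in the dual of `H¹` -/

section Form

variable {d : ℕ} {Ω : Set (Sp d)}

theorem IsWeakGradient.congr {u v : Sp d → ℝ} {g h : Sp d → Sp d}
    (hw : IsWeakGradient Ω u g) (huv : u =ᵐ[muOmega Ω] v) (hgh : g =ᵐ[muOmega Ω] h) :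
    IsWeakGradient Ω v h := by
  intro φ h1 h2 h3
  have e1 : ∫ x in Ω, v x • gradient φ x = ∫ x in Ω, u x • gradient φ x :=
    integral_congr_ae (by filter_upwards [huv] with x hx; rw [hx])
  have e2 : ∫ x in Ω, φ x • h x = ∫ x in Ω, φ x • g x :=
    integral_congr_ae (by filter_upwards [hgh] with x hx; rw [hx])
  rw [e1, e2, hw φ h1 h2 h3]

theorem exists_h1_of_test {φ : Sp d → ℝ} (h1 : ContDiff ℝ ∞ φ) (h2 : HasCompactSupport φ) :
    ∃ ψ : H1 Ω, h1fn ψ =ᵐ[muOmega Ω] φ := by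
  have m1 := memLp_test Ω h1 h2
  have m2 := memLp_gradient_test Ω h1 h2
  have hw : IsWeakGradient Ω (m1.toLp φ) (m2.toLp _) :=
    (isWeakGradient_gradient (h1.of_le (m := 1) (by simp))).congr m1.coeFn_toLp.symm
      m2.coeFn_toLp.symm
  exact ⟨⟨WithLp.toLp 2 (m1.toLp φ, m2.toLp _), hw⟩, m1.coeFn_toLp⟩

/-- A function orthogonal to the range is orthogonal to all test functions, hence zero. -/
theorem IsLipschitzDomain.denseRange_h1fnL (hΩ : IsLipschitzDomain Ω) :
    DenseRange (h1fnL Ω) := by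
  have := hΩ.isFiniteMeasure
  have h : (LinearMap.range (h1fnL Ω).toLinearMap).topologicalClosure = ⊤ := by
    rw [Submodule.topologicalClosure_eq_top_iff, Submodule.eq_bot_iff]
    intro v hv
    have hz : ∀ᵐ x, x ∈ Ω → v x = 0 := by
      refine hΩ.isOpen.ae_eq_zero_of_integral_contDiff_smul_eq_zero ?_ fun φ h1 h2 h3 => ?_
      · have h1 : IntegrableOn v Ω := (Lp.memLp v).integrable (by norm_num)
        exact h1.locallyIntegrableOn
      · obtain ⟨ψ, hψ⟩ := exists_h1_of_test (Ω := Ω) h1 h2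
        have h4 : inner ℝ v (h1fnL Ω ψ) = 0 := by
          rw [real_inner_comm]
          exact (Submodule.mem_orthogonal _ _).1 hv _ ⟨ψ, rfl⟩
        rw [inner_h1fn] at h4
        rw [← setIntegral_eq_integral_of_forall_compl_eq_zero (s := Ω) fun x hx => by
          rw [image_eq_zero_of_notMem_tsupport fun h => hx (h3 h), zero_smul], ← h4]
        refine integral_congr_ae ?_
        filter_upwards [hψ] with x hx
        rw [hx, smul_eq_mul, mul_comm]
    refine Lp.ext ?_
    filter_upwards [(ae_restrict_iff' hΩ.isOpen.measurableSet).2 hz,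
      Lp.coeFn_zero ℝ 2 (muOmega Ω)] with x h1 h2
    rw [h1, h2]; rfl
  rw [← Submodule.dense_iff_topologicalClosure_eq_top] at h
  exact h

/-- The restriction of the trace to `ΓE`. -/
noncomputable def IsLipschitzDomain.exitTraceL (hΩ : IsLipschitzDomain Ω) (ΓE : Set (Sp d)) :
    H1 Ω →L[ℝ] Lp ℝ 2 ((surf Ω).restrict ΓE) :=
  (LpToLpRestrictCLM (Sp d) ℝ ℝ (surf Ω) 2 ΓE).comp hΩ.traceL

/-- The bilinear form of the diffusion operator with outflux through `ΓE`. -/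
noncomputable def IsLipschitzDomain.form (hΩ : IsLipschitzDomain Ω) (ΓE : Set (Sp d)) (σ β : ℝ) :
    H1 Ω →L[ℝ] StrongDual ℝ (H1 Ω) :=
  (σ ^ 2 / 2) • (innerSL ℝ).bilinearComp (h1gradL Ω) (h1gradL Ω) +
    β • (innerSL ℝ).bilinearComp (hΩ.exitTraceL ΓE) (hΩ.exitTraceL ΓE)

theorem IsLipschitzDomain.form_apply (hΩ : IsLipschitzDomain Ω) (ΓE : Set (Sp d)) (σ β : ℝ)
    (u ψ : H1 Ω) : hΩ.form ΓE σ β u ψ = σ ^ 2 / 2 * inner ℝ (h1grad u) (h1grad ψ) +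
      β * inner ℝ (hΩ.exitTraceL ΓE u) (hΩ.exitTraceL ΓE ψ) := rfl

theorem IsLipschitzDomain.inner_exitTraceL (hΩ : IsLipschitzDomain Ω) (ΓE : Set (Sp d))
    (u ψ : H1 Ω) : inner ℝ (hΩ.exitTraceL ΓE u) (hΩ.exitTraceL ΓE ψ) =
      ∫ x in ΓE, trace u x * trace ψ x ∂(surf Ω) := by
  rw [L2.inner_def]
  refine integral_congr_ae ?_
  filter_upwards [LpToLpRestrictCLM_coeFn ℝ ΓE (hΩ.traceL u),
    LpToLpRestrictCLM_coeFn ℝ ΓE (hΩ.traceL ψ)] with x h1 h2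
  change inner ℝ (LpToLpRestrictCLM (Sp d) ℝ ℝ (surf Ω) 2 ΓE (hΩ.traceL u) x)
    (LpToLpRestrictCLM (Sp d) ℝ ℝ (surf Ω) 2 ΓE (hΩ.traceL ψ) x) = _
  rw [h1, h2, hΩ.traceL_apply, hΩ.traceL_apply]
  simp [mul_comm]

theorem IsLipschitzDomain.form_symm (hΩ : IsLipschitzDomain Ω) (ΓE : Set (Sp d)) (σ β : ℝ)
    (u v : H1 Ω) : hΩ.form ΓE σ β u v = hΩ.form ΓE σ β v u := by
  rw [form_apply, form_apply, real_inner_comm, real_inner_comm (hΩ.exitTraceL ΓE u)]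

/-- The outflux term has a good sign, and the gradient norm differs from the `H¹` norm only by the
`L²` norm. So α = κ = σ²/2 in the abstract estimates. -/
theorem IsLipschitzDomain.le_form (hΩ : IsLipschitzDomain Ω) (ΓE : Set (Sp d)) (σ : ℝ) {β : ℝ}
    (hβ : 0 ≤ β) (u : H1 Ω) : σ ^ 2 / 2 * ‖u‖ ^ 2 - σ ^ 2 / 2 * ‖h1fnL Ω u‖ ^ 2 ≤
      hΩ.form ΓE σ β u u := by
  rw [form_apply, real_inner_self_eq_norm_sq, real_inner_self_eq_norm_sq, h1_norm_sq, h1fnL_apply]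
  nlinarith [mul_nonneg hβ (sq_nonneg ‖hΩ.exitTraceL ΓE u‖)]

theorem IsLipschitzDomain.form_nonneg (hΩ : IsLipschitzDomain Ω) (ΓE : Set (Sp d)) (σ : ℝ) {β : ℝ}
    (hβ : 0 ≤ β) (u : H1 Ω) : 0 ≤ hΩ.form ΓE σ β u u := by
  rw [form_apply, real_inner_self_eq_norm_sq, real_inner_self_eq_norm_sq]
  positivity

/-- The functional `ψ ↦ ∫ g · ∇ψ` on `H¹(Ω)`. -/
noncomputable def fluxDual (Ω : Set (Sp d)) :
    Lp (Sp d) 2 (muOmega Ω) →L[ℝ] StrongDual ℝ (H1 Ω) :=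
  (innerSL ℝ).bilinearComp (ContinuousLinearMap.id ℝ _) (h1gradL Ω)

theorem fluxDual_apply (g : Lp (Sp d) 2 (muOmega Ω)) (ψ : H1 Ω) :
    fluxDual Ω g ψ = inner ℝ g (h1grad ψ) := rfl

/-- Composition with a continuous linear map to a dual space. -/
noncomputable def dualLift {X V S : Type*} [NormedAddCommGroup X] [NormedSpace ℝ X]
    [NormedAddCommGroup V] [NormedSpace ℝ V] [MeasurableSpace S] (ν : Measure S)
    (L : X →L[ℝ] StrongDual ℝ V) : Lp X 2 ν →L[ℝ] Lp (StrongDual ℝ V) 2 ν :=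
  L.compLpL 2 ν

theorem dualLift_ae {X V S : Type*} [NormedAddCommGroup X] [NormedSpace ℝ X]
    [NormedAddCommGroup V] [NormedSpace ℝ V] [MeasurableSpace S] (ν : Measure S)
    (L : X →L[ℝ] StrongDual ℝ V) (z : Lp X 2 ν) : ∀ᵐ t ∂ν, dualLift ν L z t = L (z t) :=
  L.coeFn_compLpL z

/-- The flux `j`, as an element of `L²(0,T; H¹(Ω)*)`. -/
noncomputable def fluxL (Ω : Set (Sp d)) (T : ℝ) :
    Lp (Sp d) 2 (muCyl Ω T) →L[ℝ] Lp (StrongDual ℝ (H1 Ω)) 2 (muTime T) :=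
  (dualLift (muTime T) (fluxDual Ω)).comp sliceL.toContinuousLinearMap

theorem fluxL_apply (Ω : Set (Sp d)) (T : ℝ) (j : Lp (Sp d) 2 (muCyl Ω T)) :
    fluxL Ω T j = dualLift (muTime T) (fluxDual Ω) (sliceL j) := rfl

theorem fluxL_ae (Ω : Set (Sp d)) (T : ℝ) (j : Lp (Sp d) 2 (muCyl Ω T)) :
    ∀ᵐ t ∂(muTime T), fluxL Ω T j t = fluxDual Ω (sliceL j t) := by
  rw [fluxL_apply]
  exact dualLift_ae (muTime T) (fluxDual Ω) (sliceL j)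

variable {T σ β : ℝ} {ΓE : Set (Sp d)}

theorem integral_inner_smul_sub (v ψ : H1 Ω) (g : Lp (Sp d) 2 (muOmega Ω)) {f : Sp d → Sp d}
    (hf : ∀ᵐ x ∂(muOmega Ω), f x = g x) (c : ℝ) :
    ∫ x in Ω, inner ℝ (c • h1grad v x - f x) (h1grad ψ x) =
      c * inner ℝ (h1grad v) (h1grad ψ) - inner ℝ g (h1grad ψ) := by
  rw [← real_inner_smul_left, ← inner_sub_left, L2.inner_def]
  refine integral_congr_ae ?_
  filter_upwards [hf, Lp.coeFn_sub (c • h1grad v) g, Lp.coeFn_smul c (h1grad v)] with x h3 h4 h5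
  rw [h4, Pi.sub_apply, h5, h3, Pi.smul_apply]

theorem weakEquation_slice_iff (hΩ : IsLipschitzDomain Ω) (v : H1 Ω) (v' : StrongDual ℝ (H1 Ω))
    (g : Lp (Sp d) 2 (muOmega Ω)) {f : Sp d → Sp d} (hf : ∀ᵐ x ∂(muOmega Ω), f x = g x) :
    (∀ ψ : H1 Ω, v' ψ + ∫ x in Ω, inner ℝ ((σ ^ 2 / 2) • h1grad v x - f x) (h1grad ψ x) =
      - ∫ x in ΓE, β * trace v x * trace ψ x ∂(surf Ω)) ↔
      v' = fluxDual Ω g - hΩ.form ΓE σ β v := by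
  rw [ContinuousLinearMap.ext_iff]
  refine forall_congr' fun ψ => ?_
  have e1 := integral_inner_smul_sub v ψ g hf (σ ^ 2 / 2)
  have e2 : ∫ x in ΓE, β * trace v x * trace ψ x ∂(surf Ω) =
      β * inner ℝ (hΩ.exitTraceL ΓE v) (hΩ.exitTraceL ΓE ψ) := by
    rw [hΩ.inner_exitTraceL, ← integral_const_mul]
    simp_rw [mul_assoc]
  have e3 : (fluxDual Ω g - hΩ.form ΓE σ β v) ψ =
      inner ℝ g (h1grad ψ) - (σ ^ 2 / 2 * inner ℝ (h1grad v) (h1grad ψ) +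
        β * inner ℝ (hΩ.exitTraceL ΓE v) (hΩ.exitTraceL ΓE ψ)) := rfl
  rw [e2, e3]
  constructor
  · intro h
    linarith [h.symm.trans (congrArg _ e1)]
  · intro h
    rw [h]
    linarith [e1]

theorem satisfiesWeakEquation_iff (hΩ : IsLipschitzDomain Ω) {u : Lp (H1 Ω) 2 (muTime T)}
    {u' : Lp (StrongDual ℝ (H1 Ω)) 2 (muTime T)} {j : Lp (Sp d) 2 (muCyl Ω T)} :
    SatisfiesWeakEquation ΓE T σ β u u' j ↔
      ∀ᵐ t ∂(muTime T), u' t = fluxL Ω T j t - hΩ.form ΓE σ β (u t) := by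
  have key := (fluxL_ae Ω T j).and (isSlice_sliceL j)
  constructor <;> intro h
  · filter_upwards [key, h] with t h1 h2
    rw [h1.1]
    exact (weakEquation_slice_iff hΩ _ _ _ h1.2).1 h2
  · filter_upwards [key, h] with t h1 h2
    rw [h1.1] at h2
    exact (weakEquation_slice_iff hΩ _ _ _ h1.2).2 h2

/-- The constraint takes the abstract form in which j enters through a continuous linear map.
Convexity, closedness and the maximum principle are all read off from here. -/
theorem isAdmissible_iff (hΩ : IsLipschitzDomain Ω) (hT : 0 < T) {ρ₀ : Lp ℝ 2 (muOmega Ω)}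
    {ρ : Lp ℝ 2 (muCyl Ω T)} {j : Lp (Sp d) 2 (muCyl Ω T)} :
    IsAdmissible Ω ΓE T σ β ρ₀ ρ j ↔ ∃ (u : Lp (H1 Ω) 2 (muTime T))
      (u' : Lp (StrongDual ℝ (H1 Ω)) 2 (muTime T)) (w : ℝ → Lp ℝ 2 (muOmega Ω)),
      IsParabolicPath (h1fnL Ω) T u u' w ∧
      (∀ᵐ t ∂(muTime T), u' t = fluxL Ω T j t - hΩ.form ΓE σ β (u t)) ∧ w 0 = ρ₀ ∧
      sliceL ρ = (h1fnL Ω).compLpL 2 (muTime T) u := by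
  have hslice : ∀ u : Lp (H1 Ω) 2 (muTime T), sliceL ρ = (h1fnL Ω).compLpL 2 (muTime T) u ↔
      ∀ᵐ t ∂(muTime T), ∀ᵐ x ∂(muOmega Ω), ρ (x, t) = h1fn (u t) x := fun u => by
    rw [← isSlice_iff]
    constructor <;> intro h
    · filter_upwards [h, (h1fnL Ω).coeFn_compLpL u] with t h1 h2
      filter_upwards [h1] with x h3
      rw [h3, h2, h1fnL_apply]
    · filter_upwards [h, (h1fnL Ω).coeFn_compLpL u] with t h1 h2
      filter_upwards [h1] with x h3
      rw [h3, h2, h1fnL_apply]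
  constructor
  · rintro ⟨u, u', hV, ⟨w, hw, hae, h0⟩, heq⟩
    exact ⟨u, u', w, hV.deriv.isParabolicPath hT hw hae, (satisfiesWeakEquation_iff hΩ).1 heq, h0,
      (hslice u).2 hV.slice⟩
  · rintro ⟨u, u', w, hp, heq, h0, hs⟩
    exact ⟨u, u', ⟨(hslice u).1 hs, hp.isWeakTimeDeriv hT⟩, ⟨w, hp.cont, hp.ae_eq, h0⟩,
      (satisfiesWeakEquation_iff hΩ).2 heq⟩

end Form

end CrowdControl

/-! ### Convexity and semicontinuity of the cost density -/

namespace CrowdControl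

/-- `F` is a concave mobility on `[0, m]`, extended by zero. -/
structure IsConcaveMobility (F : ℝ → ℝ) (m : ℝ) : Prop where
  continuousOn : ContinuousOn F (Icc 0 m)
  nonneg : ∀ r ∈ Icc 0 m, 0 ≤ F r
  zero : ∀ r, r ∉ Icc 0 m → F r = 0
  concave : ConcaveOn ℝ (Icc 0 m) F

section Density

variable {d : ℕ} {F E : ℝ → ℝ} {m : ℝ}

/-- Clearing the denominator treats F = 0 and F > 0 alike. In this form both convexity and lower
semicontinuity become visible. -/
theorem kineticDensity_le_iff {j : Sp d} {r q : ℝ} (hF : 0 ≤ F r) (hq : 0 ≤ q) :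
    kineticDensity F j r ≤ ENNReal.ofReal q ↔ ‖j‖ ^ 2 ≤ q * F r := by
  unfold kineticDensity
  split_ifs with h1 h2
  · simp [h1, h2]
  · rw [h1, mul_zero]
    have : 0 < ‖j‖ ^ 2 := by have := norm_pos_iff.2 h2; positivity
    simp only [top_le_iff, ENNReal.ofReal_ne_top, false_iff, not_le]
    exact this
  · have hp : 0 < F r := lt_of_le_of_ne hF (Ne.symm h1)
    rw [ENNReal.ofReal_le_ofReal_iff hq, div_le_iff₀ hp]

theorem norm_sq_le_of_kineticDensity_ne_top {j : Sp d} {r : ℝ} (hF : 0 ≤ F r)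
    (h : kineticDensity F j r ≠ ⊤) : ‖j‖ ^ 2 ≤ (kineticDensity F j r).toReal * F r :=
  (kineticDensity_le_iff hF ENNReal.toReal_nonneg).1 (ENNReal.ofReal_toReal h).ge

theorem eq_zero_of_kineticDensity_ne_top {j : Sp d} {r : ℝ} (hF : F r = 0)
    (h : kineticDensity F j r ≠ ⊤) : j = 0 := by
  by_contra hj
  exact h (by simp [kineticDensity, hF, hj])

/-- The cross term satisfies 2xy ≤ q₁F₂ + q₂F₁, by the arithmetic–geometric mean inequality. -/
theorem sq_add_le_of_sq_le {x y a b q₁ q₂ F₁ F₂ : ℝ} (ha : 0 ≤ a) (hb : 0 ≤ b) (hq₁ : 0 ≤ q₁)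
    (hq₂ : 0 ≤ q₂) (hF₁ : 0 ≤ F₁) (hF₂ : 0 ≤ F₂) (hx : x ^ 2 ≤ q₁ * F₁)
    (hy : y ^ 2 ≤ q₂ * F₂) : (a * x + b * y) ^ 2 ≤ (a * q₁ + b * q₂) * (a * F₁ + b * F₂) := by
  have h1 : 2 * (x * y) ≤ q₁ * F₂ + q₂ * F₁ := by
    have h2 : (x * y) ^ 2 ≤ (q₁ * F₂) * (q₂ * F₁) := by
      calc (x * y) ^ 2 = x ^ 2 * y ^ 2 := by ring
        _ ≤ (q₁ * F₁) * (q₂ * F₂) := by gcongr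
        _ = _ := by ring
    have h3 : 0 ≤ q₁ * F₂ + q₂ * F₁ := by positivity
    refine le_of_sq_le_sq ?_ h3
    nlinarith [sq_nonneg (q₁ * F₂ - q₂ * F₁)]
  have h4 : 0 ≤ a * b := mul_nonneg ha hb
  nlinarith [mul_le_mul_of_nonneg_left h1 h4, mul_le_mul_of_nonneg_left hx (sq_nonneg a),
    mul_le_mul_of_nonneg_left hy (sq_nonneg b)]

/-- Multiply out the two bounds ‖jᵢ‖² ≤ qᵢF(rᵢ), combine them by `sq_add_le_of_sq_le`, and use
concavity of F in the last factor. -/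
theorem IsConcaveMobility.kineticDensity_convex (hF : IsConcaveMobility F m) {j₁ j₂ : Sp d}
    {r₁ r₂ a b : ℝ} (h₁ : r₁ ∈ Icc 0 m) (h₂ : r₂ ∈ Icc 0 m) (ha : 0 ≤ a) (hb : 0 ≤ b)
    (hab : a + b = 1) : kineticDensity F (a • j₁ + b • j₂) (a * r₁ + b * r₂) ≤
      ENNReal.ofReal a * kineticDensity F j₁ r₁ + ENNReal.ofReal b * kineticDensity F j₂ r₂ := by
  -- Zero weights are removed first, because 0 · ⊤ = 0 would invalidate the argument for infinite
  -- densities.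
  rcases ha.eq_or_lt with rfl | ha'
  · rw [zero_add] at hab; subst hab; simp
  rcases hb.eq_or_lt with rfl | hb'
  · rw [add_zero] at hab; subst hab; simp
  by_cases k₁ : kineticDensity F j₁ r₁ = ⊤
  · rw [k₁, ENNReal.mul_top (by simpa using ha'), top_add]; exact le_top
  by_cases k₂ : kineticDensity F j₂ r₂ = ⊤
  · rw [k₂, ENNReal.mul_top (by simpa using hb'), add_top]; exact le_top
  have hm : a * r₁ + b * r₂ ∈ Icc 0 m := (convex_Icc 0 m) h₁ h₂ ha hb hab
  set q₁ := (kineticDensity F j₁ r₁).toReal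
  set q₂ := (kineticDensity F j₂ r₂).toReal
  have hq₁ : 0 ≤ q₁ := ENNReal.toReal_nonneg
  have hq₂ : 0 ≤ q₂ := ENNReal.toReal_nonneg
  rw [← ENNReal.ofReal_toReal k₁, ← ENNReal.ofReal_toReal k₂, ← ENNReal.ofReal_mul ha,
    ← ENNReal.ofReal_mul hb, ← ENNReal.ofReal_add (mul_nonneg ha hq₁) (mul_nonneg hb hq₂),
    kineticDensity_le_iff (hF.nonneg _ hm) (by positivity)]
  have n1 := norm_sq_le_of_kineticDensity_ne_top (hF.nonneg _ h₁) k₁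
  have n2 := norm_sq_le_of_kineticDensity_ne_top (hF.nonneg _ h₂) k₂
  have n3 : ‖a • j₁ + b • j₂‖ ≤ a * ‖j₁‖ + b * ‖j₂‖ := by
    refine (norm_add_le _ _).trans (le_of_eq ?_)
    rw [norm_smul, norm_smul, Real.norm_of_nonneg ha, Real.norm_of_nonneg hb]
  have hc : a * F r₁ + b * F r₂ ≤ F (a * r₁ + b * r₂) := hF.concave.2 h₁ h₂ ha hb hab
  calc ‖a • j₁ + b • j₂‖ ^ 2 ≤ (a * ‖j₁‖ + b * ‖j₂‖) ^ 2 := by gcongr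
    _ ≤ (a * q₁ + b * q₂) * (a * F r₁ + b * F r₂) :=
      sq_add_le_of_sq_le ha hb hq₁ hq₂ (hF.nonneg _ h₁) (hF.nonneg _ h₂) n1 n2
    _ ≤ (a * q₁ + b * q₂) * F (a * r₁ + b * r₂) := by gcongr

theorem IsConcaveMobility.measurable (hF : IsConcaveMobility F m) : Measurable F := by
  classical
  have h : F = (Icc 0 m).piecewise F 0 := by
    ext1 r
    by_cases hr : r ∈ Icc 0 m
    · rw [piecewise_eq_of_mem _ _ _ hr]
    · rw [piecewise_eq_of_notMem _ _ _ hr, hF.zero r hr]; rfl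
  rw [h]
  exact hF.continuousOn.measurable_piecewise continuousOn_const measurableSet_Icc

theorem IsConcaveMobility.measurable_kineticDensity (hF : IsConcaveMobility F m) :
    Measurable fun p : Sp d × ℝ => kineticDensity F p.1 p.2 := by
  have h1 : Measurable fun p : Sp d × ℝ => F p.2 := hF.measurable.comp measurable_snd
  refine Measurable.ite (h1 (measurableSet_singleton 0)) (Measurable.ite
    (measurable_fst (measurableSet_singleton 0)) measurable_const measurable_const) ?_
  exact ((measurable_fst.norm.pow_const 2).div h1).ennreal_ofReal

/-- The density of the cost functional, for `E ≥ 0`. -/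
noncomputable def costDensity (F E : ℝ → ℝ) (j : Sp d) (r : ℝ) : ℝ≥0∞ :=
  2⁻¹ * kineticDensity F j r + ENNReal.ofReal (1 / 2 * E r)

theorem IsConcaveMobility.measurable_costDensity (hF : IsConcaveMobility F m) (hE : Continuous E) :
    Measurable fun p : Sp d × ℝ => costDensity F E p.1 p.2 :=
  (hF.measurable_kineticDensity.const_mul _).add
    ((hE.measurable.comp measurable_snd).const_mul _).ennreal_ofReal

theorem ofReal_mul_half_add_le (hEc : ConvexOn ℝ (Icc 0 m) E) (hE0 : ∀ r ∈ Icc 0 m, 0 ≤ E r)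
    {r₁ r₂ a b : ℝ} (h₁ : r₁ ∈ Icc 0 m) (h₂ : r₂ ∈ Icc 0 m) (ha : 0 ≤ a) (hb : 0 ≤ b)
    (hab : a + b = 1) : ENNReal.ofReal (1 / 2 * E (a * r₁ + b * r₂)) ≤
      ENNReal.ofReal a * ENNReal.ofReal (1 / 2 * E r₁) +
        ENNReal.ofReal b * ENNReal.ofReal (1 / 2 * E r₂) := by
  have e1 := hE0 _ h₁
  have e2 := hE0 _ h₂
  rw [← ENNReal.ofReal_mul ha, ← ENNReal.ofReal_mul hb,
    ← ENNReal.ofReal_add (by positivity) (by positivity)]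
  refine ENNReal.ofReal_le_ofReal ?_
  have := hEc.2 h₁ h₂ ha hb hab
  simp only [smul_eq_mul] at this
  linarith

theorem IsConcaveMobility.costDensity_convex (hF : IsConcaveMobility F m)
    (hEc : ConvexOn ℝ (Icc 0 m) E) (hE0 : ∀ r ∈ Icc 0 m, 0 ≤ E r) {j₁ j₂ : Sp d}
    {r₁ r₂ a b : ℝ} (h₁ : r₁ ∈ Icc 0 m) (h₂ : r₂ ∈ Icc 0 m) (ha : 0 ≤ a) (hb : 0 ≤ b)
    (hab : a + b = 1) : costDensity F E (a • j₁ + b • j₂) (a * r₁ + b * r₂) ≤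
      ENNReal.ofReal a * costDensity F E j₁ r₁ + ENNReal.ofReal b * costDensity F E j₂ r₂ := by
  unfold costDensity
  calc _ ≤ 2⁻¹ * (ENNReal.ofReal a * kineticDensity F j₁ r₁ +
        ENNReal.ofReal b * kineticDensity F j₂ r₂) +
        (ENNReal.ofReal a * ENNReal.ofReal (1 / 2 * E r₁) +
          ENNReal.ofReal b * ENNReal.ofReal (1 / 2 * E r₂)) :=
      add_le_add (mul_le_mul' le_rfl (hF.kineticDensity_convex h₁ h₂ ha hb hab))
        (ofReal_mul_half_add_le hEc hE0 h₁ h₂ ha hb hab)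
    _ = _ := by ring

theorem costDensity_le_iff {j : Sp d} {r c : ℝ} (hF : 0 ≤ F r) (hE : 0 ≤ E r) (hc : 0 ≤ c) :
    costDensity F E j r ≤ ENNReal.ofReal c ↔
      E r ≤ 2 * c ∧ ‖j‖ ^ 2 ≤ (2 * c - E r) * F r := by
  unfold costDensity
  have key : E r ≤ 2 * c → (2⁻¹ * kineticDensity F j r ≤
      ENNReal.ofReal (c - 1 / 2 * E r) ↔ ‖j‖ ^ 2 ≤ (2 * c - E r) * F r) := fun h => by
    rw [ENNReal.inv_mul_le_iff two_ne_zero ENNReal.ofNat_ne_top,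
      ← kineticDensity_le_iff hF (by linarith)]
    rw [show (2 : ℝ≥0∞) = ENNReal.ofReal 2 by simp, ← ENNReal.ofReal_mul zero_le_two,
      show 2 * (c - 1 / 2 * E r) = 2 * c - E r by ring]
  constructor
  · intro h
    have h1 : E r ≤ 2 * c := by
      have := (ENNReal.ofReal_le_ofReal_iff hc).1 (le_trans le_add_self h)
      linarith
    refine ⟨h1, (key h1).1 ?_⟩
    rw [ENNReal.ofReal_sub _ (by positivity)]
    exact ENNReal.le_sub_of_add_le_right ENNReal.ofReal_ne_top h
  · rintro ⟨h1, h2⟩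
    calc _ ≤ ENNReal.ofReal (c - 1 / 2 * E r) + ENNReal.ofReal (1 / 2 * E r) :=
          add_le_add ((key h1).2 h2) le_rfl
      _ = ENNReal.ofReal c := by
          rw [← ENNReal.ofReal_add (by linarith) (by positivity)]
          congr 1; ring

/-- By `costDensity_le_iff` a sublevel is given by weak inequalities between continuous functions of
(j, r) with r in [0,m], so it is closed, including at points where F vanishes. -/
theorem IsConcaveMobility.costDensity_le_liminf (hF : IsConcaveMobility F m) (hE : Continuous E)
    (hE0 : ∀ r ∈ Icc 0 m, 0 ≤ E r) {j : ℕ → Sp d} {r : ℕ → ℝ} {j₀ : Sp d} {r₀ : ℝ}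
    (hj : Tendsto j atTop (𝓝 j₀)) (hr : Tendsto r atTop (𝓝 r₀)) (hm : ∀ n, r n ∈ Icc 0 m) :
    costDensity F E j₀ r₀ ≤ liminf (fun n => costDensity F E (j n) (r n)) atTop := by
  have hm₀ : r₀ ∈ Icc 0 m := isClosed_Icc.mem_of_tendsto hr (.of_forall hm)
  refine le_of_forall_gt_imp_ge_of_dense fun c hc => ?_
  rcases eq_or_ne c ⊤ with rfl | hct
  · exact le_top
  have hfr := frequently_lt_of_liminf_lt (by isBoundedDefault) hc
  have hFr : Tendsto (fun n => F (r n)) atTop (𝓝 (F r₀)) :=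
    (hF.continuousOn r₀ hm₀).tendsto.comp
      (tendsto_nhdsWithin_of_tendsto_nhds_of_eventually_within _ hr (.of_forall hm))
  have hEr : Tendsto (fun n => E (r n)) atTop (𝓝 (E r₀)) := (hE.tendsto r₀).comp hr
  have hfr2 : ∃ᶠ n in atTop, E (r n) ≤ 2 * c.toReal ∧
      ‖j n‖ ^ 2 ≤ (2 * c.toReal - E (r n)) * F (r n) := hfr.mono fun n hn => by
    rw [← ENNReal.ofReal_toReal hct] at hn
    exact (costDensity_le_iff (hF.nonneg _ (hm n)) (hE0 _ (hm n)) ENNReal.toReal_nonneg).1 hn.le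
  rw [← ENNReal.ofReal_toReal hct, costDensity_le_iff (hF.nonneg _ hm₀) (hE0 _ hm₀)
    ENNReal.toReal_nonneg]
  refine ⟨le_of_tendsto_of_frequently hEr (hfr2.mono fun n hn => hn.1), ?_⟩
  have ht : Tendsto (fun n => ‖j n‖ ^ 2 - (2 * c.toReal - E (r n)) * F (r n)) atTop
      (𝓝 (‖j₀‖ ^ 2 - (2 * c.toReal - E r₀) * F r₀)) :=
    (hj.norm.pow 2).sub ((tendsto_const_nhds.sub hEr).mul hFr)
  have := le_of_tendsto_of_frequently (b := 0) ht (hfr2.mono fun n hn => by linarith [hn.2])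
  linarith

/-- Both summands are convex and finite, so equality holds in each. Strict convexity of E gives r₁ =
r₂; the parallelogram law gives j₁ = j₂ where F > 0, and finiteness makes both fluxes zero where F =
0. -/
theorem IsConcaveMobility.eq_of_costDensity_midpoint (hF : IsConcaveMobility F m)
    (hEs : StrictConvexOn ℝ (Icc 0 m) E) (hE0 : ∀ r ∈ Icc 0 m, 0 ≤ E r) {j₁ j₂ : Sp d}
    {r₁ r₂ : ℝ} (h₁ : r₁ ∈ Icc 0 m) (h₂ : r₂ ∈ Icc 0 m)
    (hfin₁ : costDensity F E j₁ r₁ ≠ ⊤) (hfin₂ : costDensity F E j₂ r₂ ≠ ⊤)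
    (h : costDensity F E ((1 / 2 : ℝ) • j₁ + (1 / 2 : ℝ) • j₂) (1 / 2 * r₁ + 1 / 2 * r₂) =
      ENNReal.ofReal (1 / 2) * costDensity F E j₁ r₁ +
        ENNReal.ofReal (1 / 2) * costDensity F E j₂ r₂) : r₁ = r₂ ∧ j₁ = j₂ := by
  have hh : (0 : ℝ) ≤ 1 / 2 := by norm_num
  have hs : (1 / 2 : ℝ) + 1 / 2 = 1 := by norm_num
  have hk := hF.kineticDensity_convex (j₁ := j₁) (j₂ := j₂) h₁ h₂ hh hh hs
  have he := ofReal_mul_half_add_le hEs.convexOn hE0 h₁ h₂ hh hh hs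
  have k₁ : kineticDensity F j₁ r₁ ≠ ⊤ := fun hk => hfin₁ (by
    simp [costDensity, hk, ENNReal.mul_top])
  have k₂ : kineticDensity F j₂ r₂ ≠ ⊤ := fun hk => hfin₂ (by
    simp [costDensity, hk, ENNReal.mul_top])
  have hkf : ENNReal.ofReal (1 / 2) * kineticDensity F j₁ r₁ +
      ENNReal.ofReal (1 / 2) * kineticDensity F j₂ r₂ ≠ ⊤ :=
    ENNReal.add_ne_top.2 ⟨ENNReal.mul_ne_top (by simp) k₁, ENNReal.mul_ne_top (by simp) k₂⟩
  have hkm := ne_top_of_le_ne_top hkf hk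
  have hsum : 2⁻¹ * kineticDensity F ((1 / 2 : ℝ) • j₁ + (1 / 2 : ℝ) • j₂)
        (1 / 2 * r₁ + 1 / 2 * r₂) + ENNReal.ofReal (1 / 2 * E (1 / 2 * r₁ + 1 / 2 * r₂)) =
      2⁻¹ * (ENNReal.ofReal (1 / 2) * kineticDensity F j₁ r₁ +
        ENNReal.ofReal (1 / 2) * kineticDensity F j₂ r₂) +
      (ENNReal.ofReal (1 / 2) * ENNReal.ofReal (1 / 2 * E r₁) +
        ENNReal.ofReal (1 / 2) * ENNReal.ofReal (1 / 2 * E r₂)) := by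
    refine Eq.trans h ?_
    unfold costDensity
    ring
  have hhalf : (2⁻¹ : ℝ≥0∞) ≠ ⊤ := by simp
  have hk' := mul_le_mul' (le_refl (2⁻¹ : ℝ≥0∞)) hk
  have heq_e : ENNReal.ofReal (1 / 2 * E (1 / 2 * r₁ + 1 / 2 * r₂)) =
      ENNReal.ofReal (1 / 2) * ENNReal.ofReal (1 / 2 * E r₁) +
        ENNReal.ofReal (1 / 2) * ENNReal.ofReal (1 / 2 * E r₂) := by
    refine le_antisymm he ?_
    by_contra hlt
    rw [not_le] at hlt
    have := ENNReal.add_lt_add_of_le_of_lt (ENNReal.mul_ne_top hhalf hkm) hk' hlt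
    exact this.ne hsum
  have hr : r₁ = r₂ := by
    by_contra hne
    have hlt := hEs.2 h₁ h₂ hne one_half_pos one_half_pos hs
    simp only [smul_eq_mul] at hlt
    have e1 := hE0 _ h₁
    have e2 := hE0 _ h₂
    rw [← ENNReal.ofReal_mul hh, ← ENNReal.ofReal_mul hh,
      ← ENNReal.ofReal_add (by positivity) (by positivity)] at heq_e
    have hm : 1 / 2 * r₁ + 1 / 2 * r₂ ∈ Icc 0 m := (convex_Icc 0 m) h₁ h₂ hh hh hs
    have e3 := hE0 _ hm
    rw [ENNReal.ofReal_eq_ofReal_iff (by positivity) (by positivity)] at heq_e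
    linarith
  refine ⟨hr, ?_⟩
  subst hr
  have hrr : 1 / 2 * r₁ + 1 / 2 * r₁ = r₁ := by ring
  rw [← heq_e, hrr] at hsum
  have hk_eq := (ENNReal.add_left_inj ENNReal.ofReal_ne_top).1 hsum
  have hk_eq2 := (ENNReal.mul_right_inj (by simp) hhalf).1 hk_eq
  by_cases hF0 : F r₁ = 0
  · rw [eq_zero_of_kineticDensity_ne_top hF0 k₁, eq_zero_of_kineticDensity_ne_top hF0 k₂]
  · have hFp : 0 < F r₁ := lt_of_le_of_ne (hF.nonneg _ h₁) (Ne.symm hF0)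
    simp only [kineticDensity, if_neg hF0] at hk_eq2
    rw [← ENNReal.ofReal_mul hh, ← ENNReal.ofReal_mul hh,
      ← ENNReal.ofReal_add (by positivity) (by positivity),
      ENNReal.ofReal_eq_ofReal_iff (by positivity) (by positivity)] at hk_eq2
    have hpar := parallelogram_law_with_norm ℝ j₁ j₂
    rw [← smul_add, norm_smul, Real.norm_of_nonneg hh] at hk_eq2
    field_simp at hk_eq2
    have : ‖j₁ - j₂‖ * ‖j₁ - j₂‖ = 0 := by nlinarith
    exact sub_eq_zero.1 (norm_eq_zero.1 (mul_self_eq_zero.1 this))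

end Density

end CrowdControl

/-! ### The cost functional -/

namespace CrowdControl

section TotalCost

variable {d : ℕ} {F E : ℝ → ℝ} {m : ℝ} {Z : Type*} [MeasurableSpace Z] {μ : Measure Z}

/-- The cost functional, for `E ≥ 0` along `ρ`. -/
noncomputable def totalCost (F E : ℝ → ℝ) (ρ : Lp ℝ 2 μ) (j : Lp (Sp d) 2 μ) : ℝ≥0∞ :=
  ∫⁻ z, costDensity F E (j z) (ρ z) ∂μ

theorem IsConcaveMobility.aemeasurable_costDensity (hF : IsConcaveMobility F m)
    (hE : Continuous E) (ρ : Lp ℝ 2 μ) (j : Lp (Sp d) 2 μ) :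
    AEMeasurable (fun z => costDensity F E (j z) (ρ z)) μ :=
  (hF.measurable_costDensity hE).comp_aemeasurable
    ((Lp.aestronglyMeasurable j).aemeasurable.prodMk (Lp.aestronglyMeasurable ρ).aemeasurable)

theorem coeFn_smul_add_smul {G : Type*} [NormedAddCommGroup G] [NormedSpace ℝ G] (a b : ℝ)
    (f g : Lp G 2 μ) : ∀ᵐ z ∂μ, (a • f + b • g) z = a • f z + b • g z := by
  filter_upwards [Lp.coeFn_add (a • f) (b • g), Lp.coeFn_smul a f, Lp.coeFn_smul b g]
    with z h1 h2 h3
  rw [h1, Pi.add_apply, h2, h3, Pi.smul_apply, Pi.smul_apply]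

theorem ae_mem_Icc_smul_add_smul {ρ₁ ρ₂ : Lp ℝ 2 μ} (h₁ : ∀ᵐ z ∂μ, ρ₁ z ∈ Icc 0 m)
    (h₂ : ∀ᵐ z ∂μ, ρ₂ z ∈ Icc 0 m) {a b : ℝ} (ha : 0 ≤ a) (hb : 0 ≤ b) (hab : a + b = 1) :
    ∀ᵐ z ∂μ, (a • ρ₁ + b • ρ₂) z ∈ Icc 0 m := by
  filter_upwards [h₁, h₂, coeFn_smul_add_smul a b ρ₁ ρ₂] with z k1 k2 k3
  rw [k3]
  exact (convex_Icc 0 m) k1 k2 ha hb hab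

theorem IsConcaveMobility.costDensity_smul_add_smul_le (hF : IsConcaveMobility F m)
    (hEc : ConvexOn ℝ (Icc 0 m) E) (hE0 : ∀ r ∈ Icc 0 m, 0 ≤ E r) {ρ₁ ρ₂ : Lp ℝ 2 μ}
    {j₁ j₂ : Lp (Sp d) 2 μ} (h₁ : ∀ᵐ z ∂μ, ρ₁ z ∈ Icc 0 m) (h₂ : ∀ᵐ z ∂μ, ρ₂ z ∈ Icc 0 m)
    {a b : ℝ} (ha : 0 ≤ a) (hb : 0 ≤ b) (hab : a + b = 1) :
    ∀ᵐ z ∂μ, costDensity F E ((a • j₁ + b • j₂) z) ((a • ρ₁ + b • ρ₂) z) ≤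
      ENNReal.ofReal a * costDensity F E (j₁ z) (ρ₁ z) +
        ENNReal.ofReal b * costDensity F E (j₂ z) (ρ₂ z) := by
  filter_upwards [h₁, h₂, coeFn_smul_add_smul a b ρ₁ ρ₂, coeFn_smul_add_smul a b j₁ j₂]
    with z k1 k2 k3 k4
  rw [k3, k4]
  exact hF.costDensity_convex hEc hE0 k1 k2 ha hb hab

theorem IsConcaveMobility.lintegral_costDensity_combination (hF : IsConcaveMobility F m)
    (hE : Continuous E) (ρ₁ ρ₂ : Lp ℝ 2 μ) (j₁ j₂ : Lp (Sp d) 2 μ) (a b : ℝ) :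
    ∫⁻ z, (ENNReal.ofReal a * costDensity F E (j₁ z) (ρ₁ z) +
        ENNReal.ofReal b * costDensity F E (j₂ z) (ρ₂ z)) ∂μ =
      ENNReal.ofReal a * totalCost F E ρ₁ j₁ + ENNReal.ofReal b * totalCost F E ρ₂ j₂ := by
  rw [lintegral_add_left' ((hF.aemeasurable_costDensity hE ρ₁ j₁).const_mul _),
    lintegral_const_mul' _ _ ENNReal.ofReal_ne_top, lintegral_const_mul' _ _ ENNReal.ofReal_ne_top]
  rfl

theorem IsConcaveMobility.totalCost_convex (hF : IsConcaveMobility F m) (hE : Continuous E)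
    (hEc : ConvexOn ℝ (Icc 0 m) E) (hE0 : ∀ r ∈ Icc 0 m, 0 ≤ E r) {ρ₁ ρ₂ : Lp ℝ 2 μ}
    {j₁ j₂ : Lp (Sp d) 2 μ} (h₁ : ∀ᵐ z ∂μ, ρ₁ z ∈ Icc 0 m) (h₂ : ∀ᵐ z ∂μ, ρ₂ z ∈ Icc 0 m)
    {a b : ℝ} (ha : 0 ≤ a) (hb : 0 ≤ b) (hab : a + b = 1) :
    totalCost F E (a • ρ₁ + b • ρ₂) (a • j₁ + b • j₂) ≤
      ENNReal.ofReal a * totalCost F E ρ₁ j₁ + ENNReal.ofReal b * totalCost F E ρ₂ j₂ := by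
  rw [← hF.lintegral_costDensity_combination hE]
  exact lintegral_mono_ae (hF.costDensity_smul_add_smul_le hEc hE0 h₁ h₂ ha hb hab)

/-- A pointwise inequality between functions with equal finite integrals is an equality a.e., which
reduces the claim to the densities. -/
theorem IsConcaveMobility.eq_of_totalCost_midpoint (hF : IsConcaveMobility F m)
    (hE : Continuous E) (hEs : StrictConvexOn ℝ (Icc 0 m) E) (hE0 : ∀ r ∈ Icc 0 m, 0 ≤ E r)
    {ρ₁ ρ₂ : Lp ℝ 2 μ} {j₁ j₂ : Lp (Sp d) 2 μ} (h₁ : ∀ᵐ z ∂μ, ρ₁ z ∈ Icc 0 m)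
    (h₂ : ∀ᵐ z ∂μ, ρ₂ z ∈ Icc 0 m) (hf₁ : totalCost F E ρ₁ j₁ ≠ ⊤)
    (heq : totalCost F E ρ₁ j₁ = totalCost F E ρ₂ j₂)
    (hle : totalCost F E ρ₁ j₁ ≤
      totalCost F E ((1 / 2 : ℝ) • ρ₁ + (1 / 2 : ℝ) • ρ₂) ((1 / 2 : ℝ) • j₁ + (1 / 2 : ℝ) • j₂)) :
    ρ₁ = ρ₂ ∧ j₁ = j₂ := by
  have hh : (0 : ℝ) ≤ 1 / 2 := by norm_num
  have hs : (1 / 2 : ℝ) + 1 / 2 = 1 := by norm_num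
  have hf₂ : totalCost F E ρ₂ j₂ ≠ ⊤ := heq ▸ hf₁
  have hsum : ENNReal.ofReal (1 / 2) * totalCost F E ρ₁ j₁ +
      ENNReal.ofReal (1 / 2) * totalCost F E ρ₂ j₂ = totalCost F E ρ₁ j₁ := by
    rw [← heq, ← add_mul, ← ENNReal.ofReal_add hh hh, hs, ENNReal.ofReal_one, one_mul]
  have hae := hF.costDensity_smul_add_smul_le (j₁ := j₁) (j₂ := j₂) hEs.convexOn hE0 h₁ h₂ hh hh hs
  have hmid := hF.totalCost_convex (j₁ := j₁) (j₂ := j₂) hE hEs.convexOn hE0 h₁ h₂ hh hh hs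
  rw [hsum] at hmid
  have heq_ae := ae_eq_of_ae_le_of_lintegral_le hae (ne_top_of_le_ne_top hf₁ hmid)
    (((hF.aemeasurable_costDensity hE ρ₁ j₁).const_mul _).add
      ((hF.aemeasurable_costDensity hE ρ₂ j₂).const_mul _))
    (by rw [hF.lintegral_costDensity_combination hE, hsum]; exact hle)
  have t₁ := ae_lt_top' (hF.aemeasurable_costDensity hE ρ₁ j₁) hf₁
  have t₂ := ae_lt_top' (hF.aemeasurable_costDensity hE ρ₂ j₂) hf₂
  have key : ∀ᵐ z ∂μ, ρ₁ z = ρ₂ z ∧ j₁ z = j₂ z := by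
    filter_upwards [heq_ae, t₁, t₂, h₁, h₂, coeFn_smul_add_smul (1 / 2 : ℝ) (1 / 2 : ℝ) ρ₁ ρ₂,
      coeFn_smul_add_smul (1 / 2 : ℝ) (1 / 2 : ℝ) j₁ j₂] with z k1 k2 k3 k4 k5 k6 k7
    rw [k6, k7] at k1
    exact hF.eq_of_costDensity_midpoint hEs hE0 k4 k5 k2.ne k3.ne k1
  exact ⟨Lp.ext (key.mono fun z h => h.1), Lp.ext (key.mono fun z h => h.2)⟩

/-- Fatou's lemma along a subsequence on which both ρ and j converge a.e. -/
theorem IsConcaveMobility.totalCost_le_of_tendsto (hF : IsConcaveMobility F m) (hE : Continuous E)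
    (hE0 : ∀ r ∈ Icc 0 m, 0 ≤ E r) {ρ : ℕ → Lp ℝ 2 μ} {j : ℕ → Lp (Sp d) 2 μ} {ρ₀ : Lp ℝ 2 μ}
    {j₀ : Lp (Sp d) 2 μ} (hρ : Tendsto ρ atTop (𝓝 ρ₀)) (hj : Tendsto j atTop (𝓝 j₀))
    (hm : ∀ n, ∀ᵐ z ∂μ, ρ n z ∈ Icc 0 m) {c : ℝ≥0∞} (hc : ∀ n, totalCost F E (ρ n) (j n) ≤ c) :
    (∀ᵐ z ∂μ, ρ₀ z ∈ Icc 0 m) ∧ totalCost F E ρ₀ j₀ ≤ c := by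
  obtain ⟨ns, hns, hae⟩ := (tendstoInMeasure_of_tendsto_Lp hρ).exists_seq_tendsto_ae
  obtain ⟨ms, hms, hae2⟩ :=
    (tendstoInMeasure_of_tendsto_Lp (hj.comp hns.tendsto_atTop)).exists_seq_tendsto_ae
  have hall := ae_all_iff.2 hm
  constructor
  · filter_upwards [hae, hall] with z h1 h2
    exact isClosed_Icc.mem_of_tendsto h1 (.of_forall fun n => h2 _)
  · calc totalCost F E ρ₀ j₀ ≤ ∫⁻ z, liminf (fun n =>
          costDensity F E (j (ns (ms n)) z) (ρ (ns (ms n)) z)) atTop ∂μ := by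
          refine lintegral_mono_ae ?_
          filter_upwards [hae, hae2, hall] with z h1 h2 h3
          exact hF.costDensity_le_liminf hE hE0 h2 (h1.comp hms.tendsto_atTop) fun n => h3 _
      _ ≤ liminf (fun n => ∫⁻ z,
          costDensity F E (j (ns (ms n)) z) (ρ (ns (ms n)) z) ∂μ) atTop :=
          lintegral_liminf_le' fun n => hF.aemeasurable_costDensity hE _ _
      _ ≤ c := by
          refine (liminf_le_liminf (.of_forall fun n => hc (ns (ms n)))).trans ?_
          rw [liminf_const]

/-- Boundedness of the mobility is what makes the cost coercive in the flux. -/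
theorem IsConcaveMobility.enorm_sq_le (hF : IsConcaveMobility F m) {C : ℝ} (hC0 : 0 < C)
    (hC : ∀ r, |F r| ≤ C) {j : Sp d} {r : ℝ} (hr : r ∈ Icc 0 m) :
    ‖j‖ₑ ^ 2 ≤ ENNReal.ofReal (2 * C) * costDensity F E j r := by
  have h1 : ‖j‖ₑ ^ 2 ≤ ENNReal.ofReal C * kineticDensity F j r := by
    by_cases hk : kineticDensity F j r = ⊤
    · rw [hk, ENNReal.mul_top (by simpa using hC0)]; exact le_top
    · have h2 := norm_sq_le_of_kineticDensity_ne_top (hF.nonneg _ hr) hk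
      have h3 : ‖j‖ ^ 2 ≤ C * (kineticDensity F j r).toReal := by
        refine h2.trans ?_
        rw [mul_comm]
        exact mul_le_mul_of_nonneg_right ((le_abs_self _).trans (hC r)) ENNReal.toReal_nonneg
      rw [← ENNReal.ofReal_toReal hk, ← ENNReal.ofReal_mul hC0.le, ← ofReal_norm,
        ← ENNReal.ofReal_pow (norm_nonneg _)]
      exact ENNReal.ofReal_le_ofReal h3
  refine h1.trans ?_
  rw [mul_comm 2 C, ENNReal.ofReal_mul hC0.le, mul_assoc]
  refine mul_le_mul' le_rfl ?_
  unfold costDensity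
  rw [mul_add, ← mul_assoc, ENNReal.ofReal_ofNat, ENNReal.mul_inv_cancel two_ne_zero
    ENNReal.ofNat_ne_top, one_mul]
  exact le_self_add

theorem IsConcaveMobility.norm_sq_le_of_totalCost_le (hF : IsConcaveMobility F m) {C : ℝ}
    (hC0 : 0 < C) (hC : ∀ r, |F r| ≤ C) {ρ : Lp ℝ 2 μ} {j : Lp (Sp d) 2 μ}
    (hρ : ∀ᵐ z ∂μ, ρ z ∈ Icc 0 m) {c : ℝ} (hc0 : 0 ≤ c)
    (hc : totalCost F E ρ j ≤ ENNReal.ofReal c) : ‖j‖ ^ 2 ≤ 2 * C * c := by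
  have h1 : eLpNorm j 2 μ ^ 2 ≤ ENNReal.ofReal (2 * C * c) := by
    rw [sq_eLpNorm_two, ENNReal.ofReal_mul (by positivity)]
    calc ∫⁻ z, ‖j z‖ₑ ^ 2 ∂μ
        ≤ ∫⁻ z, ENNReal.ofReal (2 * C) * costDensity F E (j z) (ρ z) ∂μ := by
          refine lintegral_mono_ae ?_
          filter_upwards [hρ] with z hz using hF.enorm_sq_le hC0 hC hz
      _ = ENNReal.ofReal (2 * C) * totalCost F E ρ j :=
          lintegral_const_mul' _ _ ENNReal.ofReal_ne_top
      _ ≤ _ := mul_le_mul' le_rfl hc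
  rw [Lp.norm_def, ← ENNReal.toReal_pow]
  exact ENNReal.toReal_le_of_le_ofReal (by positivity) h1

end TotalCost

section Cost

variable {d : ℕ} {F E : ℝ → ℝ} {m T : ℝ} {Ω : Set (Sp d)}

theorem cost_eq_totalCost (hE : Continuous E) (hE0 : ∀ r ∈ Icc 0 m, 0 ≤ E r)
    {ρ : Lp ℝ 2 (muCyl Ω T)} {j : Lp (Sp d) 2 (muCyl Ω T)}
    (hρ : ∀ᵐ z ∂(muCyl Ω T), ρ z ∈ Icc 0 m) :
    cost Ω T F E ρ j = (totalCost F E ρ j : EReal) := by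
  have h1 : ∫⁻ z, ENNReal.ofReal (-(1 / 2 * E (ρ z))) ∂(muCyl Ω T) = 0 := by
    rw [lintegral_eq_zero_of_ae_eq_zero]
    filter_upwards [hρ] with z hz
    have := hE0 _ hz
    exact ENNReal.ofReal_of_nonpos (by linarith)
  have h2 : AEMeasurable (fun z => ENNReal.ofReal (1 / 2 * E (ρ z))) (muCyl Ω T) :=
    ((hE.comp_aestronglyMeasurable (Lp.aestronglyMeasurable ρ)).aemeasurable.const_mul
      _).ennreal_ofReal
  unfold cost extIntegral totalCost costDensity
  rw [h1, lintegral_add_right' _ h2, EReal.coe_ennreal_add]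
  simp

/-- A convex function lies above its tangent at 0, and E(0) ≥ 0 removes the constant. The linear
bound makes the negative part of E(ρ) integrable on a bounded cylinder. -/
theorem neg_abs_deriv_mul_le (hE : ContDiff ℝ 1 E) (hEc : ConvexOn ℝ univ E) (h0 : 0 ≤ E 0)
    (r : ℝ) : -E r ≤ |deriv E 0| * |r| := by
  have hd : DifferentiableAt ℝ E 0 := hE.differentiable one_ne_zero 0
  have key : E 0 + deriv E 0 * r ≤ E r := by
    rcases lt_trichotomy r 0 with h | rfl | h
    · have := hEc.slope_le_deriv (mem_univ r) (mem_univ 0) h hd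
      rw [slope_def_field, div_le_iff₀ (by linarith)] at this
      linarith
    · simp
    · have := hEc.deriv_le_slope (mem_univ 0) (mem_univ r) h hd
      rw [slope_def_field, le_div_iff₀ (by linarith)] at this
      linarith
  have h2 : -(deriv E 0 * r) ≤ |deriv E 0| * |r| := by
    rw [← abs_mul]; exact neg_le_abs _
  linarith

theorem ae_eq_zero_of_cost_lt_top [IsFiniteMeasure (muCyl Ω T)] (hF : IsConcaveMobility F m)
    (hE : ContDiff ℝ 1 E) (hEc : ConvexOn ℝ univ E) (h0 : 0 ≤ E 0)
    {ρ : Lp ℝ 2 (muCyl Ω T)} {j : Lp (Sp d) 2 (muCyl Ω T)} (h : cost Ω T F E ρ j < ⊤) :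
    ∀ᵐ z ∂(muCyl Ω T), F (ρ z) = 0 → j z = 0 := by
  -- Without this the cost could be ⊤ + ⊥ = ⊥ in `EReal`, and a cost below ⊤ would say nothing about
  -- the kinetic part.
  have hN : ∫⁻ z, ENNReal.ofReal (-(1 / 2 * E (ρ z))) ∂(muCyl Ω T) ≠ ⊤ := by
    have hi : Integrable (fun z => |deriv E 0| * |ρ z|) (muCyl Ω T) :=
      (((Lp.memLp ρ).integrable (by norm_num)).abs).const_mul _
    have h1 : ∫⁻ z, ENNReal.ofReal (|deriv E 0| * |ρ z|) ∂(muCyl Ω T) ≠ ⊤ :=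
      hi.lintegral_lt_top.ne
    refine ne_top_of_le_ne_top h1 (lintegral_mono fun z => ENNReal.ofReal_le_ofReal ?_)
    have := neg_abs_deriv_mul_le hE hEc h0 (ρ z)
    have h3 : 0 ≤ |deriv E 0| * |ρ z| := by positivity
    linarith
  have hK : ∫⁻ z, 2⁻¹ * kineticDensity F (j z) (ρ z) ∂(muCyl Ω T) ≠ ⊤ := by
    intro hK
    unfold cost extIntegral at h
    rw [hK] at h
    refine h.ne (EReal.top_add_of_ne_bot ?_)
    lift ∫⁻ z, ENNReal.ofReal (-(1 / 2 * E (ρ z))) ∂(muCyl Ω T) to ℝ≥0 using hN with N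
    rw [sub_eq_add_neg]
    exact EReal.add_ne_bot_iff.2 ⟨by simp, by simp⟩
  have hm : AEMeasurable (fun z => 2⁻¹ * kineticDensity F (j z) (ρ z)) (muCyl Ω T) :=
    (hF.measurable_kineticDensity.comp_aemeasurable
      ((Lp.aestronglyMeasurable j).aemeasurable.prodMk
        (Lp.aestronglyMeasurable ρ).aemeasurable)).const_mul _
  filter_upwards [ae_lt_top' hm hK] with z hz hFz
  refine eq_zero_of_kineticDensity_ne_top hFz fun hk => ?_
  rw [hk, ENNReal.mul_top (by simp)] at hz
  exact hz.ne rfl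

end Cost

end CrowdControl

/-! ### The maximum principle -/

namespace CrowdControl

theorem exists_abs_deriv_smoothTransition_le :
    ∃ M : ℝ, ∀ r, |deriv Real.smoothTransition r| ≤ M := by
  have hc : Continuous (deriv Real.smoothTransition) :=
    (Real.smoothTransition.contDiff (n := 1)).continuous_deriv le_rfl
  obtain ⟨M, hM⟩ := (isCompact_Icc (a := (0 : ℝ)) (b := 1)).exists_bound_of_continuousOn
    hc.continuousOn
  refine ⟨M, fun r => ?_⟩
  have hM0 : 0 ≤ M := (norm_nonneg _).trans (hM 0 (by simp))
  by_cases hr : r ∈ Icc (0 : ℝ) 1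
  · exact hM r hr
  · have h0 : deriv Real.smoothTransition r = 0 := by
      rcases not_and_or.1 hr with h | h
      · rw [not_le] at h
        refine Filter.EventuallyEq.deriv_eq (f := fun _ => (0 : ℝ)) ?_ |>.trans (deriv_const _ _)
        filter_upwards [Iio_mem_nhds h] with s hs
        exact Real.smoothTransition.zero_of_nonpos (le_of_lt hs)
      · rw [not_le] at h
        refine Filter.EventuallyEq.deriv_eq (f := fun _ => (1 : ℝ)) ?_ |>.trans (deriv_const _ _)
        filter_upwards [Ioi_mem_nhds h] with s hs
        exact Real.smoothTransition.one_of_one_le (le_of_lt hs)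
    rw [h0, abs_zero]
    exact hM0

theorem deriv_smoothTransition_of_nonpos {r : ℝ} (hr : r ≤ 0) :
    deriv Real.smoothTransition r = 0 := by
  refine IsLocalMin.deriv_eq_zero (.of_forall fun s => ?_)
  rw [Real.smoothTransition.zero_of_nonpos hr]
  exact Real.smoothTransition.nonneg s

/-- A function measuring how far its argument is outside `[0, m]`. -/
structure IsTruncation (G : ℝ → ℝ) (m M : ℝ) : Prop extends IsC1Lipschitz G M where
  abs_le_one : ∀ r, |G r| ≤ 1
  monotone : Monotone G
  eq_zero : ∀ r ∈ Icc 0 m, G r = 0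
  deriv_eq_zero : ∀ r ∈ Icc 0 m, deriv G r = 0
  pos : ∀ r, m < r → 0 < G r
  neg : ∀ r, r < 0 → G r < 0

theorem exists_isTruncation {m : ℝ} (hm : 0 < m) : ∃ G M, IsTruncation G m M := by
  obtain ⟨M, hM⟩ := exists_abs_deriv_smoothTransition_le
  set θ := Real.smoothTransition
  have hθ : ContDiff ℝ 1 θ := Real.smoothTransition.contDiff
  have hd : ∀ r, HasDerivAt (fun r => θ (r - m) - θ (-r)) (deriv θ (r - m) + deriv θ (-r)) r := by
    intro r
    have h1 : HasDerivAt (fun r => θ (r - m)) (deriv θ (r - m)) r :=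
      ((hθ.differentiable one_ne_zero (r - m)).hasDerivAt).comp_sub_const r m
    have h2 : HasDerivAt (fun r => θ (-r)) (-deriv θ (-r)) r := by
      have := ((hθ.differentiable one_ne_zero (-r)).hasDerivAt).scomp r (hasDerivAt_neg r)
      simpa [Function.comp_def] using this
    have := h1.sub h2
    rwa [sub_neg_eq_add] at this
  have hz : ∀ {r}, r ≤ 0 → θ r = 0 := fun h => Real.smoothTransition.zero_of_nonpos h
  have hp : ∀ {r}, 0 < r → 0 < θ r := fun h => Real.smoothTransition.pos_of_pos h
  -- A smooth step starting at m minus a reflected one starting at 0. Each contributes M to the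
  -- bound on the derivative.
  refine ⟨fun r => θ (r - m) - θ (-r), M + M, ⟨by fun_prop, ?_, fun r => ?_⟩, fun r => ?_, ?_,
    fun r hr => ?_, fun r hr => ?_, fun r hr => ?_, fun r hr => ?_⟩
  · rw [hz (by linarith), hz (by simp), sub_zero]
  · rw [(hd r).deriv]
    exact (abs_add_le _ _).trans (add_le_add (hM _) (hM _))
  · have h1 := Real.smoothTransition.nonneg (r - m)
    have h2 := Real.smoothTransition.le_one (r - m)
    have h3 := Real.smoothTransition.nonneg (-r)
    have h4 := Real.smoothTransition.le_one (-r)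
    exact abs_le.2 ⟨by simp only [θ]; linarith, by simp only [θ]; linarith⟩
  · intro r s hrs
    have h1 : θ (r - m) ≤ θ (s - m) := Real.smoothTransition.monotone (by linarith)
    have h2 : θ (-s) ≤ θ (-r) := Real.smoothTransition.monotone (by linarith)
    linarith
  · rw [hz (by linarith [hr.2]), hz (by linarith [hr.1]), sub_zero]
  · rw [(hd r).deriv, deriv_smoothTransition_of_nonpos (by linarith [hr.2]),
      deriv_smoothTransition_of_nonpos (by linarith [hr.1]), add_zero]
  · rw [hz (show -r ≤ 0 by linarith), sub_zero]
    exact hp (by linarith)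
  · rw [hz (show r - m ≤ 0 by linarith), zero_sub]
    exact neg_neg_of_pos (hp (by linarith))

namespace IsTruncation

variable {G : ℝ → ℝ} {m M : ℝ}

theorem continuous (hG : IsTruncation G m M) : Continuous G := hG.contDiff.continuous

theorem deriv_nonneg (hG : IsTruncation G m M) (r : ℝ) : 0 ≤ deriv G r := hG.monotone.deriv_nonneg

theorem mul_nonneg (hG : IsTruncation G m M) (r : ℝ) : 0 ≤ r * G r := by
  rcases le_total 0 r with h | h
  · exact _root_.mul_nonneg h (hG.zero ▸ hG.monotone h)
  · exact mul_nonneg_of_nonpos_of_nonpos h (hG.zero ▸ hG.monotone h)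

/-- The primitive of a truncation function. -/
noncomputable def primitive (G : ℝ → ℝ) (r : ℝ) : ℝ := ∫ s in (0 : ℝ)..r, G s

theorem primitive_zero : primitive G 0 = 0 := intervalIntegral.integral_same

/-- G is nondecreasing, so its primitive is convex; this is the tangent inequality at b, the
convexity required by `IsParabolicPath.energy_le`. -/
theorem primitive_sub_le (hG : IsTruncation G m M) (a b : ℝ) :
    primitive G b - primitive G a ≤ (b - a) * G b := by
  have hi : ∀ a b, IntervalIntegrable G volume a b := fun a b =>
    hG.continuous.intervalIntegrable a b
  unfold primitive
  rw [intervalIntegral.integral_interval_sub_left (hi _ _) (hi _ _)]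
  rcases le_total a b with h | h
  · have := intervalIntegral.integral_mono_on h (hi a b) intervalIntegrable_const
      fun x hx => hG.monotone hx.2
    rwa [intervalIntegral.integral_const, smul_eq_mul] at this
  · have := intervalIntegral.integral_mono_on h intervalIntegrable_const (hi b a)
      fun x hx => hG.monotone hx.1
    rw [intervalIntegral.integral_const, smul_eq_mul] at this
    rw [intervalIntegral.integral_symm]
    linarith

theorem primitive_nonneg (hG : IsTruncation G m M) (a : ℝ) : 0 ≤ primitive G a := by
  have := hG.primitive_sub_le a 0
  rw [primitive_zero, hG.zero] at this
  linarith

theorem lipschitzWith_primitive (hG : IsTruncation G m M) : LipschitzWith 1 (primitive G) := by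
  refine LipschitzWith.of_dist_le_mul fun a b => ?_
  have h1 := hG.primitive_sub_le a b
  have h2 := hG.primitive_sub_le b a
  have h3 : ∀ x y : ℝ, x * G y ≤ |x| := fun x y => by
    calc x * G y ≤ |x * G y| := le_abs_self _
      _ = |x| * |G y| := abs_mul _ _
      _ ≤ |x| * 1 := by gcongr; exact hG.abs_le_one y
      _ = |x| := mul_one _
  rw [Real.dist_eq, Real.dist_eq, NNReal.coe_one, one_mul, abs_le]
  have h4 := h3 (b - a) b
  have h5 := h3 (a - b) a
  rw [abs_sub_comm] at h4
  constructor <;> linarith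

theorem primitive_eq_zero (hG : IsTruncation G m M) {r : ℝ} (hr : r ∈ Icc 0 m) :
    primitive G r = 0 := by
  refine le_antisymm ?_ (hG.primitive_nonneg r)
  have := hG.primitive_sub_le 0 r
  rw [primitive_zero, hG.eq_zero r hr] at this
  linarith

/-- Outside [0,m], compare r with r/2, or with (m + r)/2: there G is nonzero, so the tangent
inequality and nonnegativity of the primitive force a strictly positive value at r. -/
theorem mem_of_primitive_eq_zero (hG : IsTruncation G m M) {r : ℝ} (hr : primitive G r = 0) :
    r ∈ Icc 0 m := by
  by_contra h
  rcases not_and_or.1 h with h | h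
  · rw [not_le] at h
    have h1 := hG.primitive_sub_le r (r / 2)
    have h2 := hG.primitive_nonneg (r / 2)
    have h3 := mul_pos_of_neg_of_neg (show r / 2 < 0 by linarith) (hG.neg (r / 2) (by linarith))
    have h4 : (r / 2 - r) * G (r / 2) = -(r / 2 * G (r / 2)) := by ring
    linarith
  · rw [not_le] at h
    have h1 := hG.primitive_sub_le r ((m + r) / 2)
    have h2 := hG.primitive_nonneg ((m + r) / 2)
    have h3 := mul_pos (show 0 < (r - m) / 2 by linarith)
      (hG.pos ((m + r) / 2) (by linarith))
    have h4 : ((m + r) / 2 - r) * G ((m + r) / 2) = -((r - m) / 2 * G ((m + r) / 2)) := by ring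
    linarith

end IsTruncation

section MaximumPrinciple

variable {d : ℕ} {Ω ΓE : Set (Sp d)} {T σ β m M : ℝ} {F G : ℝ → ℝ}

theorem continuous_integral_comp [IsFiniteMeasure (muOmega Ω)] {Φ : ℝ → ℝ}
    (hΦ : LipschitzWith 1 Φ) (h0 : Φ 0 = 0) :
    Continuous fun v : Lp ℝ 2 (muOmega Ω) => ∫ x in Ω, Φ (v x) := by
  have h1 : MemLp (fun _ : Sp d => (1 : ℝ)) 2 (muOmega Ω) := memLp_const 1
  have h2 : (fun v : Lp ℝ 2 (muOmega Ω) => ∫ x in Ω, Φ (v x)) =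
      fun v => inner ℝ (h1.toLp _) (hΦ.compLp h0 v) := by
    ext1 v
    rw [L2.inner_def]
    refine integral_congr_ae ?_
    filter_upwards [h1.coeFn_toLp, hΦ.coeFn_compLp h0 v] with x k1 k2
    rw [k1, k2]
    simp
  rw [h2]
  exact continuous_const.inner (hΦ.continuous_compLp h0)

theorem integrable_comp [IsFiniteMeasure (muOmega Ω)] {Φ : ℝ → ℝ} (hΦ : LipschitzWith 1 Φ)
    (h0 : Φ 0 = 0) (v : Lp ℝ 2 (muOmega Ω)) : Integrable (fun x => Φ (v x)) (muOmega Ω) :=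
  ((hΦ.comp_memLp h0 (Lp.memLp v)).integrable (by norm_num))

/-- The gradient of G(u) is G'(u)∇u, which vanishes where u lies in [0,m]; elsewhere F(u) = 0 and
the flux vanishes. So transport never acts on the excess. -/
theorem IsTruncation.fluxDual_compH1_eq_zero (hG : IsTruncation G m M) (hΩ : IsLipschitzDomain Ω)
    (hF : ∀ r, r ∉ Icc 0 m → F r = 0) {u : H1 Ω} {g : Lp (Sp d) 2 (muOmega Ω)}
    (h : ∀ᵐ x ∂(muOmega Ω), F (h1fn u x) = 0 → g x = 0) :
    fluxDual Ω g (hG.toIsC1Lipschitz.compH1 hΩ u) = 0 := by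
  rw [fluxDual_apply, L2.inner_def]
  refine integral_eq_zero_of_ae ?_
  filter_upwards [h, hG.toIsC1Lipschitz.h1grad_compH1 hΩ u] with x h1 h2
  rw [h2]
  by_cases hm : h1fn u x ∈ Icc 0 m
  · simp [hG.deriv_eq_zero _ hm]
  · simp [h1 (hF _ hm)]

/-- Diffusion contributes G'(u)|∇u|² ≥ 0. Outflux contributes r G(r) ≥ 0, with r the trace of u,
because the trace of G(u) is G of the trace. -/
theorem IsTruncation.form_compH1_nonneg (hG : IsTruncation G m M) (hΩ : IsLipschitzDomain Ω)
    (hβ : 0 ≤ β) (u : H1 Ω) : 0 ≤ hΩ.form ΓE σ β u (hG.toIsC1Lipschitz.compH1 hΩ u) := by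
  rw [hΩ.form_apply, hΩ.inner_exitTraceL, L2.inner_def]
  refine add_nonneg (_root_.mul_nonneg (by positivity) (integral_nonneg_of_ae ?_))
    (_root_.mul_nonneg hβ (integral_nonneg_of_ae ?_))
  · filter_upwards [hG.toIsC1Lipschitz.h1grad_compH1 hΩ u] with x h2
    rw [h2, real_inner_smul_right]
    exact _root_.mul_nonneg (hG.deriv_nonneg _) real_inner_self_nonneg
  · filter_upwards [ae_restrict_of_ae (hG.toIsC1Lipschitz.trace_compH1 hΩ u)] with x h2
    rw [h2]
    exact hG.mul_nonneg _

theorem IsTruncation.dual_compH1_nonpos (hG : IsTruncation G m M) (hΩ : IsLipschitzDomain Ω)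
    (hβ : 0 ≤ β) (hF : ∀ r, r ∉ Icc 0 m → F r = 0) {u : H1 Ω} {g : Lp (Sp d) 2 (muOmega Ω)}
    (h : ∀ᵐ x ∂(muOmega Ω), F (h1fn u x) = 0 → g x = 0) {v' : StrongDual ℝ (H1 Ω)}
    (hv' : v' = fluxDual Ω g - hΩ.form ΓE σ β u) : v' (hG.toIsC1Lipschitz.compH1 hΩ u) ≤ 0 := by
  have e1 := hG.fluxDual_compH1_eq_zero hΩ hF h
  have e2 := hG.form_compH1_nonneg (ΓE := ΓE) (σ := σ) hΩ hβ u
  have e3 : v' (hG.toIsC1Lipschitz.compH1 hΩ u) =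
      fluxDual Ω g (hG.toIsC1Lipschitz.compH1 hΩ u) -
        hΩ.form ΓE σ β u (hG.toIsC1Lipschitz.compH1 hΩ u) := by rw [hv']; rfl
  linarith

theorem IsTruncation.integral_primitive_sub_le (hG : IsTruncation G m M)
    (hΩ : IsLipschitzDomain Ω) (a b : H1 Ω) :
    (∫ x in Ω, primitive G (h1fnL Ω b x)) - ∫ x in Ω, primitive G (h1fnL Ω a x) ≤
      inner ℝ (h1fnL Ω b - h1fnL Ω a) (h1fnL Ω (hG.toIsC1Lipschitz.compH1 hΩ b)) := by
  have := hΩ.isFiniteMeasure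
  have hi := fun v : Lp ℝ 2 (muOmega Ω) =>
    integrable_comp hG.lipschitzWith_primitive primitive_zero v
  rw [← integral_sub (hi _) (hi _), inner_h1fn]
  refine integral_mono_ae ((hi _).sub (hi _)) (MemLp.integrable_mul (Lp.memLp _) (Lp.memLp _)) ?_
  filter_upwards [hG.toIsC1Lipschitz.h1fn_compH1 hΩ b, Lp.coeFn_sub (h1fnL Ω b) (h1fnL Ω a)]
    with x h1 h2
  rw [h1, h2]
  exact hG.primitive_sub_le _ _

/-- The energy inequality with Ψ(v) the integral of the primitive of G along v, which starts from
zero. -/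
theorem IsTruncation.integral_primitive_nonpos (hG : IsTruncation G m M)
    (hΩ : IsLipschitzDomain Ω) {u : Lp (H1 Ω) 2 (muTime T)}
    {u' : Lp (StrongDual ℝ (H1 Ω)) 2 (muTime T)} {w : ℝ → Lp ℝ 2 (muOmega Ω)}
    (hp : IsParabolicPath (h1fnL Ω) T u u' w) (h0 : ∀ᵐ x ∂(muOmega Ω), w 0 x ∈ Icc 0 m)
    (hneg : ∀ᵐ t ∂(muTime T), u' t (hG.toIsC1Lipschitz.compH1 hΩ (u t)) ≤ 0) :
    ∀ τ ∈ Ioc 0 T, ∫ x in Ω, primitive G (w τ x) ≤ 0 := by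
  intro τ hτ
  have := hΩ.isFiniteMeasure
  have h1 := hp.energy_le (hG.toIsC1Lipschitz.continuous_compH1 hΩ)
    (hG.toIsC1Lipschitz.norm_compH1_le hΩ) (Ψ := fun v => ∫ x in Ω, primitive G (v x))
    (continuous_integral_comp hG.lipschitzWith_primitive primitive_zero)
    (hG.integral_primitive_sub_le hΩ) hτ
  have h2 : ∫ x in Ω, primitive G (w 0 x) = 0 := by
    refine integral_eq_zero_of_ae ?_
    filter_upwards [h0] with x hx using hG.primitive_eq_zero hx
  have h3 : ∫ t in (0 : ℝ)..τ, u' t (hG.toIsC1Lipschitz.compH1 hΩ (u t)) ≤ 0 := by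
    rw [intervalIntegral.integral_of_le hτ.1.le, integral_Ioc_eq_integral_Ioo]
    exact integral_nonpos_of_ae
      (ae_restrict_of_ae_restrict_of_subset (Ioo_subset_Ioo_right hτ.2) hneg)
  simp only [h2] at h1
  linarith

theorem IsTruncation.ae_mem_Icc_of_integral_nonpos (hG : IsTruncation G m M)
    [IsFiniteMeasure (muOmega Ω)] {v : Lp ℝ 2 (muOmega Ω)}
    (h : ∫ x in Ω, primitive G (v x) ≤ 0) : ∀ᵐ x ∂(muOmega Ω), v x ∈ Icc 0 m := by
  have h5 : ∫ x in Ω, primitive G (v x) = 0 :=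
    le_antisymm h (integral_nonneg fun x => hG.primitive_nonneg _)
  rw [integral_eq_zero_iff_of_nonneg (fun x => hG.primitive_nonneg _)
    (integrable_comp hG.lipschitzWith_primitive primitive_zero v)] at h5
  filter_upwards [h5] with x hx using hG.mem_of_primitive_eq_zero hx

theorem ae_prod_of_ae_ae_swap {α S : Type*} [MeasurableSpace α] [MeasurableSpace S]
    {μ : Measure α} {ν : Measure S} [SFinite μ] [SFinite ν] {p : α × S → Prop}
    (hp : MeasurableSet {z | p z}) (h : ∀ᵐ t ∂ν, ∀ᵐ x ∂μ, p (x, t)) : ∀ᵐ z ∂(μ.prod ν), p z := by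
  have hm : MeasurableSet {z : S × α | p z.swap} := measurable_swap hp
  have h1 : ∀ᵐ z ∂(ν.prod μ), p z.swap := (Measure.ae_prod_iff_ae_ae hm).2 h
  have h2 := (Measure.measurePreserving_swap (μ := μ) (ν := ν)).quasiMeasurePreserving.ae h1
  simpa using h2

/-- The maximum principle. -/
theorem ae_mem_Icc_of_isAdmissible (hΩ : IsLipschitzDomain Ω) (hT : 0 < T) (hβ : 0 ≤ β)
    (hm : 0 < m) (hF : ∀ r, r ∉ Icc 0 m → F r = 0) {ρ₀ : Lp ℝ 2 (muOmega Ω)}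
    (hρ₀ : ∀ᵐ x ∂(muOmega Ω), ρ₀ x ∈ Icc 0 m) {ρ : Lp ℝ 2 (muCyl Ω T)}
    {j : Lp (Sp d) 2 (muCyl Ω T)} (h : IsAdmissible Ω ΓE T σ β ρ₀ ρ j)
    (hj : ∀ᵐ z ∂(muCyl Ω T), F (ρ z) = 0 → j z = 0) :
    ∀ᵐ z ∂(muCyl Ω T), ρ z ∈ Icc 0 m := by
  have := hΩ.isFiniteMeasure
  obtain ⟨u, u', w, hp, heq, hw0, hs⟩ := (isAdmissible_iff hΩ hT).1 h
  obtain ⟨G, M, hG⟩ := exists_isTruncation hm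
  have hC1 := hG.toIsC1Lipschitz
  have hsl : ∀ᵐ t ∂(muTime T), ∀ᵐ x ∂(muOmega Ω), ρ (x, t) = h1fn (u t) x := by
    filter_upwards [isSlice_iff.2 hs, (h1fnL Ω).coeFn_compLpL u] with t h1 h2
    filter_upwards [h1] with x h3
    rw [h3, h2, h1fnL_apply]
  have hneg : ∀ᵐ t ∂(muTime T), u' t (hC1.compH1 hΩ (u t)) ≤ 0 := by
    filter_upwards [heq, fluxL_ae Ω T j, isSlice_sliceL j, ae_ae_of_ae_prod_swap hj, hsl]
      with t h1 h2 h3 h4 h5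
    rw [h2] at h1
    refine hG.dual_compH1_nonpos hΩ hβ hF ?_ h1
    filter_upwards [h3, h4, h5] with x h6 h7 h8
    rw [← h6, ← h8]
    exact h7
  have hzero := hG.integral_primitive_nonpos hΩ hp (hw0 ▸ hρ₀) hneg
  have hfin : ∀ᵐ t ∂(muTime T), ∀ᵐ x ∂(muOmega Ω), ρ (x, t) ∈ Icc 0 m := by
    filter_upwards [hp.ae_eq, hsl, ae_restrict_mem measurableSet_Ioo] with t h1 h2 h3
    have h5 := hG.ae_mem_Icc_of_integral_nonpos (hzero t ⟨h3.1, h3.2.le⟩)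
    rw [h1] at h5
    filter_upwards [h2, h5] with x h6 h7
    rw [h6]
    exact h7
  exact ae_prod_of_ae_ae_swap ((Lp.stronglyMeasurable ρ).measurable measurableSet_Icc) hfin

end MaximumPrinciple

end CrowdControl

/-! ### Convexity and closedness of the constraint; existence and uniqueness of minimizers -/

namespace CrowdControl

theorem IsParabolicPath.smul_add_smul {V H : Type*} [NormedAddCommGroup V] [InnerProductSpace ℝ V]
    [NormedAddCommGroup H] [InnerProductSpace ℝ H] {ι : V →L[ℝ] H} {T : ℝ}
    {u v : Lp V 2 (muTime T)} {u' v' : Lp (StrongDual ℝ V) 2 (muTime T)} {w z : ℝ → H}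
    (hp : IsParabolicPath ι T u u' w) (hq : IsParabolicPath ι T v v' z) (a b : ℝ) :
    IsParabolicPath ι T (a • u + b • v) (a • u' + b • v') (fun t => a • w t + b • z t) := by
  refine ⟨(hp.cont.const_smul a).add (hq.cont.const_smul b), ?_, fun ψ s hs t ht hst => ?_⟩
  · filter_upwards [hp.ae_eq, hq.ae_eq, coeFn_smul_add_smul a b u v] with t h1 h2 h3
    rw [h1, h2, h3, map_add, map_smul, map_smul]
  · have hi : ∀ v' : Lp (StrongDual ℝ V) 2 (muTime T),
        IntervalIntegrable (fun t => v' t ψ) volume s t := fun v' => by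
      rw [intervalIntegrable_iff_integrableOn_Ioo_of_le hst]
      exact (integrableOn_dual_apply_const v' ψ).mono_set (Ioo_subset_Ioo hs.1 ht.2)
    have e : ∫ r in s..t, (a • u' + b • v') r ψ = ∫ r in s..t, (a * u' r ψ + b * v' r ψ) := by
      rw [intervalIntegral.integral_of_le hst, intervalIntegral.integral_of_le hst,
        integral_Ioc_eq_integral_Ioo, integral_Ioc_eq_integral_Ioo]
      refine integral_congr_ae ?_
      filter_upwards [ae_restrict_of_ae_restrict_of_subset (Ioo_subset_Ioo hs.1 ht.2)
        (coeFn_smul_add_smul a b u' v')] with r hr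
      rw [hr]; rfl
    rw [e, intervalIntegral.integral_add ((hi u').const_mul a) ((hi v').const_mul b),
      intervalIntegral.integral_const_mul, intervalIntegral.integral_const_mul,
      ← hp.deriv ψ s hs t ht hst, ← hq.deriv ψ s hs t ht hst, inner_add_left, inner_add_left,
      real_inner_smul_left, real_inner_smul_left, real_inner_smul_left, real_inner_smul_left]
    ring

theorem _root_.ContinuousLinearMap.map_smul_add_smul {X Y : Type*} [NormedAddCommGroup X]
    [NormedSpace ℝ X] [NormedAddCommGroup Y] [NormedSpace ℝ Y] (L : X →L[ℝ] Y) (a b : ℝ)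
    (x y : X) : L (a • x + b • y) = a • L x + b • L y := by
  rw [map_add, map_smul, map_smul]

theorem _root_.LinearIsometry.apply_smul_add_smul_eq {X Y Z : Type*} [NormedAddCommGroup X]
    [NormedSpace ℝ X] [NormedAddCommGroup Y] [NormedSpace ℝ Y] [NormedAddCommGroup Z]
    [NormedSpace ℝ Z] (L : X →ₗᵢ[ℝ] Z) (M : Y →L[ℝ] Z) {x₁ x₂ : X} {y₁ y₂ : Y}
    (h₁ : L x₁ = M y₁) (h₂ : L x₂ = M y₂) (a b : ℝ) :
    L (a • x₁ + b • x₂) = M (a • y₁ + b • y₂) := by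
  rw [M.map_smul_add_smul, map_add, map_smul, map_smul, h₁, h₂]

theorem dualEquation_smul_add_smul {V X : Type*} [NormedAddCommGroup V] [NormedSpace ℝ V]
    [NormedAddCommGroup X] [NormedSpace ℝ X] {α : Type*} [MeasurableSpace α] {μ : Measure α}
    {L : X →L[ℝ] Lp (StrongDual ℝ V) 2 μ} {A : V →L[ℝ] StrongDual ℝ V} {u v : Lp V 2 μ}
    {u' v' : Lp (StrongDual ℝ V) 2 μ} {x y : X} (hu : ∀ᵐ t ∂μ, u' t = L x t - A (u t))
    (hv : ∀ᵐ t ∂μ, v' t = L y t - A (v t)) (a b : ℝ) :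
    ∀ᵐ t ∂μ, (a • u' + b • v') t = L (a • x + b • y) t - A ((a • u + b • v) t) := by
  rw [L.map_smul_add_smul]
  filter_upwards [hu, hv, coeFn_smul_add_smul a b u v, coeFn_smul_add_smul a b u' v',
    coeFn_smul_add_smul a b (L x) (L y)] with t h1 h2 h3 h4 h5
  rw [h3, h4, h5, h1, h2, map_add, map_smul, map_smul, smul_sub, smul_sub]
  abel

section Admissible

variable {d : ℕ} {Ω ΓE : Set (Sp d)} {T σ β m : ℝ} {ρ₀ : Lp ℝ 2 (muOmega Ω)}

theorem IsAdmissible.smul_add_smul (hΩ : IsLipschitzDomain Ω) (hT : 0 < T)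
    {ρ₁ ρ₂ : Lp ℝ 2 (muCyl Ω T)} {j₁ j₂ : Lp (Sp d) 2 (muCyl Ω T)}
    (h₁ : IsAdmissible Ω ΓE T σ β ρ₀ ρ₁ j₁) (h₂ : IsAdmissible Ω ΓE T σ β ρ₀ ρ₂ j₂) {a b : ℝ}
    (hab : a + b = 1) : IsAdmissible Ω ΓE T σ β ρ₀ (a • ρ₁ + b • ρ₂) (a • j₁ + b • j₂) := by
  obtain ⟨u, u', w, hp, he, h0, hs⟩ := (isAdmissible_iff hΩ hT).1 h₁
  obtain ⟨v, v', z, hq, hf, k0, ks⟩ := (isAdmissible_iff hΩ hT).1 h₂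
  refine (isAdmissible_iff hΩ hT).2 ⟨_, _, _, hp.smul_add_smul hq a b, ?_, ?_, ?_⟩
  · exact dualEquation_smul_add_smul he hf a b
  · rw [h0, k0, ← add_smul, hab, one_smul]
  · let S : Lp ℝ 2 (muCyl Ω T) →ₗᵢ[ℝ] Lp (Lp ℝ 2 (muOmega Ω)) 2 (muTime T) := sliceL
    let M : Lp (H1 Ω) 2 (muTime T) →L[ℝ] Lp (Lp ℝ 2 (muOmega Ω)) 2 (muTime T) :=
      (h1fnL Ω).compLpL 2 (muTime T)
    have e₁ : S ρ₁ = M u := hs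
    have e₂ : S ρ₂ = M v := ks
    have := LinearIsometry.apply_smul_add_smul_eq S M e₁ (x₂ := ρ₂) (y₂ := v)
    exact this e₂ a b

/-- Strong convergence of the fluxes makes the right-hand sides converge, and stability gives a
limit solution. Its density is the limit of the densities, by continuity of slicing. -/
theorem isAdmissible_of_tendsto (hΩ : IsLipschitzDomain Ω) (hT : 0 < T) (hσ : 0 < σ) (hβ : 0 ≤ β)
    {ρ : ℕ → Lp ℝ 2 (muCyl Ω T)} {j : ℕ → Lp (Sp d) 2 (muCyl Ω T)} {ρ' : Lp ℝ 2 (muCyl Ω T)}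
    {j' : Lp (Sp d) 2 (muCyl Ω T)} (hρ : Tendsto ρ atTop (𝓝 ρ')) (hj : Tendsto j atTop (𝓝 j'))
    (h : ∀ n, IsAdmissible Ω ΓE T σ β ρ₀ (ρ n) (j n)) : IsAdmissible Ω ΓE T σ β ρ₀ ρ' j' := by
  choose u u' w hp he h0 hs using fun n => (isAdmissible_iff hΩ hT).1 (h n)
  have hα : 0 < σ ^ 2 / 2 := by positivity
  obtain ⟨v, v', z, hv, h1, h2, h3⟩ := exists_isParabolicPath_of_tendsto hT hα hα
    (hΩ.le_form ΓE σ hβ) hp he (((fluxL Ω T).continuous.tendsto j').comp hj)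
    (tendsto_const_nhds.congr fun n => (h0 n).symm)
  refine (isAdmissible_iff hΩ hT).2 ⟨v, v', z, h1, h2, h3, ?_⟩
  refine tendsto_nhds_unique ((sliceL.continuous.tendsto ρ').comp hρ) ?_
  exact ((((h1fnL Ω).compLpL 2 (muTime T)).continuous.tendsto v).comp hv).congr
    fun n => (hs n).symm

theorem exists_isAdmissible_zero (hΩ : IsLipschitzDomain Ω) (hT : 0 < T) (hσ : 0 < σ)
    (hβ : 0 ≤ β) (ΓE : Set (Sp d)) (ρ₀ : Lp ℝ 2 (muOmega Ω)) :
    ∃ ρ : Lp ℝ 2 (muCyl Ω T), IsAdmissible Ω ΓE T σ β ρ₀ ρ 0 := by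
  have hα : 0 < σ ^ 2 / 2 := by positivity
  obtain ⟨u, u', w, hp, he, h0⟩ := exists_isParabolicPath hT hα hα (hΩ.le_form ΓE σ hβ)
    (hΩ.form_symm ΓE σ β) (hΩ.form_nonneg ΓE σ hβ) hΩ.denseRange_h1fnL ρ₀
  obtain ⟨ρ, hρ⟩ := surjective_sliceL (μ := muOmega Ω) ((h1fnL Ω).compLpL 2 (muTime T) u)
  refine ⟨ρ, (isAdmissible_iff hΩ hT).2 ⟨u, u', w, hp, ?_, h0, hρ⟩⟩
  rwa [map_zero]

end Admissible

section Minimizer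

variable {d : ℕ} {Ω ΓE : Set (Sp d)} {T σ β m : ℝ} {ρ₀ : Lp ℝ 2 (muOmega Ω)} {F E : ℝ → ℝ}

/-- The admissible pairs with density in `[0, m]` and cost at most `c`. -/
def sublevel (Ω ΓE : Set (Sp d)) (T σ β m : ℝ) (ρ₀ : Lp ℝ 2 (muOmega Ω)) (F E : ℝ → ℝ)
    (c : ℝ≥0∞) : Set (WithLp 2 (Lp ℝ 2 (muCyl Ω T) × Lp (Sp d) 2 (muCyl Ω T))) :=
  {p | IsAdmissible Ω ΓE T σ β ρ₀ p.fst p.snd ∧ (∀ᵐ z ∂(muCyl Ω T), p.fst z ∈ Icc 0 m) ∧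
    totalCost F E p.fst p.snd ≤ c}

theorem isClosed_sublevel (hΩ : IsLipschitzDomain Ω) (hT : 0 < T) (hσ : 0 < σ) (hβ : 0 ≤ β)
    (hF : IsConcaveMobility F m) (hE : Continuous E) (hE0 : ∀ r ∈ Icc 0 m, 0 ≤ E r) (c : ℝ≥0∞) :
    IsClosed (sublevel Ω ΓE T σ β m ρ₀ F E c) := by
  refine IsSeqClosed.isClosed fun p q hp hq => ?_
  have h1 : Tendsto (fun n => (p n).fst) atTop (𝓝 q.fst) :=
    ((WithLp.prod_continuous_ofLp 2 _ _).fst.tendsto q).comp hq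
  have h2 : Tendsto (fun n => (p n).snd) atTop (𝓝 q.snd) :=
    ((WithLp.prod_continuous_ofLp 2 _ _).snd.tendsto q).comp hq
  exact ⟨isAdmissible_of_tendsto hΩ hT hσ hβ h1 h2 fun n => (hp n).1,
    hF.totalCost_le_of_tendsto hE hE0 h1 h2 (fun n => (hp n).2.1) fun n => (hp n).2.2⟩

theorem convex_sublevel (hΩ : IsLipschitzDomain Ω) (hT : 0 < T)
    (hF : IsConcaveMobility F m) (hE : Continuous E) (hEc : ConvexOn ℝ (Icc 0 m) E)
    (hE0 : ∀ r ∈ Icc 0 m, 0 ≤ E r) (c : ℝ≥0∞) :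
    Convex ℝ (sublevel Ω ΓE T σ β m ρ₀ F E c) := by
  intro p hp q hq a b ha hb hab
  refine ⟨hp.1.smul_add_smul hΩ hT hq.1 hab, ae_mem_Icc_smul_add_smul hp.2.1 hq.2.1 ha hb hab, ?_⟩
  refine (hF.totalCost_convex hE hEc hE0 hp.2.1 hq.2.1 ha hb hab).trans ?_
  calc _ ≤ ENNReal.ofReal a * c + ENNReal.ofReal b * c :=
        add_le_add (mul_le_mul' le_rfl hp.2.2) (mul_le_mul' le_rfl hq.2.2)
    _ = c := by rw [← add_mul, ← ENNReal.ofReal_add ha hb, hab, ENNReal.ofReal_one, one_mul]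

theorem isBounded_sublevel (hΩ : IsLipschitzDomain Ω) (hm : 0 ≤ m) (hF : IsConcaveMobility F m) {C : ℝ}
    (hC : ∀ r, |F r| ≤ C) {c : ℝ≥0∞} (hc : c ≠ ⊤) :
    Bornology.IsBounded (sublevel Ω ΓE T σ β m ρ₀ F E c) := by
  have := hΩ.isFiniteMeasure
  set C' := max C 1
  have hC' : ∀ r, |F r| ≤ C' := fun r => (hC r).trans (le_max_left _ _)
  have hC0 : 0 < C' := lt_max_of_lt_right one_pos
  set R := measureUnivNNReal (muCyl Ω T) ^ (2 : ℝ≥0∞).toReal⁻¹ * m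
  refine (isBounded_iff_forall_norm_le).2 ⟨Real.sqrt (R ^ 2 + 2 * C' * c.toReal), fun p hp => ?_⟩
  refine Real.le_sqrt_of_sq_le ?_
  rw [WithLp.prod_norm_sq_eq_of_L2]
  have h2 := hF.norm_sq_le_of_totalCost_le hC0 hC' hp.2.1 ENNReal.toReal_nonneg
    (hp.2.2.trans (ENNReal.ofReal_toReal hc).ge)
  have h1 : ‖p.fst‖ ≤ R := by
    refine Lp.norm_le_of_ae_bound hm ?_
    filter_upwards [hp.2.1] with z hz
    rw [Real.norm_of_nonneg hz.1]
    exact hz.2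
  have h3 : ‖p.fst‖ ^ 2 ≤ R ^ 2 := by gcongr
  exact add_le_add h3 h2

/-- Pairs of finite cost have density in `[0, m]`. -/
theorem ae_mem_Icc_of_cost_lt_top (hΩ : IsLipschitzDomain Ω) (hT : 0 < T) (hβ : 0 ≤ β)
    (hm : 0 < m) (hF : IsConcaveMobility F m) (hE : ContDiff ℝ 1 E) (hEc : ConvexOn ℝ univ E)
    (hE0 : ∀ r ∈ Icc 0 m, 0 ≤ E r) (hρ₀ : ∀ᵐ x ∂(muOmega Ω), ρ₀ x ∈ Icc 0 m)
    {ρ : Lp ℝ 2 (muCyl Ω T)} {j : Lp (Sp d) 2 (muCyl Ω T)}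
    (h : IsAdmissible Ω ΓE T σ β ρ₀ ρ j) (hc : cost Ω T F E ρ j < ⊤) :
    ∀ᵐ z ∂(muCyl Ω T), ρ z ∈ Icc 0 m := by
  have := hΩ.isFiniteMeasure
  exact ae_mem_Icc_of_isAdmissible hΩ hT hβ hm hF.zero hρ₀ h
    (ae_eq_zero_of_cost_lt_top hF hE hEc (hE0 0 ⟨le_rfl, hm.le⟩) hc)

/-- With j = 0 the kinetic part vanishes. The maximum principle applies and keeps ρ in [0,m], where
E is bounded. -/
theorem exists_totalCost_ne_top (hΩ : IsLipschitzDomain Ω) (hT : 0 < T) (hσ : 0 < σ)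
    (hβ : 0 ≤ β) (hm : 0 < m) (hF : IsConcaveMobility F m) (hE : Continuous E)
    (hρ₀ : ∀ᵐ x ∂(muOmega Ω), ρ₀ x ∈ Icc 0 m) :
    ∃ (ρ : Lp ℝ 2 (muCyl Ω T)) (j : Lp (Sp d) 2 (muCyl Ω T)),
      IsAdmissible Ω ΓE T σ β ρ₀ ρ j ∧ (∀ᵐ z ∂(muCyl Ω T), ρ z ∈ Icc 0 m) ∧
        totalCost F E ρ j ≠ ⊤ := by
  have := hΩ.isFiniteMeasure
  obtain ⟨ρ, hρ⟩ := exists_isAdmissible_zero hΩ hT hσ hβ ΓE ρ₀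
  have h0 := Lp.coeFn_zero (Sp d) 2 (muCyl Ω T)
  have hmem := ae_mem_Icc_of_isAdmissible hΩ hT hβ hm hF.zero hρ₀ hρ
    (h0.mono fun z hz _ => hz)
  obtain ⟨C, hC⟩ := (isCompact_Icc (a := (0 : ℝ)) (b := m)).exists_bound_of_continuousOn
    hE.continuousOn
  refine ⟨ρ, 0, hρ, hmem, ne_top_of_le_ne_top (b := ∫⁻ _, ENNReal.ofReal C ∂(muCyl Ω T)) ?_ ?_⟩
  · rw [lintegral_const]
    exact ENNReal.mul_ne_top ENNReal.ofReal_ne_top (measure_ne_top _ _)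
  · refine lintegral_mono_ae ?_
    filter_upwards [h0, hmem] with z h1 h2
    rw [h1]
    have h3 : kineticDensity F (0 : Sp d) (ρ z) = 0 := by simp [kineticDensity]
    change costDensity F E (0 : Sp d) (ρ z) ≤ _
    rw [costDensity, h3, mul_zero, zero_add]
    refine ENNReal.ofReal_le_ofReal ?_
    have h4 := hC _ h2
    have h5 := le_abs_self (E (ρ z))
    rw [Real.norm_eq_abs] at h4
    have h6 := abs_nonneg (E (ρ z))
    linarith

/-- The infimum S is taken over densities in [0,m]. Competitors of infinite cost are irrelevant, and
those of finite cost have their density in [0,m] by the maximum principle. -/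
theorem exists_isMinimizer (hΩ : IsLipschitzDomain Ω) (hT : 0 < T) (hσ : 0 < σ)
    (hβ : 0 ≤ β) (hm : 0 < m) (hF : IsConcaveMobility F m) {C : ℝ} (hC : ∀ r, |F r| ≤ C)
    (hE : ContDiff ℝ 1 E) (hEc : ConvexOn ℝ univ E) (hE0 : ∀ r ∈ Icc 0 m, 0 ≤ E r)
    (hρ₀ : ∀ᵐ x ∂(muOmega Ω), ρ₀ x ∈ Icc 0 m) :
    ∃ (ρ : Lp ℝ 2 (muCyl Ω T)) (j : Lp (Sp d) 2 (muCyl Ω T)),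
      IsMinimizer Ω ΓE T σ β ρ₀ F E ρ j ∧ cost Ω T F E ρ j < ⊤ := by
  set S : Set ℝ≥0∞ := {c | ∃ (ρ : Lp ℝ 2 (muCyl Ω T)) (j : Lp (Sp d) 2 (muCyl Ω T)),
      IsAdmissible Ω ΓE T σ β ρ₀ ρ j ∧ (∀ᵐ z ∂(muCyl Ω T), ρ z ∈ Icc 0 m) ∧
        totalCost F E ρ j = c}
  have hEm : ConvexOn ℝ (Icc 0 m) E := hEc.subset (subset_univ _) (convex_Icc 0 m)
  obtain ⟨ρ₁, j₁, a1, a2, a3⟩ := exists_totalCost_ne_top (T := T) (ΓE := ΓE) hΩ hT hσ hβ hm hF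
    hE.continuous hρ₀
  have hinf : sInf S ≠ ⊤ := ne_top_of_le_ne_top a3 (sInf_le ⟨ρ₁, j₁, a1, a2, rfl⟩)
  have hc : ∀ n : ℕ, sInf S + ((n : ℝ≥0∞) + 1)⁻¹ ≠ ⊤ := fun n =>
    ENNReal.add_ne_top.2 ⟨hinf, ENNReal.inv_ne_top.2 (by simp)⟩
  -- The shift n + 1 keeps even the first level finite, as boundedness of the first set requires.
  obtain ⟨p, hp⟩ := nonempty_iInter_of_convex
    (fun n : ℕ => sublevel Ω ΓE T σ β m ρ₀ F E (sInf S + ((n : ℝ≥0∞) + 1)⁻¹))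
    (fun n => by
      obtain ⟨c, ⟨ρ, j, h1, h2, h3⟩, h4⟩ := exists_lt_of_csInf_lt
        (show S.Nonempty from ⟨_, ρ₁, j₁, a1, a2, rfl⟩)
        (ENNReal.lt_add_right hinf (show ((n : ℝ≥0∞) + 1)⁻¹ ≠ 0 by simp))
      exact ⟨WithLp.toLp 2 (ρ, j), h1, h2, by rw [← h3] at h4; exact h4.le⟩)
    (fun n => isClosed_sublevel hΩ hT hσ hβ hF hE.continuous hE0 _)
    (fun n => convex_sublevel hΩ hT hF hE.continuous hEm hE0 _)
    (fun k n hkn p hp => ⟨hp.1, hp.2.1, hp.2.2.trans (by gcongr)⟩)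
    (isBounded_sublevel hΩ hm.le hF hC (hc 0))
  rw [mem_iInter] at hp
  have hle : totalCost F E p.fst p.snd ≤ sInf S := by
    have ht : Tendsto (fun n : ℕ => sInf S + ((n : ℝ≥0∞) + 1)⁻¹) atTop (𝓝 (sInf S + 0)) := by
      refine tendsto_const_nhds.add ?_
      have := (tendsto_add_atTop_iff_nat 1).2 ENNReal.tendsto_inv_nat_nhds_zero
      simpa using this
    rw [add_zero] at ht
    exact ge_of_tendsto' ht fun n => (hp n).2.2
  have hcp := cost_eq_totalCost (j := p.snd) (F := F) hE.continuous hE0 (hp 0).2.1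
  refine ⟨p.fst, p.snd, ⟨(hp 0).1, fun ρ' j' h' => ?_⟩, ?_⟩
  · by_cases hlt : cost Ω T F E ρ' j' < ⊤
    · have hmem := ae_mem_Icc_of_cost_lt_top hΩ hT hβ hm hF hE hEc hE0 hρ₀ h' hlt
      rw [hcp, cost_eq_totalCost hE.continuous hE0 hmem, EReal.coe_ennreal_le_coe_ennreal_iff]
      exact hle.trans (sInf_le ⟨ρ', j', h', hmem, rfl⟩)
    · rw [not_lt, top_le_iff] at hlt
      rw [hlt]; exact le_top
  · rw [hcp, lt_top_iff_ne_top]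
    exact fun h => ne_top_of_le_ne_top hinf hle (EReal.coe_ennreal_eq_top_iff.1 h)

/-- The midpoint is admissible because the constraint is affine, so it costs at least as much as
either minimizer; equality in the convexity inequality follows. -/
theorem IsMinimizer.unique (hΩ : IsLipschitzDomain Ω) (hT : 0 < T)
    (hβ : 0 ≤ β) (hm : 0 < m) (hF : IsConcaveMobility F m)
    (hE : ContDiff ℝ 1 E) (hEc : ConvexOn ℝ univ E) (hEs : StrictConvexOn ℝ (Icc 0 m) E)
    (hE0 : ∀ r ∈ Icc 0 m, 0 ≤ E r) (hρ₀ : ∀ᵐ x ∂(muOmega Ω), ρ₀ x ∈ Icc 0 m)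
    {ρ₁ ρ₂ : Lp ℝ 2 (muCyl Ω T)} {j₁ j₂ : Lp (Sp d) 2 (muCyl Ω T)}
    (h₁ : IsMinimizer Ω ΓE T σ β ρ₀ F E ρ₁ j₁) (h₂ : IsMinimizer Ω ΓE T σ β ρ₀ F E ρ₂ j₂)
    (hlt : cost Ω T F E ρ₁ j₁ < ⊤) : ρ₁ = ρ₂ ∧ j₁ = j₂ := by
  have hhs : (1 / 2 : ℝ) + 1 / 2 = 1 := by norm_num
  have hh : (0 : ℝ) ≤ 1 / 2 := by norm_num
  have heq : cost Ω T F E ρ₁ j₁ = cost Ω T F E ρ₂ j₂ :=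
    le_antisymm (h₁.2 _ _ h₂.1) (h₂.2 _ _ h₁.1)
  have m₁ := ae_mem_Icc_of_cost_lt_top hΩ hT hβ hm hF hE hEc hE0 hρ₀ h₁.1 hlt
  have m₂ := ae_mem_Icc_of_cost_lt_top hΩ hT hβ hm hF hE hEc hE0 hρ₀ h₂.1 (heq ▸ hlt)
  have mm := ae_mem_Icc_smul_add_smul m₁ m₂ hh hh hhs
  have hle := h₁.2 _ _ (h₁.1.smul_add_smul hΩ hT h₂.1 hhs)
  rw [cost_eq_totalCost hE.continuous hE0 m₁] at hlt heq hle
  rw [cost_eq_totalCost hE.continuous hE0 m₂, EReal.coe_ennreal_eq_coe_ennreal_iff] at heq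
  rw [cost_eq_totalCost hE.continuous hE0 mm, EReal.coe_ennreal_le_coe_ennreal_iff] at hle
  exact hF.eq_of_totalCost_midpoint hE.continuous hEs hE0 m₁ m₂
    (fun h => hlt.ne (EReal.coe_ennreal_eq_top_iff.2 h)) heq hle

end Minimizer

end CrowdControl

theorem mainTheorem2 (d : ℕ) (hd : d = 1 ∨ d = 2)
    (Ω : Set (CrowdControl.Sp d)) (hΩ_open : IsOpen Ω) (hΩ_conn : IsConnected Ω)
    (hΩ_bdd : Bornology.IsBounded Ω) (hΩ_lip : CrowdControl.HasLipschitzBoundary Ω)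
    (ΓE : Set (CrowdControl.Sp d)) (hΓE_sub : ΓE ⊆ frontier Ω) (hΓE_meas : MeasurableSet ΓE)
    (T σ β ρmax : ℝ) (hT : 0 < T) (hσ : 0 < σ) (hβ : 0 ≤ β) (hρmax : 0 < ρmax)
    (ρ₀ : Lp ℝ 2 (CrowdControl.muOmega Ω))
    (hρ₀ : ∀ᵐ x ∂(CrowdControl.muOmega Ω), ρ₀ x ∈ Icc 0 ρmax)
    (F E : ℝ → ℝ)
    (hF_C1 : ContDiffOn ℝ 1 F (Icc 0 ρmax)) (hF_bdd : ∃ C : ℝ, ∀ r, |F r| ≤ C)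
    (hF_nonneg : ∀ r ∈ Icc 0 ρmax, 0 ≤ F r) (hF_pos : ∀ r ∈ Ioo 0 ρmax, 0 < F r)
    (hF_zero : ∀ r, r ∉ Icc 0 ρmax → F r = 0) (hF_conc : ConcaveOn ℝ (Icc 0 ρmax) F)
    (hE_C1 : ContDiff ℝ 1 E) (hE_nonneg : ∀ r ∈ Icc 0 ρmax, 0 ≤ E r)
    (hE_conv : ConvexOn ℝ univ E) :
    (∃ (ρ : Lp ℝ 2 (CrowdControl.muCyl Ω T))
        (j : Lp (CrowdControl.Sp d) 2 (CrowdControl.muCyl Ω T)),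
      CrowdControl.IsMinimizer Ω ΓE T σ β ρ₀ F E ρ j ∧
      CrowdControl.cost Ω T F E ρ j < ⊤ ∧
      MemLp ρ ⊤ (CrowdControl.muCyl Ω T) ∧
      ∀ᵐ z ∂(CrowdControl.muCyl Ω T), ρ z ∈ Icc 0 ρmax) ∧
    (StrictConvexOn ℝ (Icc 0 ρmax) E →
      ∃! p : Lp ℝ 2 (CrowdControl.muCyl Ω T) ×
          Lp (CrowdControl.Sp d) 2 (CrowdControl.muCyl Ω T),
        CrowdControl.IsMinimizer Ω ΓE T σ β ρ₀ F E p.1 p.2) := by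
  have hΩ : CrowdControl.IsLipschitzDomain Ω := ⟨hΩ_open, hΩ_bdd, hΩ_lip⟩
  have hF : CrowdControl.IsConcaveMobility F ρmax :=
    ⟨hF_C1.continuousOn, hF_nonneg, hF_zero, hF_conc⟩
  obtain ⟨C, hC⟩ := hF_bdd
  obtain ⟨ρ, j, hmin, hlt⟩ := CrowdControl.exists_isMinimizer (ΓE := ΓE) hΩ hT hσ hβ hρmax hF hC
    hE_C1 hE_conv hE_nonneg hρ₀
  have hmem := CrowdControl.ae_mem_Icc_of_cost_lt_top hΩ hT hβ hρmax hF hE_C1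
    hE_conv hE_nonneg hρ₀ hmin.1 hlt
  refine ⟨⟨ρ, j, hmin, hlt, ?_, hmem⟩, fun hEs => ⟨(ρ, j), hmin, fun q hq => ?_⟩⟩
  · refine memLp_top_of_bound (Lp.aestronglyMeasurable ρ) ρmax ?_
    filter_upwards [hmem] with z hz
    rw [Real.norm_of_nonneg hz.1]
    exact hz.2
  · obtain ⟨h1, h2⟩ := CrowdControl.IsMinimizer.unique hΩ hT hβ hρmax hF hE_C1
      hE_conv hEs hE_nonneg hρ₀ hmin hq hlt
    exact Prod.ext h1.symm h2.symm
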